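/- Let $p\ge 1$ and let $\{0,\dots,p\}$ be partitioned into $\{q_1<\dots<q_m\}$ and $\{r_1<\dots<r_n\}$ with $m,n\ge 1$ (so $m+n=p+1$). For a real sequence $(X_t)$, let $M_t\in\mathbb{R}^m$ and $N_t\in\mathbb{R}^n$ be the vectors of the coordinates with indices $q_1,\dots,q_m$ and $r_1,\dots,r_n$, respectively, of $(1,X_{t-1}^2,\dots,X_{t-p}^2)'$ (coordinates numbered from $0$). Let $(\xi_t)$ be i.i.d. $\mathcal{N}(0,1)$. For $\alpha:[0,1]\to\mathbb{R}^m$, $\beta\in\mathbb{R}^n$ and fixed $x_1,\dots,x_p\in\mathbb{R}$, let $\mathbb{P}_{T,\alpha,\beta}$ be the conditional law of $(X_{p+1},\dots,X_T)$ given $X_1=x_1,\dots,X_p=x_p$ in the model $$X_t=\xi_t\sigma_t,\qquad \sigma_t^2=M_t'\alpha(t/T)+N_t'\beta,\qquad p+1\le t\le T,$$ (whose noise $\xi_{p+1},\dots,\xi_T$ is independent of $X_1,\dots,X_p$). Let $\alpha:[0,1]\to\mathbb{R}^m$ be Lipschitz with positive coordinates on $[0,1]$, and let $\beta\in\mathbb{R}^n$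 have positive coordinates. Write $a_{q_i}(u)=\alpha_i(u)$ and $a_{r_j}(u)=\beta_j$, and assume that $\sup_{u\in[0,1]}\sum_{j=1}^p a_j(u)<1$. For $u\in[0,1]$ let $(X_t(u))_{t\in\mathbb{Z}}$ be the stationary ARCH process with noise $\xi$ and coefficients $(\alpha(u),\beta)$, that is, the strictly stationary process such that $X_t(u)$ is a function of $(\xi_s)_{s\le t}$ and $X_t(u)=\xi_t\sigma_t(u)$ with $\sigma_t(u)^2=M_t(u)'\alpha(u)+N_t(u)'\beta$, where $M_t(u),N_t(u)$ are built from $X(u)$. Let $g:[0,1]\to\mathbb{R}^m$ be Lipschitz, let $h\in\mathbb{R}^n$, and set $$\Vert(g,h)\Vert_{\mathbb{H}}^2=\frac12\int_0^1\begin{pmatrix}g(u)\\h\end{pmatrix}'E(u)\begin{pmatrix}g(u)\\h\end{pmatrix}du,\qquad E(u)=\mathbb{E}\left[\frac{1}{\sigma_1(u)^4}\begin{pmatrix}M_1(u)\\N_1(u)\end{pmatrix}\begin{pmatrix}M_1(u)\\N_1(u)\end{pmatrix}'\right],$$ $$\Delta_{T,g,h}=\frac{1}{2\sqrt T}\sum_{t=p+1}^T\frac{X_t^2-\sigma_t^2}{\sigma_t^4}\left(M_t'g(t/T)+N_t'h\right).$$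 Then, for all fixed initial values $x_1,\dots,x_p$, as $T\to\infty$: $\mathbb{P}_{T,\alpha+g/\sqrt T,\beta+h/\sqrt T}\ll\mathbb{P}_{T,\alpha,\beta}$ for all large $T$, $$\log\frac{d\mathbb{P}_{T,\alpha+g/\sqrt T,\beta+h/\sqrt T}}{d\mathbb{P}_{T,\alpha,\beta}}(X_{p+1},\dots,X_T)=\Delta_{T,g,h}-\frac12\Vert(g,h)\Vert_{\mathbb{H}}^2+o_{\mathbb{P}_{T,\alpha,\beta}}(1),$$ and, under $\mathbb{P}_{T,\alpha,\beta}$, $\Delta_{T,g,h}$ converges in distribution to $\mathcal{N}(0,\Vert(g,h)\Vert_{\mathbb{H}}^2)$. -/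

import Mathlib

open MeasureTheory ProbabilityTheory Filter Topology
open scoped NNReal ENNReal Matrix

noncomputable section

namespace TvARCH

/-- The full regressor `(1, X_{t-1}², …, X_{t-p}²)`, as a function of the vector of past values
`v = (X_{t-1}, …, X_{t-p})`. -/
def regressor {p : ℕ} (v : Fin p → ℝ) : Fin (p + 1) → ℝ :=
  Fin.cons 1 (fun j => v j ^ 2)

/-- The subvector of the regressor with indices `s_1, …, s_k` in `{0, …, p}`. For `s = q` it is the
vector `M_t` and for `s = r` it is the vector `N_t`. -/
def subvec {p k : ℕ} (s : Fin k → Fin (p + 1)) (v : Fin p → ℝ) : Fin k → ℝ :=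
  fun i => regressor v (s i)

/-- The conditional variance `σ_t² = M_t' a + N_t' b`. -/
def sigmaSq {p m n : ℕ} (q : Fin m → Fin (p + 1)) (r : Fin n → Fin (p + 1))
    (a : Fin m → ℝ) (b : Fin n → ℝ) (v : Fin p → ℝ) : ℝ :=
  subvec q v ⬝ᵥ a + subvec r v ⬝ᵥ b

/-- The sum of the lag coefficients `a_1 + … + a_p` (the intercept, of index `0`, is left out),
where `a_{q_i} = a i` and `a_{r_i} = b i`. -/
def lagCoeffSum {p m n : ℕ} (q : Fin m → Fin (p + 1)) (r : Fin n → Fin (p + 1))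
    (a : Fin m → ℝ) (b : Fin n → ℝ) : ℝ :=
  ∑ i with q i ≠ 0, a i + ∑ i with r i ≠ 0, b i

/-- All coordinates are Lipschitz continuous on `[0,1]`. -/
def IsLipschitzVec {m : ℕ} (f : ℝ → Fin m → ℝ) : Prop :=
  ∀ i, ∃ K : ℝ≥0, LipschitzOnWith K (fun u => f u i) (Set.Icc 0 1)

/-! ### The tv-ARCH recursion and the conditional law of the sample -/

/-- The sequence `X_1, …, X_T` with given initial values `x = (X_1, …, X_p)` and given
`y = (X_{p+1}, …, X_T)`; it is `0` at all other times. -/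
def path {p T : ℕ} (x : Finset.Icc 1 p → ℝ) (y : Finset.Icc (p + 1) T → ℝ) (t : ℕ) : ℝ :=
  if h : t ∈ Finset.Icc 1 p then x ⟨t, h⟩
  else if h : t ∈ Finset.Icc (p + 1) T then y ⟨t, h⟩ else 0

/-- The past values `(X_{t-1}, …, X_{t-p})`. -/
def past (p : ℕ) (X : ℕ → ℝ) (t : ℕ) : Fin p → ℝ := fun j => X (t - 1 - j)

/-- The solution of the tv-ARCH recursion `X_t = ξ_t σ_t`, `σ_t² = M_t' α(t/T) + N_t' β`,
`p + 1 ≤ t ≤ T`, with initial values `X_t = x_t` for `1 ≤ t ≤ p`. -/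
def solution {p m n : ℕ} (q : Fin m → Fin (p + 1)) (r : Fin n → Fin (p + 1)) (T : ℕ)
    (α : ℝ → Fin m → ℝ) (β : Fin n → ℝ) (x : Finset.Icc 1 p → ℝ)
    (ξ : Finset.Icc (p + 1) T → ℝ) (t : ℕ) : ℝ :=
  if h : t ∈ Finset.Icc 1 p then x ⟨t, h⟩
  else if h : t ∈ Finset.Icc (p + 1) T then
    ξ ⟨t, h⟩ * √(sigmaSq q r (α (t / T)) β
      (fun j : Fin p => solution q r T α β x ξ (t - 1 - j)))
  else 0
termination_by t
decreasing_by
  rw [Finset.mem_Icc] at h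
  omega

/-- The conditional law `P_{T,α,β}` of `(X_{p+1}, …, X_T)` given `X_1 = x_1, …, X_p = x_p`, for
i.i.d. standard Gaussian noise (independent of the initial values). -/
def condLaw {p m n : ℕ} (q : Fin m → Fin (p + 1)) (r : Fin n → Fin (p + 1)) (T : ℕ)
    (α : ℝ → Fin m → ℝ) (β : Fin n → ℝ) (x : Finset.Icc 1 p → ℝ) :
    Measure (Finset.Icc (p + 1) T → ℝ) :=
  (Measure.pi (fun _ : Finset.Icc (p + 1) T => gaussianReal 0 1)).map
    (fun ξ t => solution q r T α β x ξ t)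

lemma measurable_sigmaSq {p m n : ℕ} (q : Fin m → Fin (p + 1)) (r : Fin n → Fin (p + 1))
    (a : Fin m → ℝ) (b : Fin n → ℝ) : Measurable (sigmaSq q r a b) := by
  have h : ∀ k : Fin (p + 1), Measurable fun v : Fin p → ℝ => regressor v k := by
    intro k
    refine Fin.cases ?_ (fun j => ?_) k
    · simp [regressor]
    · simp only [regressor, Fin.cons_succ]
      fun_prop
  unfold sigmaSq subvec dotProduct
  fun_prop

lemma measurable_solution {p m n : ℕ} (q : Fin m → Fin (p + 1)) (r : Fin n → Fin (p + 1)) (T : ℕ)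
    (α : ℝ → Fin m → ℝ) (β : Fin n → ℝ) (x : Finset.Icc 1 p → ℝ) (t : ℕ) :
    Measurable fun ξ => solution q r T α β x ξ t := by
  induction t using Nat.strong_induction_on with
  | _ t ih =>
    by_cases h1 : t ∈ Finset.Icc 1 p
    · have : (fun ξ => solution q r T α β x ξ t) = fun _ => x ⟨t, h1⟩ := by
        funext ξ; rw [solution, dif_pos h1]
      rw [this]; exact measurable_const
    · by_cases h2 : t ∈ Finset.Icc (p + 1) T
      · have : (fun ξ => solution q r T α β x ξ t) = fun ξ =>
            ξ ⟨t, h2⟩ * √(sigmaSq q r (α (t / T)) β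
              (fun j : Fin p => solution q r T α β x ξ (t - 1 - j))) := by
          funext ξ; rw [solution, dif_neg h1, dif_pos h2]
        rw [this]
        refine (measurable_pi_apply _).mul (Measurable.sqrt ?_)
        refine (measurable_sigmaSq q r _ β).comp (measurable_pi_lambda _ fun j => ih _ ?_)
        rw [Finset.mem_Icc] at h2
        omega
      · have : (fun ξ => solution q r T α β x ξ t) = fun _ => 0 := by
          funext ξ; rw [solution, dif_neg h1, dif_neg h2]
        rw [this]; exact measurable_const

instance isProbabilityMeasure_condLaw {p m n : ℕ} (q : Fin m → Fin (p + 1))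
    (r : Fin n → Fin (p + 1)) (T : ℕ) (α : ℝ → Fin m → ℝ) (β : Fin n → ℝ)
    (x : Finset.Icc 1 p → ℝ) : IsProbabilityMeasure (condLaw q r T α β x) :=
  Measure.isProbabilityMeasure_map
    (measurable_pi_lambda (fun ξ (t : Finset.Icc (p + 1) T) => solution q r T α β x ξ t)
      fun t => measurable_solution q r T α β x t).aemeasurable

/-- The score `Δ_{T,g,h}`, as a function of the sample `y = (X_{p+1}, …, X_T)`, for the initial
values `x = (X_1, …, X_p)`. -/
def score {p m n : ℕ} (q : Fin m → Fin (p + 1)) (r : Fin n → Fin (p + 1)) (T : ℕ)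
    (α : ℝ → Fin m → ℝ) (β : Fin n → ℝ) (g : ℝ → Fin m → ℝ) (h : Fin n → ℝ)
    (x : Finset.Icc 1 p → ℝ) (y : Finset.Icc (p + 1) T → ℝ) : ℝ :=
  1 / (2 * √T) * ∑ t ∈ Finset.Icc (p + 1) T,
    (path x y t ^ 2 - sigmaSq q r (α (t / T)) β (past p (path x y) t))
      / sigmaSq q r (α (t / T)) β (past p (path x y) t) ^ 2
      * (subvec q (past p (path x y) t) ⬝ᵥ g (t / T) + subvec r (past p (path x y) t) ⬝ᵥ h)

/-! ### Stationary ARCH processes and the norm of the tangent space -/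

/-- `ξ` is a sequence of i.i.d. standard Gaussian variables. -/
structure IsGaussianNoise {Ω : Type*} [MeasurableSpace Ω] (P : Measure Ω) (ξ : ℤ → Ω → ℝ) :
    Prop where
  measurable : ∀ t, Measurable (ξ t)
  indep : iIndepFun ξ P
  law : ∀ t, P.map (ξ t) = gaussianReal 0 1

/-- The past values `(X_{t-1}, …, X_{t-p})` at time `t` of a process indexed by `ℤ`. -/
def pastZ {Ω : Type*} (p : ℕ) (X : ℤ → Ω → ℝ) (t : ℤ) (ω : Ω) : Fin p → ℝ :=
  fun j => X (t - 1 - (j : ℤ)) ω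

/-- `X` is a stationary ARCH process with noise `ξ` and coefficients `(a, b)`: it is strictly
stationary, `X_t` is a function of `ξ_t, ξ_{t-1}, …`, and `X_t = ξ_t σ_t` with
`σ_t² = M_t' a + N_t' b`. -/
structure IsStationaryARCH {Ω : Type*} [MeasurableSpace Ω] (P : Measure Ω) (ξ : ℤ → Ω → ℝ)
    {p m n : ℕ} (q : Fin m → Fin (p + 1)) (r : Fin n → Fin (p + 1))
    (a : Fin m → ℝ) (b : Fin n → ℝ) (X : ℤ → Ω → ℝ) : Prop where
  causal : ∀ t, Measurable[⨆ s : Set.Iic t, MeasurableSpace.comap (ξ s) inferInstance] (X t)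
  stationary : ∀ k : ℤ, P.map (fun ω t => X (t + k) ω) = P.map (fun ω t => X t ω)
  recursion : ∀ t, ∀ᵐ ω ∂P, X t ω = ξ t ω * √(sigmaSq q r a b (pastZ p X t ω))

/-- The block matrix `E(u)`, with blocks `E(M M' / σ⁴)`, `E(M N' / σ⁴)`, `E(N M' / σ⁴)` and
`E(N N' / σ⁴)` taken at time `1` of the process `X`, with `σ² = M' a + N' b`. -/
def infoMatrix {Ω : Type*} [MeasurableSpace Ω] (P : Measure Ω) {p m n : ℕ}
    (q : Fin m → Fin (p + 1)) (r : Fin n → Fin (p + 1)) (a : Fin m → ℝ) (b : Fin n → ℝ)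
    (X : ℤ → Ω → ℝ) : Matrix (Fin m ⊕ Fin n) (Fin m ⊕ Fin n) ℝ :=
  Matrix.fromBlocks
    (Matrix.of fun i j => ∫ ω, subvec q (pastZ p X 1 ω) i * subvec q (pastZ p X 1 ω) j
      / sigmaSq q r a b (pastZ p X 1 ω) ^ 2 ∂P)
    (Matrix.of fun i j => ∫ ω, subvec q (pastZ p X 1 ω) i * subvec r (pastZ p X 1 ω) j
      / sigmaSq q r a b (pastZ p X 1 ω) ^ 2 ∂P)
    (Matrix.of fun i j => ∫ ω, subvec r (pastZ p X 1 ω) i * subvec q (pastZ p X 1 ω) j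
      / sigmaSq q r a b (pastZ p X 1 ω) ^ 2 ∂P)
    (Matrix.of fun i j => ∫ ω, subvec r (pastZ p X 1 ω) i * subvec r (pastZ p X 1 ω) j
      / sigmaSq q r a b (pastZ p X 1 ω) ^ 2 ∂P)

/-- The squared norm `‖(g,h)‖² = ½ ∫₀¹ (g(u), h)' E(u) (g(u), h) du`, where `X u` is the stationary
ARCH process with coefficients `(α(u), β)`. -/
def normSq {Ω : Type*} [MeasurableSpace Ω] (P : Measure Ω) {p m n : ℕ}
    (q : Fin m → Fin (p + 1)) (r : Fin n → Fin (p + 1)) (α : ℝ → Fin m → ℝ) (β : Fin n → ℝ)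
    (X : ℝ → ℤ → Ω → ℝ) (g : ℝ → Fin m → ℝ) (h : Fin n → ℝ) : ℝ :=
  1 / 2 * ∫ u in (0 : ℝ)..1,
    Sum.elim (g u) h ⬝ᵥ (infoMatrix P q r (α u) β (X u) *ᵥ Sum.elim (g u) h)

end TvARCH

end

/-!
The argument takes place on the probability space of the noise, where the sample of every length `T`
is a function of the same variables `ξ_t` (`condLaw_eq_map`). Let `w_t = (M_t'g + N_t'h) / σ_t²` be
the relative perturbation of the conditional variance (`relPert`). Since the coefficients are bounded
away from `0`, it is bounded, uniformly in `t`, `T` and the sample; and it is predictable.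

*Density.* The sample is a triangular transformation of the noise, so its law has a density with
respect to the law of the noise: a product of one-dimensional Gaussian likelihood ratios
(`lintegral_partialSolution`, which integrates out one coordinate at a time). For `T` large the
perturbed conditional variance `σ_t² (1 + w_t / √T)` is positive, so that the perturbed law is
absolutely continuous and the log-likelihood ratio is the sum of
`-½ log (1 + w_t / √T) + ½ ξ_t² (w_t / √T) / (1 + w_t / √T)` (`llr_condLaw_eq_sum`), while the score
is `(2√T)⁻¹ ∑ (ξ_t² - 1) w_t` (`score_eq_sum`).

*Law of large numbers.* The averages `T⁻¹ ∑ w_t²` converge in `L¹` to `Q = 2 ‖(g,h)‖²`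
(`tendsto_integral_abs_average_sub`, `dotProduct_infoMatrix_mulVec`). The squares of ARCH processes
satisfy linear recursions, which contract in `L¹` because the lag coefficients sum to less than `1`
(`IsSqARCH.lintegral_abs_sub_le`). Hence `w_t`, but for boundedly many `t`, is close to the value it would
have if the coefficients were frozen at `t / T` and the recursion restarted from `0` at time
`t - p - K`. These approximations depend on boundedly many noise variables and so obey a law of large
numbers; their means are close to those for the stationary processes, which depend on the rescaled
time in a Lipschitz way, and a Riemann sum converges to the integral. The stationary processes are
not assumed to have moments: a bound for their second moment follows from the same contraction,
applied on the events where the initial values are bounded (`IsSqARCH.lintegral_le_of_stationary`).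

*Expansion and central limit theorem.* Expanding the logarithm to second order gives
`Δ - T⁻¹ ∑ w_t² / 4` and a remainder that vanishes in `L¹` (`tendsto_lintegral_abs_llr_sub`). For the
score, let `S` be the sum `v Δ` and `V = v² (4T)⁻¹ ∑ w_t²`; then `exp (iS + V)` is an approximate
martingale, because the characteristic function of `ξ² - 1` is `1 - s² + o(s²)` and `w_t` is
predictable. So its expectation tends to `1`, and as `V` converges to `v² Q / 4` in `L¹`, that of
`exp (iS)` tends to `exp (-v² Q / 4)` (`tendsto_integral_cexp_score`). Lévy's continuity theorem
concludes.
-/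

noncomputable section

namespace TvARCH

/-! ### Linear forms in the squared past values -/

/-- The linear form `c₀ + ∑ⱼ cⱼ zⱼ` in the squared past values `z = (X_{t-1}², …, X_{t-p}²)`. -/
def lin {p : ℕ} (c : Fin (p + 1) → ℝ) (z : Fin p → ℝ) : ℝ := c 0 + ∑ j : Fin p, c j.succ * z j

/-- The family on `{0, …, p}` whose subfamilies with indices `q` and `r` are `a` and `b`. -/
def mergeCoeff {p m n : ℕ} (e : Fin m ⊕ Fin n ≃ Fin (p + 1)) (a : Fin m → ℝ) (b : Fin n → ℝ) :
    Fin (p + 1) → ℝ := fun k => Sum.elim a b (e.symm k)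

/-- The bijection `Fin m ⊕ Fin n ≃ {0, …, p}` given by a bipartition. -/
def indexEquiv {p m n : ℕ} (q : Fin m → Fin (p + 1)) (r : Fin n → Fin (p + 1))
    (hq : StrictMono q) (hr : StrictMono r) (hqr : IsCompl (Set.range q) (Set.range r)) :
    Fin m ⊕ Fin n ≃ Fin (p + 1) :=
  Equiv.ofBijective (Sum.elim q r) ⟨by
    refine Function.Injective.sumElim hq.injective hr.injective fun i j hij => ?_
    exact Set.disjoint_left.1 hqr.disjoint ⟨i, rfl⟩ ⟨j, hij.symm⟩, by
    rw [← Set.range_eq_univ, Set.Sum.elim_range]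
    exact hqr.sup_eq_top⟩

section merge

variable {p m n : ℕ} {q : Fin m → Fin (p + 1)} {r : Fin n → Fin (p + 1)}
  {e : Fin m ⊕ Fin n ≃ Fin (p + 1)}

lemma mergeCoeff_left (he : ⇑e = Sum.elim q r) (a : Fin m → ℝ) (b : Fin n → ℝ) (i : Fin m) :
    mergeCoeff e a b (q i) = a i := by
  have : e.symm (q i) = Sum.inl i := by rw [Equiv.symm_apply_eq, he]; rfl
  simp [mergeCoeff, this]

lemma mergeCoeff_right (he : ⇑e = Sum.elim q r) (a : Fin m → ℝ) (b : Fin n → ℝ) (i : Fin n) :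
    mergeCoeff e a b (r i) = b i := by
  have : e.symm (r i) = Sum.inr i := by rw [Equiv.symm_apply_eq, he]; rfl
  simp [mergeCoeff, this]

lemma subvec_dotProduct_add (he : ⇑e = Sum.elim q r) (a : Fin m → ℝ) (b : Fin n → ℝ)
    (v : Fin p → ℝ) :
    subvec q v ⬝ᵥ a + subvec r v ⬝ᵥ b = lin (mergeCoeff e a b) (fun j => v j ^ 2) := by
  have h1 : lin (mergeCoeff e a b) (fun j => v j ^ 2)
      = ∑ k, mergeCoeff e a b k * regressor v k := by
    rw [Fin.sum_univ_succ]; simp [lin, regressor]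
  rw [h1, ← e.sum_comp, Fintype.sum_sum_type]
  simp [mergeCoeff_left he, mergeCoeff_right he, he, dotProduct, subvec, mul_comm]

lemma lagCoeffSum_eq (he : ⇑e = Sum.elim q r) (a : Fin m → ℝ) (b : Fin n → ℝ) :
    lagCoeffSum q r a b = ∑ j : Fin p, mergeCoeff e a b j.succ := by
  have h1 : ∑ j : Fin p, mergeCoeff e a b j.succ
      = ∑ k : Fin (p + 1), if k ≠ 0 then mergeCoeff e a b k else 0 := by
    rw [Fin.sum_univ_succ]; simp
  rw [h1, ← e.sum_comp, Fintype.sum_sum_type]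
  simp [mergeCoeff_left he, mergeCoeff_right he, he, lagCoeffSum, Finset.sum_filter]

end merge

section ratio

variable {p : ℕ} {c c' d d' : Fin (p + 1) → ℝ} {z z' : Fin p → ℝ} {κ C D η : ℝ}

lemma measurable_lin (c : Fin (p + 1) → ℝ) : Measurable (lin c) := by
  unfold lin; fun_prop

lemma lin_nonneg (hc : ∀ k, 0 ≤ c k) (hz : ∀ j, 0 ≤ z j) : 0 ≤ lin c z :=
  add_nonneg (hc 0) (Finset.sum_nonneg fun j _ => mul_nonneg (hc _) (hz j))

lemma le_lin (hc : ∀ k, κ ≤ c k) (hz : ∀ j, 0 ≤ z j) : κ * (1 + ∑ j, z j) ≤ lin c z := by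
  rw [lin, mul_add, mul_one, Finset.mul_sum]
  exact add_le_add (hc 0) (Finset.sum_le_sum fun j _ => mul_le_mul_of_nonneg_right (hc _) (hz j))

lemma le_lin_of_nonneg (hκ : 0 ≤ κ) (hc : ∀ k, κ ≤ c k) (hz : ∀ j, 0 ≤ z j) : κ ≤ lin c z := by
  refine le_trans ?_ (le_lin hc hz)
  nlinarith [Finset.sum_nonneg fun j (_ : j ∈ Finset.univ) => hz j]

lemma lin_sub_lin_left (c c' : Fin (p + 1) → ℝ) (z : Fin p → ℝ) :
    lin c z - lin c' z = lin (c - c') z := by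
  simp only [lin, Pi.sub_apply, sub_mul, Finset.sum_sub_distrib]; ring

lemma lin_sub_lin_right (c : Fin (p + 1) → ℝ) (z z' : Fin p → ℝ) :
    lin c z - lin c z' = ∑ j : Fin p, c j.succ * (z j - z' j) := by
  simp only [lin, mul_sub, Finset.sum_sub_distrib]; ring

lemma abs_lin_le (hd : ∀ k, |d k| ≤ D) (hz : ∀ j, 0 ≤ z j) :
    |lin d z| ≤ D * (1 + ∑ j, z j) := by
  rw [lin, mul_add, mul_one, Finset.mul_sum]
  refine (abs_add_le _ _).trans (add_le_add (hd 0) ((Finset.abs_sum_le_sum_abs _ _).trans ?_))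
  refine Finset.sum_le_sum fun j _ => ?_
  rw [abs_mul, abs_of_nonneg (hz j)]
  exact mul_le_mul_of_nonneg_right (hd _) (hz j)

lemma abs_lin_sub_lin_le (hc : ∀ k, |c k| ≤ C) :
    |lin c z - lin c z'| ≤ C * ∑ j, |z j - z' j| := by
  rw [lin_sub_lin_right, Finset.mul_sum]
  refine (Finset.abs_sum_le_sum_abs _ _).trans (Finset.sum_le_sum fun j _ => ?_)
  rw [abs_mul]
  exact mul_le_mul_of_nonneg_right (hc _) (abs_nonneg _)

/-- The relative perturbation `(M'g + N'h) / (M'α + N'β)` of the conditional variance, as a function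
of the squared past values. -/
def ratio {p : ℕ} (c d : Fin (p + 1) → ℝ) (z : Fin p → ℝ) : ℝ := lin d z / lin c z

lemma measurable_ratio (c d : Fin (p + 1) → ℝ) : Measurable (ratio c d) :=
  (measurable_lin d).div (measurable_lin c)

lemma abs_ratio_le (hκ : 0 < κ) (hc : ∀ k, κ ≤ c k) (hd : ∀ k, |d k| ≤ D) (hz : ∀ j, 0 ≤ z j) :
    |ratio c d z| ≤ D / κ := by
  have hs : 0 ≤ ∑ j, z j := Finset.sum_nonneg fun j _ => hz j
  have h1 := le_lin hc hz
  have hpos : 0 < κ * (1 + ∑ j, z j) := by positivity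
  have hD : 0 ≤ D := (abs_nonneg _).trans (hd 0)
  rw [ratio, abs_div, abs_of_pos (hpos.trans_le h1), div_le_div_iff₀ (hpos.trans_le h1) hκ]
  have := abs_lin_le hd hz
  nlinarith

/-- The ratio is Lipschitz in the squared past values: its numerator and denominator are, the
denominator is bounded below, and the ratio itself is bounded. -/
lemma abs_ratio_sub_ratio_le (hκ : 0 < κ) (hc : ∀ k, κ ≤ c k) (hC : ∀ k, c k ≤ C)
    (hd : ∀ k, |d k| ≤ D) (hz : ∀ j, 0 ≤ z j) (hz' : ∀ j, 0 ≤ z' j) :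
    |ratio c d z - ratio c d z'| ≤ (D + D / κ * C) / κ * ∑ j, |z j - z' j| := by
  have hB := le_lin_of_nonneg hκ.le hc hz
  have hB' := le_lin_of_nonneg hκ.le hc hz'
  have hw := abs_ratio_le hκ hc hd hz'
  have hA := abs_lin_sub_lin_le (z := z) (z' := z') hd
  have hC' : ∀ k, |c k| ≤ C := fun k => abs_le.2 ⟨by linarith [hc k, hC k], hC k⟩
  have hBB := abs_lin_sub_lin_le (z := z) (z' := z') hC'
  have hs : 0 ≤ ∑ j, |z j - z' j| := Finset.sum_nonneg fun j _ => abs_nonneg _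
  have hD : 0 ≤ D := (abs_nonneg _).trans (hd 0)
  have key : ratio c d z - ratio c d z'
      = ((lin d z - lin d z') - ratio c d z' * (lin c z - lin c z')) / lin c z := by
    have h1 : lin c z ≠ 0 := by linarith
    have h2 : lin c z' ≠ 0 := by linarith
    unfold ratio; field_simp; ring
  rw [key, abs_div, abs_of_pos (hκ.trans_le hB), div_mul_eq_mul_div]
  have hn : |(lin d z - lin d z') - ratio c d z' * (lin c z - lin c z')|
      ≤ (D + D / κ * C) * ∑ j, |z j - z' j| := by
    refine (abs_sub _ _).trans ?_
    rw [abs_mul, add_mul, mul_assoc (D / κ)]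
    exact add_le_add hA (mul_le_mul hw hBB (abs_nonneg _) (by positivity))
  exact div_le_div₀ ((abs_nonneg _).trans hn) hn hκ hB

lemma abs_ratio_sub_ratio_coeff_le (hκ : 0 < κ) (hc : ∀ k, κ ≤ c k) (hc' : ∀ k, κ ≤ c' k)
    (hd : ∀ k, |d k| ≤ D) (hcc : ∀ k, |c' k - c k| ≤ η) (hdd : ∀ k, |d' k - d k| ≤ η)
    (hz : ∀ j, 0 ≤ z j) :
    |ratio c' d' z - ratio c d z| ≤ (1 + D / κ) / κ * η := by
  have hs : 0 ≤ ∑ j, z j := Finset.sum_nonneg fun j _ => hz j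
  have hpos : 0 < κ * (1 + ∑ j, z j) := by positivity
  have hB := le_lin hc hz
  have hB' := le_lin hc' hz
  have hw := abs_ratio_le hκ hc hd hz
  have hA := abs_lin_le (d := d' - d) hdd hz
  have hBB := abs_lin_le (d := c' - c) hcc hz
  rw [← lin_sub_lin_left] at hA hBB
  have hη : 0 ≤ η := (abs_nonneg _).trans (hcc 0)
  have hD : 0 ≤ D := (abs_nonneg _).trans (hd 0)
  have key : ratio c' d' z - ratio c d z
      = ((lin d' z - lin d z) - ratio c d z * (lin c' z - lin c z)) / lin c' z := by
    have h1 : lin c z ≠ 0 := by linarith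
    have h2 : lin c' z ≠ 0 := by linarith
    unfold ratio; field_simp; ring
  have hn : |(lin d' z - lin d z) - ratio c d z * (lin c' z - lin c z)|
      ≤ (1 + D / κ) * η * (1 + ∑ j, z j) := by
    refine (abs_sub _ _).trans ?_
    rw [abs_mul, mul_assoc, add_mul, one_mul]
    exact add_le_add hA (mul_le_mul hw hBB (abs_nonneg _) (by positivity))
  rw [key, abs_div, abs_of_pos (hpos.trans_le hB')]
  calc _ ≤ (1 + D / κ) * η * (1 + ∑ j, z j) / (κ * (1 + ∑ j, z j)) :=
        div_le_div₀ ((abs_nonneg _).trans hn) hn hpos hB'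
    _ = (1 + D / κ) / κ * η := by field_simp

lemma abs_sq_sub_sq_le {x y W : ℝ} (hx : |x| ≤ W) (hy : |y| ≤ W) :
    |x ^ 2 - y ^ 2| ≤ 2 * W * |x - y| := by
  rw [sq_sub_sq, abs_mul]
  exact mul_le_mul_of_nonneg_right ((abs_add_le x y).trans (by linarith)) (abs_nonneg _)

end ratio

/-- Uniform bounds on `[0,1]` for the coefficients `c` of a tv-ARCH model and a direction `d`: the
entries of `c` lie in `[κ, C]`, those of `d` in `[-D, D]`, both are Lipschitz with constant `L`, and
the lag coefficients sum to at most `ρ ^ p`, so that the recursion contracts at rate `ρ`. -/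
structure RegularCoeffs {p : ℕ} (c d : ℝ → Fin (p + 1) → ℝ) (κ C D L ρ : ℝ) : Prop where
  pos : 0 < κ
  lower : ∀ u ∈ Set.Icc (0 : ℝ) 1, ∀ k, κ ≤ c u k
  upper : ∀ u ∈ Set.Icc (0 : ℝ) 1, ∀ k, c u k ≤ C
  dir : ∀ u ∈ Set.Icc (0 : ℝ) 1, ∀ k, |d u k| ≤ D
  lip : ∀ u ∈ Set.Icc (0 : ℝ) 1, ∀ v ∈ Set.Icc (0 : ℝ) 1, ∀ k, |c u k - c v k| ≤ L * |u - v|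
  dir_lip : ∀ u ∈ Set.Icc (0 : ℝ) 1, ∀ v ∈ Set.Icc (0 : ℝ) 1, ∀ k, |d u k - d v k| ≤ L * |u - v|
  rate_nonneg : 0 ≤ ρ
  rate_lt_one : ρ < 1
  rate_pow_lt_one : ρ ^ p < 1
  sum_le : ∀ u ∈ Set.Icc (0 : ℝ) 1, ∑ j : Fin p, c u j.succ ≤ ρ ^ p

namespace RegularCoeffs

variable {p : ℕ} {c d : ℝ → Fin (p + 1) → ℝ} {κ C D L ρ : ℝ}

lemma upper_nonneg (h : RegularCoeffs c d κ C D L ρ) : 0 ≤ C := by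
  have h0 : (0 : ℝ) ∈ Set.Icc (0 : ℝ) 1 := by simp
  linarith [h.pos, h.lower 0 h0 0, h.upper 0 h0 0]

lemma dir_nonneg (h : RegularCoeffs c d κ C D L ρ) : 0 ≤ D :=
  (abs_nonneg _).trans (h.dir 0 (by simp) 0)

lemma lip_nonneg (h : RegularCoeffs c d κ C D L ρ) : 0 ≤ L := by
  simpa using (abs_nonneg _).trans (h.lip 0 (by simp) 1 (by simp) 0)

lemma coeff_nonneg (h : RegularCoeffs c d κ C D L ρ) {u : ℝ} (hu : u ∈ Set.Icc (0 : ℝ) 1)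
    (k : Fin (p + 1)) : 0 ≤ c u k := h.pos.le.trans (h.lower u hu k)

end RegularCoeffs

/-! ### The density of the conditional law of the sample -/

/-- The density of `N(0, v)` with respect to `N(0, 1)`. -/
def gaussRatio (v z : ℝ) : ℝ := (√v)⁻¹ * Real.exp (z ^ 2 / 2 - z ^ 2 / (2 * v))

lemma gaussRatio_pos {v : ℝ} (hv : 0 < v) (z : ℝ) : 0 < gaussRatio v z := by
  unfold gaussRatio; positivity

lemma log_gaussRatio {v : ℝ} (hv : 0 < v) (z : ℝ) :
    Real.log (gaussRatio v z) = -(1 / 2) * Real.log v + (z ^ 2 / 2 - z ^ 2 / (2 * v)) := by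
  rw [gaussRatio, Real.log_mul (by positivity) (Real.exp_ne_zero _), Real.log_exp, Real.log_inv,
    Real.log_sqrt hv.le]
  ring

lemma measurable_gaussRatio : Measurable fun a : ℝ × ℝ => gaussRatio a.1 a.2 := by
  unfold gaussRatio; fun_prop

/-- Scaling a standard Gaussian variable by `√v` amounts to the density `gaussRatio v`. -/
lemma lintegral_gaussianReal_mul_sqrt {v : ℝ} (hv : 0 < v) {ψ : ℝ → ℝ≥0∞} (hψ : Measurable ψ) :
    ∫⁻ z, ψ (z * √v) ∂gaussianReal 0 1
      = ∫⁻ z, ψ z * ENNReal.ofReal (gaussRatio v z) ∂gaussianReal 0 1 := by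
  have hv' : v.toNNReal ≠ 0 := (Real.toNNReal_pos.2 hv).ne'
  have h1 : (gaussianReal 0 1).map (· * √v) = gaussianReal 0 v.toNNReal := by
    rw [gaussianReal_map_mul_const]
    congr 1
    · simp
    · ext; simp [Real.sq_sqrt hv.le, Real.coe_toNNReal _ hv.le]
  have hm : Measurable fun z => ENNReal.ofReal (gaussRatio v z) :=
    (measurable_gaussRatio.comp (measurable_const.prodMk measurable_id)).ennreal_ofReal
  rw [← lintegral_map (f := ψ) (g := fun z => z * √v) hψ (by fun_prop), h1,
    gaussianReal_of_var_ne_zero _ hv', gaussianReal_of_var_ne_zero _ one_ne_zero,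
    lintegral_withDensity_eq_lintegral_mul _ (measurable_gaussianPDF _ _) hψ,
    lintegral_withDensity_eq_lintegral_mul _ (measurable_gaussianPDF _ _)
      (show Measurable fun z => ψ z * ENNReal.ofReal (gaussRatio v z) from hψ.mul hm)]
  refine lintegral_congr fun z => ?_
  have h2 : gaussianPDFReal 0 v.toNNReal z = gaussianPDFReal 0 1 z * gaussRatio v z := by
    simp only [gaussianPDFReal, gaussRatio, Real.coe_toNNReal _ hv.le, NNReal.coe_one, sub_zero,
      mul_one]
    rw [Real.sqrt_mul (by positivity), mul_inv, mul_assoc, mul_assoc]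
    congr 1
    rw [mul_left_comm, ← Real.exp_add]
    congr 2
    ring
  simp only [Pi.mul_apply, gaussianPDF]
  rw [h2, ENNReal.ofReal_mul (gaussianPDFReal_nonneg _ _ _)]
  ring

section density

variable {p m n : ℕ} (q : Fin m → Fin (p + 1)) (r : Fin n → Fin (p + 1)) (T : ℕ)
  (α : ℝ → Fin m → ℝ) (β : Fin n → ℝ) (x : Finset.Icc 1 p → ℝ)

/-- The conditional variance `σ_t²` as a function of the sample. -/
def condVar (t : ℕ) (y : Finset.Icc (p + 1) T → ℝ) : ℝ :=
  sigmaSq q r (α (t / T)) β (past p (path x y) t)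

/-- The solution of the recursion up to time `s`, followed by the noise after time `s`. -/
def partialSolution (s : ℕ) (ξ : Finset.Icc (p + 1) T → ℝ) : Finset.Icc (p + 1) T → ℝ :=
  fun t => if (t : ℕ) ≤ s then solution q r T α β x ξ t else ξ t

/-- The density, with respect to the law of the noise, of the law of the solution up to time `s`
followed by the noise. -/
def partialDensity (s : ℕ) (y : Finset.Icc (p + 1) T → ℝ) : ℝ :=
  ∏ t : Finset.Icc (p + 1) T, if (t : ℕ) ≤ s then gaussRatio (condVar q r T α β x t y) (y t) else 1

variable {q r T α β x}

lemma measurable_path (t : ℕ) : Measurable fun y : Finset.Icc (p + 1) T → ℝ => path x y t := by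
  unfold path
  split_ifs <;> fun_prop

lemma measurable_past_path (t : ℕ) :
    Measurable fun y : Finset.Icc (p + 1) T → ℝ => past p (path x y) t :=
  measurable_pi_lambda _ fun _ => measurable_path _

lemma measurable_condVar (t : ℕ) : Measurable (condVar q r T α β x t) :=
  (measurable_sigmaSq q r _ β).comp (measurable_past_path t)

lemma measurable_partialSolution (s : ℕ) : Measurable (partialSolution q r T α β x s) := by
  refine measurable_pi_lambda _ fun t => ?_
  unfold partialSolution
  split_ifs
  · exact measurable_solution q r T α β x t
  · exact measurable_pi_apply t

lemma measurable_partialDensity (s : ℕ) : Measurable (partialDensity q r T α β x s) := by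
  refine Finset.measurable_prod _ fun t _ => ?_
  split_ifs
  · exact measurable_gaussRatio.comp ((measurable_condVar t).prodMk (measurable_pi_apply t))
  · exact measurable_const

lemma past_path_congr {y y' : Finset.Icc (p + 1) T → ℝ} {t : ℕ}
    (h : ∀ s : Finset.Icc (p + 1) T, (s : ℕ) < t → y s = y' s) (ht : p + 1 ≤ t) :
    past p (path x y) t = past p (path x y') t := by
  funext j
  simp only [past, path]
  split_ifs with h1 h2
  · rfl
  · exact h _ (by simp; omega)
  · rfl

lemma condVar_update {y : Finset.Icc (p + 1) T → ℝ} {i : Finset.Icc (p + 1) T} {t : ℕ}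
    (hti : t ≤ i) (ht : p + 1 ≤ t) (z : ℝ) :
    condVar q r T α β x t (Function.update y i z) = condVar q r T α β x t y := by
  unfold condVar
  rw [past_path_congr (fun s hs => ?_) ht]
  exact Function.update_of_ne (fun h => by subst h; omega) _ _

lemma condVar_partialSolution {ξ : Finset.Icc (p + 1) T → ℝ} {s t : ℕ} (hts : t ≤ s + 1) :
    condVar q r T α β x t (partialSolution q r T α β x s ξ)
      = sigmaSq q r (α (t / T)) β (fun j : Fin p => solution q r T α β x ξ (t - 1 - j)) := by
  unfold condVar
  congr 1
  funext j
  simp only [past, path]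
  rw [solution]
  split_ifs with h1 h2
  · rfl
  · simp only [partialSolution]
    rw [if_pos (by simp; omega), solution, dif_neg h1, dif_pos h2]
  · rfl

lemma partialSolution_succ (ξ : Finset.Icc (p + 1) T → ℝ) {s : ℕ}
    (hs : s + 1 ∈ Finset.Icc (p + 1) T) :
    partialSolution q r T α β x (s + 1) ξ
      = Function.update (partialSolution q r T α β x s ξ) ⟨s + 1, hs⟩
          (partialSolution q r T α β x s ξ ⟨s + 1, hs⟩
            * √(condVar q r T α β x (s + 1) (partialSolution q r T α β x s ξ))) := by
  have hs' := Finset.mem_Icc.1 hs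
  funext t
  rcases eq_or_ne t ⟨s + 1, hs⟩ with rfl | ht
  · rw [Function.update_self, condVar_partialSolution le_rfl]
    simp only [partialSolution, le_refl, if_true, Nat.not_succ_le_self, if_false]
    rw [solution, dif_neg (by rw [Finset.mem_Icc]; omega), dif_pos hs]
  · rw [Function.update_of_ne ht]
    have : (t : ℕ) ≠ s + 1 := fun h => ht (Subtype.ext h)
    simp only [partialSolution]
    congr 1
    exact propext ⟨fun _ => by omega, fun _ => by omega⟩

lemma partialDensity_update {y : Finset.Icc (p + 1) T → ℝ} {s : ℕ}
    (hs : s + 1 ∈ Finset.Icc (p + 1) T) (z : ℝ) :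
    partialDensity q r T α β x s (Function.update y ⟨s + 1, hs⟩ z)
      = partialDensity q r T α β x s y := by
  refine Finset.prod_congr rfl fun t _ => ?_
  split_ifs with h
  · rw [condVar_update (by simp; omega) (Finset.mem_Icc.1 t.2).1,
      Function.update_of_ne (fun h' => by subst h'; simp at h)]
  · rfl

lemma partialDensity_succ {y : Finset.Icc (p + 1) T → ℝ} {s : ℕ}
    (hs : s + 1 ∈ Finset.Icc (p + 1) T) :
    partialDensity q r T α β x (s + 1) y = partialDensity q r T α β x s y
      * gaussRatio (condVar q r T α β x (s + 1) y) (y ⟨s + 1, hs⟩) := by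
  unfold partialDensity
  have hmem := Finset.mem_univ (⟨s + 1, hs⟩ : Finset.Icc (p + 1) T)
  rw [← Finset.mul_prod_erase _ _ hmem,
    ← Finset.mul_prod_erase _ (fun t : Finset.Icc (p + 1) T =>
      if (t : ℕ) ≤ s then gaussRatio (condVar q r T α β x t y) (y t) else 1) hmem]
  simp only [le_refl, if_true, Nat.not_succ_le_self, if_false, one_mul]
  rw [mul_comm]
  congr 1
  refine Finset.prod_congr rfl fun t ht => ?_
  have : (t : ℕ) ≠ s + 1 := fun h => Finset.ne_of_mem_erase ht (Subtype.ext h)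
  congr 1
  exact propext ⟨fun _ => by omega, fun _ => by omega⟩

variable (hpos : ∀ t ∈ Finset.Icc (p + 1) T, ∀ y, 0 < condVar q r T α β x t y)

include hpos

lemma partialDensity_pos (s : ℕ) (y : Finset.Icc (p + 1) T → ℝ) :
    0 < partialDensity q r T α β x s y := by
  refine Finset.prod_pos fun t _ => ?_
  split_ifs
  · exact gaussRatio_pos (hpos t t.2 y) _
  · exact one_pos

/-- One coordinate at a time, integrating out the noise of the last time point: the conditional
variance at that time depends only on the earlier coordinates, so that given them the new coordinate
is a centred Gaussian variable with that variance. -/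
lemma lintegral_partialSolution {s : ℕ} (hps : p ≤ s) (hsT : s ≤ T)
    {φ : (Finset.Icc (p + 1) T → ℝ) → ℝ≥0∞} (hφ : Measurable φ) :
    ∫⁻ ξ, φ (partialSolution q r T α β x s ξ) ∂Measure.pi (fun _ => gaussianReal 0 1)
      = ∫⁻ y, φ y * ENNReal.ofReal (partialDensity q r T α β x s y)
          ∂Measure.pi (fun _ => gaussianReal 0 1) := by
  induction s, hps using Nat.le_induction generalizing φ with
  | base =>
    have h1 : ∀ ξ, partialSolution q r T α β x p ξ = ξ := fun ξ => by
      funext t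
      have := Finset.mem_Icc.1 t.2
      exact if_neg (by omega)
    have h2 : ∀ y, partialDensity q r T α β x p y = 1 := fun y => by
      refine Finset.prod_eq_one fun t _ => if_neg ?_
      have := Finset.mem_Icc.1 t.2
      omega
    simp [h1, h2]
  | succ s hps ih =>
    have hs : s + 1 ∈ Finset.Icc (p + 1) T := Finset.mem_Icc.2 ⟨by omega, hsT⟩
    set i : Finset.Icc (p + 1) T := ⟨s + 1, hs⟩ with hi
    let Ψ : (Finset.Icc (p + 1) T → ℝ) → Finset.Icc (p + 1) T → ℝ := fun y =>
      Function.update y i (y i * √(condVar q r T α β x (s + 1) y))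
    have hΨ : Measurable Ψ := by
      refine measurable_pi_lambda _ fun t => ?_
      rcases eq_or_ne t i with rfl | ht
      · simp only [Ψ, Function.update_self]
        exact (measurable_pi_apply _).mul (measurable_condVar _).sqrt
      · simp only [Ψ, Function.update_of_ne ht]
        exact measurable_pi_apply t
    have hD : ∀ k, Measurable fun y => ENNReal.ofReal (partialDensity q r T α β x k y) :=
      fun k => (measurable_partialDensity k).ennreal_ofReal
    calc _ = ∫⁻ ξ, (φ ∘ Ψ) (partialSolution q r T α β x s ξ)
          ∂Measure.pi (fun _ => gaussianReal 0 1) :=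
          lintegral_congr fun ξ => by rw [partialSolution_succ ξ hs]; rfl
      _ = _ := ih (by omega) (hφ.comp hΨ)
      _ = _ := by
          refine lintegral_eq_of_lmarginal_eq {i} ((hφ.comp hΨ).mul (hD _)) (hφ.mul (hD _)) ?_
          simp only [lmarginal_singleton]
          funext y
          have hv := hpos (s + 1) hs y
          have h1 : ∀ z, Ψ (Function.update y i z)
              = Function.update y i (z * √(condVar q r T α β x (s + 1) y)) := fun z => by
            simp only [Ψ]
            rw [condVar_update (i := i) (t := s + 1) le_rfl (by omega), Function.update_self,
              Function.update_idem]
          simp only [Function.comp_apply, h1]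
          have hu : Measurable fun z => φ (Function.update y i z) :=
            hφ.comp (measurable_update y)
          have e1 : ∀ z, partialDensity q r T α β x s (Function.update y i z)
              = partialDensity q r T α β x s y := partialDensity_update hs
          have e2 : ∀ z, partialDensity q r T α β x (s + 1) (Function.update y i z)
              = partialDensity q r T α β x s y
                * gaussRatio (condVar q r T α β x (s + 1) y) z := fun z => by
            rw [partialDensity_succ hs, e1, condVar_update (i := i) (t := s + 1) le_rfl (by omega),
              Function.update_self]
          simp only [e1, e2]
          have hm : Measurable fun z => φ (Function.update y i
              (z * √(condVar q r T α β x (s + 1) y))) := hu.comp (measurable_id.mul_const _)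
          rw [lintegral_mul_const _ hm, lintegral_gaussianReal_mul_sqrt hv hu, ← lintegral_mul_const]
          · refine lintegral_congr fun z => ?_
            rw [ENNReal.ofReal_mul (partialDensity_pos hpos s y).le]
            ring
          · exact hu.mul (measurable_gaussRatio.comp
              (measurable_const.prodMk measurable_id)).ennreal_ofReal

lemma condLaw_eq_withDensity (hpT : p ≤ T) :
    condLaw q r T α β x = (Measure.pi (fun _ => gaussianReal 0 1)).withDensity
      (fun y => ENNReal.ofReal (partialDensity q r T α β x T y)) := by
  refine Measure.ext fun A hA => ?_
  have h1 : (fun ξ (t : Finset.Icc (p + 1) T) => solution q r T α β x ξ t)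
      = partialSolution q r T α β x T := by
    funext ξ t
    exact (if_pos (Finset.mem_Icc.1 t.2).2).symm
  rw [condLaw, h1, ← lintegral_indicator_one hA, ← lintegral_indicator_one hA,
    lintegral_map (measurable_one.indicator hA) (measurable_partialSolution T),
    lintegral_partialSolution hpos hpT le_rfl (measurable_one.indicator hA),
    lintegral_withDensity_eq_lintegral_mul _ (measurable_partialDensity T).ennreal_ofReal
      (measurable_one.indicator hA)]
  exact lintegral_congr fun y => mul_comm _ _

lemma log_partialDensity (y : Finset.Icc (p + 1) T → ℝ) :
    Real.log (partialDensity q r T α β x T y)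
      = ∑ t ∈ Finset.Icc (p + 1) T, (-(1 / 2) * Real.log (condVar q r T α β x t y)
        + (path x y t ^ 2 / 2 - path x y t ^ 2 / (2 * condVar q r T α β x t y))) := by
  rw [partialDensity, Real.log_prod, ← Finset.sum_coe_sort (Finset.Icc (p + 1) T)]
  · refine Finset.sum_congr rfl fun t _ => ?_
    have ht := Finset.mem_Icc.1 t.2
    rw [if_pos ht.2, log_gaussRatio (hpos t t.2 y)]
    have : path x y t = y t := by
      rw [path, dif_neg (by rw [Finset.mem_Icc]; omega), dif_pos t.2]
    rw [this]
  · intro t _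
    split_ifs
    · exact (gaussRatio_pos (hpos t t.2 y) _).ne'
    · exact one_ne_zero

end density

section likelihood

variable {p m n : ℕ} {q : Fin m → Fin (p + 1)} {r : Fin n → Fin (p + 1)} {T : ℕ}
  {α α' : ℝ → Fin m → ℝ} {β β' : Fin n → ℝ} {x : Finset.Icc 1 p → ℝ}
  (hpos : ∀ t ∈ Finset.Icc (p + 1) T, ∀ y, 0 < condVar q r T α β x t y)
  (hpos' : ∀ t ∈ Finset.Icc (p + 1) T, ∀ y, 0 < condVar q r T α' β' x t y)

include hpos hpos'

lemma condLaw_eq_withDensity_condLaw (hpT : p ≤ T) :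
    condLaw q r T α' β' x = (condLaw q r T α β x).withDensity (fun y => ENNReal.ofReal
      (partialDensity q r T α' β' x T y / partialDensity q r T α β x T y)) := by
  rw [condLaw_eq_withDensity hpos hpT, condLaw_eq_withDensity hpos' hpT,
    ← withDensity_mul _ (measurable_partialDensity T).ennreal_ofReal]
  swap
  · exact ((measurable_partialDensity T).div (measurable_partialDensity T)).ennreal_ofReal
  congr 1
  funext y
  have h := partialDensity_pos hpos T y
  rw [Pi.mul_apply, ← ENNReal.ofReal_mul h.le, mul_div_cancel₀ _ h.ne']

lemma condLaw_absolutelyContinuous (hpT : p ≤ T) :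
    condLaw q r T α' β' x ≪ condLaw q r T α β x := by
  rw [condLaw_eq_withDensity_condLaw hpos hpos' hpT]
  exact withDensity_absolutelyContinuous _ _

lemma llr_condLaw (hpT : p ≤ T) :
    llr (condLaw q r T α' β' x) (condLaw q r T α β x) =ᵐ[condLaw q r T α β x] fun y =>
      ∑ t ∈ Finset.Icc (p + 1) T,
        (-(1 / 2) * Real.log (condVar q r T α' β' x t y / condVar q r T α β x t y)
          + path x y t ^ 2 / 2
            * (1 / condVar q r T α β x t y - 1 / condVar q r T α' β' x t y)) := by
  have h := Measure.rnDeriv_withDensity (condLaw q r T α β x)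
    ((measurable_partialDensity (q := q) (r := r) (α := α') (β := β') (x := x) T).div
      (measurable_partialDensity (q := q) (r := r) (α := α) (β := β) (x := x) T)).ennreal_ofReal
  simp only [Pi.div_apply] at h
  rw [← condLaw_eq_withDensity_condLaw hpos hpos' hpT] at h
  filter_upwards [h] with y hy
  have h1 := partialDensity_pos hpos T y
  have h2 := partialDensity_pos hpos' T y
  rw [llr, hy, ENNReal.toReal_ofReal (div_pos h2 h1).le, Real.log_div h2.ne' h1.ne',
    log_partialDensity hpos, log_partialDensity hpos', ← Finset.sum_sub_distrib]
  refine Finset.sum_congr rfl fun t ht => ?_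
  rw [Real.log_div (hpos' t ht y).ne' (hpos t ht y).ne']
  have e1 := (hpos' t ht y).ne'
  have e2 := (hpos t ht y).ne'
  field_simp
  ring

end likelihood

/-! ### Squared ARCH recursions driven by the noise -/

lemma integrable_pow_gaussianReal (k : ℕ) :
    Integrable (fun z : ℝ => z ^ k) (gaussianReal 0 1) := by
  have := (memLp_id_gaussianReal (μ := 0) (v := 1) k).integrable_norm_pow'
  exact this.mono' (by fun_prop) (by simp)

lemma integral_sq_gaussianReal : ∫ z, z ^ 2 ∂gaussianReal 0 1 = 1 := by
  have := variance_fun_id_gaussianReal (μ := 0) (v := 1)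
  rw [variance_eq_integral measurable_id'.aemeasurable] at this
  simpa using this

section noise

variable {Ω : Type*}

/-- The `σ`-algebra generated by the noise variables `ξ_s`, `s ∈ S`. -/
abbrev noiseSigma (ξ : ℤ → Ω → ℝ) (S : Set ℤ) : MeasurableSpace Ω :=
  ⨆ s ∈ S, MeasurableSpace.comap (ξ s) inferInstance

lemma noiseSigma_mono (ξ : ℤ → Ω → ℝ) {S S' : Set ℤ} (h : S ⊆ S') :
    noiseSigma ξ S ≤ noiseSigma ξ S' := biSup_mono h

lemma measurable_noise (ξ : ℤ → Ω → ℝ) {S : Set ℤ} {s : ℤ} (hs : s ∈ S) :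
    Measurable[noiseSigma ξ S] (ξ s) := by
  have : MeasurableSpace.comap (ξ s) inferInstance ≤ noiseSigma ξ S :=
    le_biSup (fun s => MeasurableSpace.comap (ξ s) inferInstance) hs
  exact (comap_measurable (ξ s)).mono this le_rfl

lemma measurable_lags {m : MeasurableSpace Ω} {p : ℕ} {Z : ℤ → Ω → ℝ} {t : ℤ}
    (h : ∀ j : Fin p, Measurable (Z (t - 1 - j))) :
    Measurable fun ω (j : Fin p) => Z (t - 1 - j) ω :=
  measurable_pi_lambda _ h

variable [mΩ : MeasurableSpace Ω] {P : Measure Ω} {ξ : ℤ → Ω → ℝ}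

lemma noiseSigma_le (hξ : IsGaussianNoise P ξ) (S : Set ℤ) : noiseSigma ξ S ≤ mΩ :=
  iSup₂_le fun s _ => (hξ.measurable s).comap_le

lemma indep_noiseSigma (hξ : IsGaussianNoise P ξ) {S S' : Set ℤ} (h : Disjoint S S') :
    Indep (noiseSigma ξ S) (noiseSigma ξ S') P :=
  indep_iSup_of_disjoint (fun s => (hξ.measurable s).comap_le) hξ.indep h

lemma integrable_noise_pow (hξ : IsGaussianNoise P ξ) (t : ℤ) (k : ℕ) :
    Integrable (fun ω => ξ t ω ^ k) P := by
  have h : Integrable (fun z : ℝ => z ^ k) (P.map (ξ t)) := by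
    rw [hξ.law t]
    exact integrable_pow_gaussianReal k
  exact h.comp_measurable (hξ.measurable t)

lemma integral_noise_sq (hξ : IsGaussianNoise P ξ) (t : ℤ) : ∫ ω, ξ t ω ^ 2 ∂P = 1 := by
  have h := integral_sq_gaussianReal
  rw [← hξ.law t, integral_map (hξ.measurable t).aemeasurable (by fun_prop)] at h
  exact h

lemma lintegral_noise_sq_mul (hξ : IsGaussianNoise P ξ) {t : ℤ} {F : Ω → ℝ≥0∞}
    (hF : Measurable[noiseSigma ξ (Set.Iio t)] F) :
    ∫⁻ ω, ENNReal.ofReal (ξ t ω ^ 2) * F ω ∂P = ∫⁻ ω, F ω ∂P := by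
  have h1 : Measurable[noiseSigma ξ {t}] fun ω => ENNReal.ofReal (ξ t ω ^ 2) :=
    ((measurable_noise ξ (Set.mem_singleton t)).pow_const 2).ennreal_ofReal
  rw [lintegral_mul_eq_lintegral_mul_lintegral_of_independent_measurableSpace
      (noiseSigma_le hξ {t}) (noiseSigma_le hξ (Set.Iio t))
      (indep_noiseSigma hξ (by simp)) h1 hF,
    ← ofReal_integral_eq_lintegral_ofReal (integrable_noise_pow hξ t 2)
      (Eventually.of_forall fun ω => sq_nonneg _), integral_noise_sq hξ]
  simp

/-- A nonnegative process `Z`, adapted to the noise, which on `(s₀, s₁]` satisfies the recursion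
`Z_t = ξ_t² (c_{t,0} + ∑ⱼ c_{t,j} Z_{t-j})` of the squares of a tv-ARCH process. -/
structure IsSqARCH (P : Measure Ω) (ξ : ℤ → Ω → ℝ) {p : ℕ} (c : ℤ → Fin (p + 1) → ℝ) (s₀ s₁ : ℤ)
    (Z : ℤ → Ω → ℝ) : Prop where
  nonneg : ∀ t ω, 0 ≤ Z t ω
  adapted : ∀ t, Measurable[noiseSigma ξ (Set.Iic t)] (Z t)
  recursion : ∀ t, s₀ < t → t ≤ s₁ → ∀ᵐ ω ∂P, Z t ω = ξ t ω ^ 2 * lin (c t) (pastZ p Z t ω)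

namespace IsSqARCH

variable {p : ℕ} {c c' : ℤ → Fin (p + 1) → ℝ} {s₀ s₁ : ℤ} {Z Z' : ℤ → Ω → ℝ}

lemma measurable (hξ : IsGaussianNoise P ξ) (hZ : IsSqARCH P ξ c s₀ s₁ Z) (t : ℤ) :
    Measurable (Z t) := (hZ.adapted t).mono (noiseSigma_le hξ _) le_rfl

lemma measurable_pastZ (hZ : IsSqARCH P ξ c s₀ s₁ Z) (t : ℤ) :
    Measurable[noiseSigma ξ (Set.Iio t)] fun ω => pastZ p Z t ω := by
  refine measurable_lags fun j => ?_
  refine (hZ.adapted _).mono (noiseSigma_mono ξ fun s hs => ?_) le_rfl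
  simp only [Set.mem_Iic, Set.mem_Iio] at hs ⊢
  omega

lemma pastZ_nonneg (hZ : IsSqARCH P ξ c s₀ s₁ Z) (t : ℤ) (ω : Ω) (j : Fin p) :
    0 ≤ pastZ p Z t ω j := hZ.nonneg _ ω

lemma mono (hZ : IsSqARCH P ξ c s₀ s₁ Z) {s₀' s₁' : ℤ} (h₀ : s₀ ≤ s₀') (h₁ : s₁' ≤ s₁) :
    IsSqARCH P ξ c s₀' s₁' Z :=
  ⟨hZ.nonneg, hZ.adapted, fun t h h' => hZ.recursion t (by omega) (by omega)⟩

end IsSqARCH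

/-- A nonnegative sequence dominated by `∑ⱼ aⱼ e_{t-j} + δ` with `∑ⱼ aⱼ ≤ ρ ^ p` decays at the
geometric rate `ρ` towards a level of order `δ`. -/
lemma geom_recursion_bound {p : ℕ} {a : ℤ → Fin p → ℝ} {e : ℤ → ℝ≥0∞} {ρ A δ : ℝ} {s₀ s₁ : ℤ}
    (hρ : 0 ≤ ρ) (hρ1 : ρ ≤ 1) (hρp : ρ ^ p < 1) (hA : 0 ≤ A) (hδ : 0 ≤ δ)
    (ha : ∀ t, s₀ < t → t ≤ s₁ → ∀ j, 0 ≤ a t j)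
    (hsum : ∀ t, s₀ < t → t ≤ s₁ → ∑ j, a t j ≤ ρ ^ p)
    (h0 : ∀ t, s₀ - p < t → t ≤ s₀ → e t ≤ ENNReal.ofReal A)
    (hrec : ∀ t, s₀ < t → t ≤ s₁ →
      e t ≤ ∑ j : Fin p, ENNReal.ofReal (a t j) * e (t - 1 - j) + ENNReal.ofReal δ) :
    ∀ t, s₀ - p < t → t ≤ s₁ → e t ≤ ENNReal.ofReal (A * ρ ^ (t - s₀).toNat + δ / (1 - ρ ^ p)) := by
  have h1 : 0 < 1 - ρ ^ p := by linarith
  have hq : 0 ≤ δ / (1 - ρ ^ p) := div_nonneg hδ h1.le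
  suffices H : ∀ k : ℕ, ∀ t, s₀ - p < t → t ≤ s₁ → t ≤ s₀ + k →
      e t ≤ ENNReal.ofReal (A * ρ ^ (t - s₀).toNat + δ / (1 - ρ ^ p)) from
    fun t ht ht1 => H (t - s₀).toNat t ht ht1 (by omega)
  have hinit : ∀ t, s₀ - p < t → t ≤ s₀ →
      e t ≤ ENNReal.ofReal (A * ρ ^ (t - s₀).toNat + δ / (1 - ρ ^ p)) := fun t ht ht0 => by
    rw [show (t - s₀).toNat = 0 by omega, pow_zero, mul_one]
    exact (h0 t ht ht0).trans (ENNReal.ofReal_le_ofReal (by linarith))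
  intro k
  induction k with
  | zero => exact fun t ht _ htk => hinit t ht (by omega)
  | succ k ih =>
    intro t ht ht1 htk
    by_cases hts : t ≤ s₀
    · exact hinit t ht hts
    push Not at hts
    have hb : ∀ j : Fin p, e (t - 1 - j)
        ≤ ENNReal.ofReal (A * ρ ^ ((t - 1 - j) - s₀).toNat + δ / (1 - ρ ^ p)) := fun j =>
      ih _ (by omega) (by omega) (by push_cast at htk; omega)
    have ha' := ha t hts ht1
    have hstep : ∀ j : Fin p, a t j * (A * ρ ^ ((t - 1 - j) - s₀).toNat + δ / (1 - ρ ^ p)) * ρ ^ p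
        ≤ a t j * (A * ρ ^ (t - s₀).toNat + ρ ^ p * (δ / (1 - ρ ^ p))) := fun j => by
      rw [mul_assoc]
      refine mul_le_mul_of_nonneg_left ?_ (ha' j)
      have : ρ ^ ((t - 1 - j) - s₀).toNat * ρ ^ p ≤ ρ ^ (t - s₀).toNat := by
        rw [← pow_add]
        exact pow_le_pow_of_le_one hρ hρ1 (by omega)
      nlinarith
    have key : ∑ j : Fin p, a t j * (A * ρ ^ ((t - 1 - j) - s₀).toNat + δ / (1 - ρ ^ p)) + δ
        ≤ A * ρ ^ (t - s₀).toNat + δ / (1 - ρ ^ p) := by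
      have hfin : δ / (1 - ρ ^ p) = ρ ^ p * (δ / (1 - ρ ^ p)) + δ := by field_simp; ring
      rcases (pow_nonneg hρ p).eq_or_lt with hz | hz
      · -- if `ρ ^ p = 0` then all the coefficients vanish
        have : ∀ j : Fin p, a t j = 0 := fun j =>
          (Finset.sum_eq_zero_iff_of_nonneg fun i _ => ha' i).1
            (le_antisymm ((hsum t hts ht1).trans hz.symm.le)
              (Finset.sum_nonneg fun i _ => ha' i)) j (Finset.mem_univ j)
        simp only [this, zero_mul, Finset.sum_const_zero, zero_add]
        rw [← hz]
        have := mul_nonneg hA (pow_nonneg hρ (t - s₀).toNat)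
        simpa using this
      · have h2 : (∑ j : Fin p, a t j * (A * ρ ^ ((t - 1 - j) - s₀).toNat + δ / (1 - ρ ^ p)))
            * ρ ^ p ≤ ρ ^ p * (A * ρ ^ (t - s₀).toNat + ρ ^ p * (δ / (1 - ρ ^ p))) := by
          rw [Finset.sum_mul]
          refine (Finset.sum_le_sum fun j _ => hstep j).trans ?_
          rw [← Finset.sum_mul]
          exact mul_le_mul_of_nonneg_right (hsum t hts ht1) (by positivity)
        rw [mul_comm] at h2
        have h3 := le_of_mul_le_mul_left h2 hz
        linarith
    refine (hrec t hts ht1).trans (le_trans ?_ (ENNReal.ofReal_le_ofReal key))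
    have hn : ∀ j : Fin p, 0 ≤ a t j * (A * ρ ^ ((t - 1 - j) - s₀).toNat + δ / (1 - ρ ^ p)) :=
      fun j => mul_nonneg (ha' j) (by positivity)
    rw [ENNReal.ofReal_add (Finset.sum_nonneg fun j _ => hn j) hδ,
      ENNReal.ofReal_sum_of_nonneg fun j _ => hn j]
    gcongr with j
    rw [ENNReal.ofReal_mul (ha' j)]
    gcongr
    exact hb j

namespace IsSqARCH

variable {p : ℕ} {c c' : ℤ → Fin (p + 1) → ℝ} {s₀ s₁ : ℤ} {Z Z' : ℤ → Ω → ℝ} {ρ A C η M : ℝ}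

/-- First moments, restricted to an event of the initial `σ`-algebra, contract geometrically. -/
lemma setLIntegral_le [IsProbabilityMeasure P] (hξ : IsGaussianNoise P ξ)
    (hZ : IsSqARCH P ξ c s₀ s₁ Z)
    (hρ : 0 ≤ ρ) (hρ1 : ρ ≤ 1) (hρp : ρ ^ p < 1) (hA : 0 ≤ A)
    (hc : ∀ t, s₀ < t → t ≤ s₁ → ∀ k, 0 ≤ c t k)
    (hsum : ∀ t, s₀ < t → t ≤ s₁ → ∑ j : Fin p, c t j.succ ≤ ρ ^ p)
    (hC0 : 0 ≤ C) (hC : ∀ t, s₀ < t → t ≤ s₁ → c t 0 ≤ C)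
    {B : Set Ω} (hB : MeasurableSet[noiseSigma ξ (Set.Iic s₀)] B)
    (h0 : ∀ t, s₀ - p < t → t ≤ s₀ → ∫⁻ ω in B, ENNReal.ofReal (Z t ω) ∂P ≤ ENNReal.ofReal A) :
    ∀ t, s₀ - p < t → t ≤ s₁ → ∫⁻ ω in B, ENNReal.ofReal (Z t ω) ∂P
      ≤ ENNReal.ofReal (A * ρ ^ (t - s₀).toNat + C / (1 - ρ ^ p)) := by
  refine geom_recursion_bound (a := fun t j => c t j.succ) hρ hρ1 hρp hA hC0
    (fun t h h' j => hc t h h' _) hsum h0 fun t ht ht1 => ?_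
  have hB' : MeasurableSet B := noiseSigma_le hξ _ _ hB
  have hBt : MeasurableSet[noiseSigma ξ (Set.Iio t)] B :=
    noiseSigma_mono ξ (Set.Iic_subset_Iio.2 ht) _ hB
  have hlin : Measurable[noiseSigma ξ (Set.Iio t)] fun ω =>
      B.indicator (fun ω => ENNReal.ofReal (lin (c t) (pastZ p Z t ω))) ω :=
    (((measurable_lin _).comp (hZ.measurable_pastZ t)).ennreal_ofReal).indicator hBt
  calc ∫⁻ ω in B, ENNReal.ofReal (Z t ω) ∂P
      = ∫⁻ ω, ENNReal.ofReal (ξ t ω ^ 2)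
          * B.indicator (fun ω => ENNReal.ofReal (lin (c t) (pastZ p Z t ω))) ω ∂P := by
        rw [← lintegral_indicator hB']
        refine lintegral_congr_ae ?_
        filter_upwards [hZ.recursion t ht ht1] with ω hω
        by_cases hωB : ω ∈ B
        · simp only [Set.indicator_of_mem hωB]
          rw [hω, ENNReal.ofReal_mul (sq_nonneg _)]
        · simp [Set.indicator_of_notMem hωB]
    _ = ∫⁻ ω in B, ENNReal.ofReal (lin (c t) (pastZ p Z t ω)) ∂P := by
        rw [lintegral_noise_sq_mul hξ hlin, lintegral_indicator hB']
    _ = ∫⁻ ω in B, (∑ j : Fin p, ENNReal.ofReal (c t j.succ) * ENNReal.ofReal (Z (t - 1 - j) ω)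
          + ENNReal.ofReal (c t 0)) ∂P := by
        refine lintegral_congr fun ω => ?_
        rw [lin, ENNReal.ofReal_add (hc t ht ht1 0) (Finset.sum_nonneg fun j _ =>
          mul_nonneg (hc t ht ht1 _) (hZ.pastZ_nonneg t ω j)), ENNReal.ofReal_sum_of_nonneg
          fun j _ => mul_nonneg (hc t ht ht1 _) (hZ.pastZ_nonneg t ω j), add_comm]
        simp_rw [ENNReal.ofReal_mul (hc t ht ht1 _)]
        rfl
    _ = ∑ j : Fin p, ENNReal.ofReal (c t j.succ) * ∫⁻ ω in B, ENNReal.ofReal (Z (t - 1 - j) ω) ∂P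
          + ENNReal.ofReal (c t 0) * P B := by
        have hm : ∀ s, Measurable fun ω => ENNReal.ofReal (Z s ω) := fun s =>
          (hZ.measurable hξ s).ennreal_ofReal
        rw [lintegral_add_right _ measurable_const,
          lintegral_finsetSum _ fun j _ => (hm _).const_mul _]
        simp [lintegral_const_mul _ (hm _)]
    _ ≤ _ := by
        gcongr
        calc _ ≤ ENNReal.ofReal (c t 0) * 1 := by gcongr; exact prob_le_one
          _ ≤ _ := by rw [mul_one]; exact ENNReal.ofReal_le_ofReal (hC t ht ht1)

/-- Coupling: two recursions driven by the same noise forget their initial values at the geometric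
rate `ρ`, up to an error proportional to the distance of their coefficients. -/
lemma lintegral_abs_sub_le [IsProbabilityMeasure P] (hξ : IsGaussianNoise P ξ)
    (hZ : IsSqARCH P ξ c s₀ s₁ Z) (hZ' : IsSqARCH P ξ c' s₀ s₁ Z')
    (hρ : 0 ≤ ρ) (hρ1 : ρ ≤ 1) (hρp : ρ ^ p < 1) (hA : 0 ≤ A) (hη : 0 ≤ η) (hM : 0 ≤ M)
    (hc : ∀ t, s₀ < t → t ≤ s₁ → ∀ k, 0 ≤ c t k)
    (hsum : ∀ t, s₀ < t → t ≤ s₁ → ∑ j : Fin p, c t j.succ ≤ ρ ^ p)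
    (hcc : ∀ t, s₀ < t → t ≤ s₁ → ∀ k, |c t k - c' t k| ≤ η)
    (hM' : ∀ t, s₀ - p < t → t ≤ s₁ → ∫⁻ ω, ENNReal.ofReal (Z' t ω) ∂P ≤ ENNReal.ofReal M)
    (h0 : ∀ t, s₀ - p < t → t ≤ s₀ →
      ∫⁻ ω, ENNReal.ofReal |Z t ω - Z' t ω| ∂P ≤ ENNReal.ofReal A) :
    ∀ t, s₀ - p < t → t ≤ s₁ → ∫⁻ ω, ENNReal.ofReal |Z t ω - Z' t ω| ∂P
      ≤ ENNReal.ofReal (A * ρ ^ (t - s₀).toNat + η * (1 + p * M) / (1 - ρ ^ p)) := by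
  refine geom_recursion_bound (a := fun t j => c t j.succ) hρ hρ1 hρp hA (by positivity)
    (fun t h h' j => hc t h h' _) hsum h0 fun t ht ht1 => ?_
  have hm : ∀ s, Measurable fun ω => ENNReal.ofReal |Z s ω - Z' s ω| := fun s =>
    (measurable_norm.comp ((hZ.measurable hξ s).sub (hZ'.measurable hξ s))).ennreal_ofReal
  have hm' : ∀ s, Measurable fun ω => ENNReal.ofReal (Z' s ω) := fun s =>
    (hZ'.measurable hξ s).ennreal_ofReal
  have hlin : Measurable[noiseSigma ξ (Set.Iio t)] fun ω =>
      ENNReal.ofReal |lin (c t) (pastZ p Z t ω) - lin (c' t) (pastZ p Z' t ω)| :=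
    (measurable_norm.comp (((measurable_lin _).comp (hZ.measurable_pastZ t)).sub
      ((measurable_lin _).comp (hZ'.measurable_pastZ t)))).ennreal_ofReal
  calc ∫⁻ ω, ENNReal.ofReal |Z t ω - Z' t ω| ∂P
      = ∫⁻ ω, ENNReal.ofReal (ξ t ω ^ 2) * ENNReal.ofReal
          |lin (c t) (pastZ p Z t ω) - lin (c' t) (pastZ p Z' t ω)| ∂P := by
        refine lintegral_congr_ae ?_
        filter_upwards [hZ.recursion t ht ht1, hZ'.recursion t ht ht1] with ω hω hω'
        rw [hω, hω', ← mul_sub, abs_mul, abs_of_nonneg (sq_nonneg (ξ t ω)),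
          ENNReal.ofReal_mul (sq_nonneg _)]
    _ = ∫⁻ ω, ENNReal.ofReal |lin (c t) (pastZ p Z t ω) - lin (c' t) (pastZ p Z' t ω)| ∂P :=
        lintegral_noise_sq_mul hξ hlin
    _ ≤ ∫⁻ ω, (∑ j : Fin p, ENNReal.ofReal (c t j.succ)
            * ENNReal.ofReal |Z (t - 1 - j) ω - Z' (t - 1 - j) ω|
          + ENNReal.ofReal η * (1 + ∑ j : Fin p, ENNReal.ofReal (Z' (t - 1 - j) ω))) ∂P := by
        refine lintegral_mono fun ω => ?_
        have h1 : |lin (c t) (pastZ p Z t ω) - lin (c' t) (pastZ p Z' t ω)|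
            ≤ ∑ j : Fin p, c t j.succ * |Z (t - 1 - j) ω - Z' (t - 1 - j) ω|
              + η * (1 + ∑ j : Fin p, Z' (t - 1 - j) ω) := by
          refine (abs_sub_le _ (lin (c t) (pastZ p Z' t ω)) _).trans (add_le_add ?_ ?_)
          · rw [lin_sub_lin_right]
            refine (Finset.abs_sum_le_sum_abs _ _).trans (Finset.sum_le_sum fun j _ => ?_)
            rw [abs_mul, abs_of_nonneg (hc t ht ht1 _)]
            rfl
          · rw [lin_sub_lin_left]
            exact abs_lin_le (hcc t ht ht1) (hZ'.pastZ_nonneg t ω)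
        refine (ENNReal.ofReal_le_ofReal h1).trans (le_of_eq ?_)
        have n1 : ∀ j : Fin p, 0 ≤ c t j.succ * |Z (t - 1 - j) ω - Z' (t - 1 - j) ω| := fun j =>
          mul_nonneg (hc t ht ht1 _) (abs_nonneg _)
        have n2 : 0 ≤ ∑ j : Fin p, Z' (t - 1 - j) ω := Finset.sum_nonneg fun j _ => hZ'.nonneg _ ω
        rw [ENNReal.ofReal_add (Finset.sum_nonneg fun j _ => n1 j) (by positivity),
          ENNReal.ofReal_sum_of_nonneg fun j _ => n1 j, ENNReal.ofReal_mul hη,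
          ENNReal.ofReal_add zero_le_one n2,
          ENNReal.ofReal_sum_of_nonneg fun j _ => hZ'.nonneg _ ω, ENNReal.ofReal_one]
        simp_rw [ENNReal.ofReal_mul (hc t ht ht1 _)]
    _ = ∑ j : Fin p, ENNReal.ofReal (c t j.succ)
            * ∫⁻ ω, ENNReal.ofReal |Z (t - 1 - j) ω - Z' (t - 1 - j) ω| ∂P
          + ENNReal.ofReal η * (1 + ∑ j : Fin p, ∫⁻ ω, ENNReal.ofReal (Z' (t - 1 - j) ω) ∂P) := by
        rw [lintegral_add_left (Finset.measurable_sum _ fun j _ => (hm _).const_mul _),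
          lintegral_finsetSum _ fun j _ => (hm _).const_mul _,
          lintegral_const_mul _ (show Measurable fun ω =>
            1 + ∑ j : Fin p, ENNReal.ofReal (Z' (t - 1 - j) ω) from
            measurable_const.add (Finset.measurable_sum _ fun j _ => hm' _)),
          lintegral_add_left measurable_const, lintegral_finsetSum _ fun j _ => hm' _]
        simp [lintegral_const_mul _ (hm _)]
    _ ≤ _ := by
        gcongr
        rw [ENNReal.ofReal_mul hη, ENNReal.ofReal_add zero_le_one (by positivity),
          ENNReal.ofReal_one]
        gcongr
        calc _ ≤ ∑ j : Fin p, ENNReal.ofReal M :=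
              Finset.sum_le_sum fun j _ => hM' _ (by omega) (by omega)
          _ = _ := by
              rw [Finset.sum_const, Finset.card_univ, Fintype.card_fin, nsmul_eq_mul,
                ENNReal.ofReal_mul (by positivity), ENNReal.ofReal_natCast]

/-- A stationary solution has a finite first moment. No moment is assumed: on the event that the
initial values are at most `R`, the first moment after a long time is bounded independently of `R`,
and by stationarity this controls the truncated moments at time `0`. -/
lemma lintegral_le_of_stationary [IsProbabilityMeasure P] (hξ : IsGaussianNoise P ξ)
    (hZ : ∀ s₁, IsSqARCH P ξ c 0 s₁ Z) (hstat : ∀ t, P.map (Z t) = P.map (Z 0))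
    (hρ : 0 ≤ ρ) (hρ1 : ρ < 1) (hρp : ρ ^ p < 1)
    (hc : ∀ t k, 0 ≤ c t k) (hsum : ∀ t, ∑ j : Fin p, c t j.succ ≤ ρ ^ p)
    (hC0 : 0 ≤ C) (hC : ∀ t, c t 0 ≤ C) (t : ℤ) :
    ∫⁻ ω, ENNReal.ofReal (Z t ω) ∂P ≤ ENNReal.ofReal (C / (1 - ρ ^ p)) := by
  have hmeas : ∀ s, Measurable (Z s) := fun s => (hZ 0).measurable hξ s
  have hsame : ∀ (f : ℝ → ℝ≥0∞), Measurable f → ∀ s, ∫⁻ ω, f (Z s ω) ∂P = ∫⁻ ω, f (Z 0 ω) ∂P :=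
    fun f hf s => by
      rw [← lintegral_map hf (hmeas s), hstat s, lintegral_map hf (hmeas 0)]
  rw [hsame _ ENNReal.measurable_ofReal t]
  set b := C / (1 - ρ ^ p) with hb
  let B : ℕ → Set Ω := fun R => ⋂ j : Fin p, {ω | Z (-(j : ℤ)) ω ≤ R}
  have hBm : ∀ R, MeasurableSet[noiseSigma ξ (Set.Iic 0)] (B R) := fun R => by
    refine MeasurableSet.iInter fun j => ?_
    refine noiseSigma_mono ξ (Set.Iic_subset_Iic.2 (by omega)) _
      (((hZ 0).adapted (-(j : ℤ))) (measurableSet_Iic (a := (R : ℝ))))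
  have hBm' : ∀ R, MeasurableSet (B R) := fun R => noiseSigma_le hξ _ _ (hBm R)
  have hBt : Tendsto (fun R => P (B R)ᶜ) atTop (𝓝 0) := by
    have hanti : Antitone fun R => (B R)ᶜ := fun R R' h => by
      refine Set.compl_subset_compl.2 (Set.iInter_mono fun j ω hω => ?_)
      exact le_trans (show Z (-(j : ℤ)) ω ≤ R from hω) (by exact_mod_cast h)
    have hempty : ⋂ R, (B R)ᶜ = ∅ := by
      rw [← Set.compl_iUnion, Set.compl_empty_iff, Set.eq_univ_iff_forall]
      intro ω
      obtain ⟨R, hR⟩ := exists_nat_ge (∑ j : Fin p, Z (-(j : ℤ)) ω)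
      refine Set.mem_iUnion.2 ⟨R, Set.mem_iInter.2 fun j => le_trans ?_ hR⟩
      exact Finset.single_le_sum (f := fun j : Fin p => Z (-(j : ℤ)) ω)
        (fun i _ => (hZ 0).nonneg _ ω) (Finset.mem_univ j)
    have := tendsto_measure_iInter_atTop (μ := P)
      (fun R => (hBm' R).compl.nullMeasurableSet) hanti ⟨0, measure_ne_top _ _⟩
    rwa [hempty, measure_empty] at this
  have htrunc : ∀ K R : ℕ, ∫⁻ ω, min (ENNReal.ofReal (Z 0 ω)) K ∂P
      ≤ ENNReal.ofReal b + K * P (B R)ᶜ := fun K R => by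
    have hlim : Tendsto (fun s : ℕ => ENNReal.ofReal (R * ρ ^ s + b) + K * P (B R)ᶜ) atTop
        (𝓝 (ENNReal.ofReal (R * 0 + b) + K * P (B R)ᶜ)) :=
      ((ENNReal.tendsto_ofReal (((tendsto_pow_atTop_nhds_zero_of_lt_one hρ hρ1).const_mul
        (R : ℝ)).add_const b))).add_const _
    rw [mul_zero, zero_add] at hlim
    refine ge_of_tendsto hlim ?_
    filter_upwards [eventually_ge_atTop 1] with s hs
    rw [← hsame (fun z => min (ENNReal.ofReal z) K) (by fun_prop) s,
      ← lintegral_add_compl _ (hBm' R)]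
    refine add_le_add ?_ ?_
    · refine (lintegral_mono fun ω => min_le_left _ _).trans ?_
      refine ((hZ s).setLIntegral_le hξ hρ hρ1.le hρp (Nat.cast_nonneg R) (fun _ _ _ => hc _)
        (fun _ _ _ => hsum _) hC0 (fun _ _ _ => hC _) (hBm R) ?_ s (by omega) le_rfl).trans ?_
      · intro t ht ht0
        calc _ ≤ ∫⁻ ω in B R, ENNReal.ofReal R ∂P := by
              refine setLIntegral_mono measurable_const fun ω hω => ENNReal.ofReal_le_ofReal ?_
              have := Set.mem_iInter.1 hω ⟨(-t).toNat, by omega⟩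
              simpa [Int.toNat_of_nonneg (show 0 ≤ -t by omega)] using this
          _ = ENNReal.ofReal R * P (B R) := by simp
          _ ≤ ENNReal.ofReal R * 1 := by gcongr; exact prob_le_one
          _ = _ := mul_one _
      · simp [hb]
    · refine (lintegral_mono fun ω => min_le_right _ _).trans ?_
      simp
  have htrunc' : ∀ K : ℕ, ∫⁻ ω, min (ENNReal.ofReal (Z 0 ω)) K ∂P ≤ ENNReal.ofReal b := fun K => by
    have hlim : Tendsto (fun R => ENNReal.ofReal b + K * P (B R)ᶜ) atTop
        (𝓝 (ENNReal.ofReal b + K * 0)) :=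
      (ENNReal.Tendsto.const_mul hBt (Or.inr (ENNReal.natCast_ne_top K))).const_add _
    rw [mul_zero, add_zero] at hlim
    exact ge_of_tendsto' hlim (htrunc K)
  have hlim : Tendsto (fun K : ℕ => ∫⁻ ω, min (ENNReal.ofReal (Z 0 ω)) K ∂P) atTop
      (𝓝 (∫⁻ ω, ENNReal.ofReal (Z 0 ω) ∂P)) := by
    refine lintegral_tendsto_of_tendsto_of_monotone (fun K => ?_) ?_ ?_
    · exact ((hmeas 0).ennreal_ofReal.min measurable_const).aemeasurable
    · refine Eventually.of_forall fun ω K K' h => ?_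
      exact min_le_min_left _ (by exact_mod_cast h)
    · refine Eventually.of_forall fun ω => ?_
      obtain ⟨K₀, hK₀⟩ := ENNReal.exists_nat_gt (ENNReal.ofReal_ne_top (r := Z 0 ω))
      refine tendsto_const_nhds.congr' ?_
      filter_upwards [eventually_ge_atTop K₀] with K hK
      exact (min_eq_left (hK₀.le.trans (by exact_mod_cast hK))).symm
  exact le_of_tendsto' hlim htrunc'

end IsSqARCH

/-- The squared ARCH process with coefficients `c`, started from `0` at all times up to `s₀`. -/
def freshARCH {p : ℕ} (ξ : ℤ → Ω → ℝ) (c : Fin (p + 1) → ℝ) (s₀ t : ℤ) (ω : Ω) : ℝ :=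
  if s₀ < t then ξ t ω ^ 2 * lin c (fun j : Fin p => freshARCH ξ c s₀ (t - 1 - j) ω) else 0
termination_by (t - s₀).toNat

section fresh

variable {p : ℕ} {c : Fin (p + 1) → ℝ} {s₀ : ℤ}

omit mΩ in
lemma freshARCH_of_le {t : ℤ} (ht : t ≤ s₀) (ω : Ω) : freshARCH ξ c s₀ t ω = 0 := by
  rw [freshARCH, if_neg (by omega)]

omit mΩ in
lemma freshARCH_of_lt {t : ℤ} (ht : s₀ < t) (ω : Ω) :
    freshARCH ξ c s₀ t ω = ξ t ω ^ 2 * lin c (pastZ p (freshARCH ξ c s₀) t ω) := by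
  rw [freshARCH, if_pos ht]; rfl

omit mΩ in
lemma freshARCH_nonneg (hc : ∀ k, 0 ≤ c k) (t : ℤ) (ω : Ω) : 0 ≤ freshARCH ξ c s₀ t ω := by
  induction hk : (t - s₀).toNat using Nat.strong_induction_on generalizing t with
  | _ k ih =>
    by_cases ht : s₀ < t
    · rw [freshARCH_of_lt ht]
      refine mul_nonneg (sq_nonneg _) (lin_nonneg hc fun j => ?_)
      exact ih _ (by omega) _ rfl
    · exact (freshARCH_of_le (by omega) ω).ge

omit mΩ in
lemma measurable_freshARCH (t : ℤ) :
    Measurable[noiseSigma ξ (Set.Ioc s₀ t)] (freshARCH ξ c s₀ t) := by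
  induction hk : (t - s₀).toNat using Nat.strong_induction_on generalizing t with
  | _ k ih =>
    by_cases ht : s₀ < t
    · rw [show freshARCH ξ c s₀ t = _ from funext (freshARCH_of_lt ht)]
      have h1 : Measurable[noiseSigma ξ (Set.Ioc s₀ t)] (ξ t) := measurable_noise ξ ⟨ht, le_rfl⟩
      have h2 : Measurable[noiseSigma ξ (Set.Ioc s₀ t)] fun ω => pastZ p (freshARCH ξ c s₀) t ω :=
        measurable_lags fun j => (ih _ (by omega) (t - 1 - j) rfl).mono
          (noiseSigma_mono ξ (Set.Ioc_subset_Ioc_right (by omega))) le_rfl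
      exact (h1.pow_const 2).mul ((measurable_lin c).comp h2)
    · rw [show freshARCH ξ c s₀ t = fun _ => 0 from funext (freshARCH_of_le (by omega))]
      exact measurable_const

lemma isSqARCH_freshARCH (hc : ∀ k, 0 ≤ c k) (s₁ : ℤ) :
    IsSqARCH P ξ (fun _ => c) s₀ s₁ (freshARCH ξ c s₀) where
  nonneg t ω := freshARCH_nonneg hc t ω
  adapted t := (measurable_freshARCH t).mono
    (noiseSigma_mono ξ fun _ hs => hs.2) le_rfl
  recursion _ ht _ := Eventually.of_forall (freshARCH_of_lt ht)

end fresh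

end noise

/-! ### Averages and Riemann sums -/

section averages

variable {Ω : Type*} [MeasurableSpace Ω] {P : Measure Ω}

/-- The second moment of a sum of variables that are orthogonal at lags greater than `N`. -/
lemma integral_sq_sum_le {I : Finset ℕ} {f : ℕ → Ω → ℝ} {N : ℕ} {B : ℝ} (hB0 : 0 ≤ B)
    (hint : ∀ s ∈ I, ∀ t ∈ I, Integrable (fun ω => f s ω * f t ω) P)
    (hB : ∀ s ∈ I, ∀ t ∈ I, ∫ ω, f s ω * f t ω ∂P ≤ B)
    (horth : ∀ s ∈ I, ∀ t ∈ I, s + N < t → ∫ ω, f s ω * f t ω ∂P = 0) :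
    ∫ ω, (∑ t ∈ I, f t ω) ^ 2 ∂P ≤ I.card * ((2 * N + 1) * B) := by
  have h1 : ∀ ω, (∑ t ∈ I, f t ω) ^ 2 = ∑ s ∈ I, ∑ t ∈ I, f s ω * f t ω := fun ω => by
    rw [sq, Finset.sum_mul_sum]
  simp_rw [h1]
  rw [integral_finsetSum _ fun s hs => integrable_finsetSum _ fun t ht => hint s hs t ht]
  rw [← nsmul_eq_mul]
  refine Finset.sum_le_card_nsmul _ _ _ fun s hs => ?_
  rw [integral_finsetSum _ fun t ht => hint s hs t ht]
  calc ∑ t ∈ I, ∫ ω, f s ω * f t ω ∂P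
      ≤ ∑ t ∈ I, if t ∈ Finset.Icc (s - N) (s + N) then B else 0 := by
        refine Finset.sum_le_sum fun t ht => ?_
        split_ifs with h
        · exact hB s hs t ht
        · rw [Finset.mem_Icc, not_and_or, not_le, not_le] at h
          rcases h with h | h
          · have := horth t ht s hs (by omega)
            simp_rw [mul_comm (f s _)]
            exact this.le
          · exact (horth s hs t ht h).le
    _ = (I.filter (· ∈ Finset.Icc (s - N) (s + N))).card * B := by
        rw [← Finset.sum_filter, Finset.sum_const, nsmul_eq_mul]
    _ ≤ _ := by
        refine mul_le_mul_of_nonneg_right ?_ hB0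
        have : (I.filter (· ∈ Finset.Icc (s - N) (s + N))).card ≤ 2 * N + 1 :=
          (Finset.card_le_card fun t ht => (Finset.mem_filter.1 ht).2).trans
            (by rw [Nat.card_Icc]; omega)
        exact_mod_cast this

lemma integral_abs_le_of_integral_sq_le [IsProbabilityMeasure P] {f : Ω → ℝ} {a b : ℝ} (hb : 0 < b)
    (hint : Integrable (fun ω => f ω ^ 2) P) (h : ∫ ω, f ω ^ 2 ∂P ≤ a * b ^ 2) :
    ∫ ω, |f ω| ∂P ≤ (1 + a) * b := by
  have h1 : ∀ ω, |f ω| ≤ b + b⁻¹ * f ω ^ 2 := fun ω => by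
    have h2 : b * |f ω| ≤ b * (b + b⁻¹ * f ω ^ 2) := by
      have : b * (b + b⁻¹ * f ω ^ 2) = b ^ 2 + |f ω| ^ 2 := by rw [sq_abs]; field_simp
      nlinarith [sq_nonneg (b - |f ω|), sq_nonneg (b + |f ω|)]
    exact le_of_mul_le_mul_left h2 hb
  have hi : Integrable (fun ω => b + b⁻¹ * f ω ^ 2) P :=
    (integrable_const b).add (hint.const_mul _)
  calc ∫ ω, |f ω| ∂P ≤ ∫ ω, (b + b⁻¹ * f ω ^ 2) ∂P :=
        integral_mono_of_nonneg (Eventually.of_forall fun ω => abs_nonneg _) hi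
          (Eventually.of_forall h1)
    _ = b + b⁻¹ * ∫ ω, f ω ^ 2 ∂P := by
        rw [integral_add (integrable_const b) (hint.const_mul _), integral_const_mul]
        simp
    _ ≤ b + b⁻¹ * (a * b ^ 2) := by gcongr
    _ = (1 + a) * b := by field_simp

/-- The error of the right-endpoint Riemann sum of a Lipschitz function. -/
lemma abs_integral_sub_riemannSum_le {f : ℝ → ℝ} {Λ : ℝ}
    (hf : ∀ u ∈ Set.Icc (0 : ℝ) 1, ∀ v ∈ Set.Icc (0 : ℝ) 1, |f u - f v| ≤ Λ * |u - v|)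
    {T : ℕ} (hT : 0 < T) :
    |1 / T * ∑ t ∈ Finset.Icc 1 T, f (t / T) - ∫ u in (0 : ℝ)..1, f u| ≤ Λ * (1 / T) := by
  have hT' : (0 : ℝ) < T := by exact_mod_cast hT
  have hΛ : 0 ≤ Λ := by simpa using (abs_nonneg _).trans (hf 0 (by simp) 1 (by simp))
  have hcont : ContinuousOn f (Set.Icc 0 1) := by
    refine LipschitzOnWith.continuousOn (K := Λ.toNNReal) (LipschitzOnWith.of_dist_le_mul ?_)
    intro u hu v hv
    rw [Real.dist_eq, Real.dist_eq, Real.coe_toNNReal _ hΛ]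
    exact hf u hu v hv
  have hmem : ∀ k ≤ T, (k : ℝ) / T ∈ Set.Icc (0 : ℝ) 1 := fun k hk =>
    ⟨by positivity, (div_le_one hT').2 (by exact_mod_cast hk)⟩
  have hint : ∀ k < T, IntervalIntegrable f volume ((k : ℝ) / T) ((k + 1 : ℕ) / T) := fun k hk => by
    refine (hcont.mono ?_).intervalIntegrable
    exact Set.uIcc_subset_Icc (hmem k hk.le) (hmem (k + 1) hk)
  have hsum : ∫ u in (0 : ℝ)..1, f u
      = ∑ k ∈ Finset.range T, ∫ u in ((k : ℝ) / T)..((k + 1 : ℕ) / T), f u := by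
    rw [intervalIntegral.sum_integral_adjacent_intervals (a := fun k : ℕ => (k : ℝ) / T) hint]
    simp [hT'.ne']
  have hR : 1 / T * ∑ t ∈ Finset.Icc 1 T, f (t / T)
      = ∑ k ∈ Finset.range T, ∫ u in ((k : ℝ) / T)..((k + 1 : ℕ) / T), f ((k + 1 : ℕ) / T) := by
    have hI : Finset.Icc 1 T = Finset.Ico (0 + 1) (T + 1) := by ext; simp
    rw [hI, ← Finset.sum_Ico_add' (fun t : ℕ => f ((t : ℝ) / T)) 0 T 1, ← Finset.range_eq_Ico,
      Finset.mul_sum]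
    refine Finset.sum_congr rfl fun k _ => ?_
    rw [intervalIntegral.integral_const, smul_eq_mul]
    congr 1
    push_cast
    field_simp
    ring
  rw [hR, hsum, ← Finset.sum_sub_distrib]
  calc _ ≤ ∑ k ∈ Finset.range T, Λ * (1 / T) * (1 / T) := by
        refine (Finset.abs_sum_le_sum_abs _ _).trans (Finset.sum_le_sum fun k hk => ?_)
        have hk' := Finset.mem_range.1 hk
        have hlen : ((k + 1 : ℕ) : ℝ) / T - k / T = 1 / T := by push_cast; field_simp; ring
        rw [← intervalIntegral.integral_sub intervalIntegrable_const (hint k hk')]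
        have := intervalIntegral.norm_integral_le_of_norm_le_const (a := (k : ℝ) / T)
          (b := ((k + 1 : ℕ) : ℝ) / T) (C := Λ * (1 / T))
          (f := fun u => f (((k + 1 : ℕ) : ℝ) / T) - f u) fun u hu => ?_
        · rwa [hlen, abs_of_pos (a := 1 / (T : ℝ)) (by positivity), Real.norm_eq_abs] at this
        · have hle : (k : ℝ) / T ≤ ((k + 1 : ℕ) : ℝ) / T := by
            have : (0 : ℝ) ≤ 1 / T := by positivity
            linarith
          rw [Set.uIoc_of_le hle] at hu
          have h1 := hmem k hk'.le
          have h2 := hmem (k + 1) hk'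
          refine (hf _ h2 _ ⟨h1.1.trans hu.1.le, hu.2.trans h2.2⟩).trans ?_
          refine mul_le_mul_of_nonneg_left ?_ hΛ
          rw [abs_of_nonneg (by linarith [hu.2])]
          linarith [hu.1]
    _ = Λ * (1 / T) := by
        rw [Finset.sum_const, Finset.card_range, nsmul_eq_mul]
        field_simp

end averages

/-! ### Law of large numbers for the squared relative perturbation -/

section lln

variable {Ω : Type*} [MeasurableSpace Ω] {P : Measure Ω} [IsProbabilityMeasure P]
  {ξ : ℤ → Ω → ℝ} {p : ℕ} {c d : ℝ → Fin (p + 1) → ℝ} {κ C D L ρ : ℝ} {S : ℝ → ℤ → Ω → ℝ}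

lemma integrable_of_abs_le {f : Ω → ℝ} (hf : Measurable f) {W : ℝ} (hW : ∀ ω, |f ω| ≤ W) :
    Integrable f P :=
  Integrable.of_bound hf.aestronglyMeasurable W (Eventually.of_forall hW)

omit [IsProbabilityMeasure P] in
lemma integral_abs_le_of_lintegral_le {f : Ω → ℝ} {g : Fin p → Ω → ℝ} {K B : ℝ} (hK : 0 ≤ K)
    (hB : 0 ≤ B) (hf : ∀ ω, |f ω| ≤ K * ∑ j, |g j ω|) (hg : ∀ j, Measurable (g j))
    (hgB : ∀ j, ∫⁻ ω, ENNReal.ofReal |g j ω| ∂P ≤ ENNReal.ofReal B) :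
    ∫ ω, |f ω| ∂P ≤ K * (p * B) := by
  have hint : ∀ j, Integrable (fun ω => |g j ω|) P := fun j => by
    refine ⟨(hg j).norm.aestronglyMeasurable, ?_⟩
    rw [hasFiniteIntegral_iff_ofReal (Eventually.of_forall fun ω => abs_nonneg _)]
    exact (hgB j).trans_lt ENNReal.ofReal_lt_top
  have hle : ∀ j, ∫ ω, |g j ω| ∂P ≤ B := fun j => by
    rw [integral_eq_lintegral_of_nonneg_ae (Eventually.of_forall fun ω => abs_nonneg _)
      (hg j).norm.aestronglyMeasurable]
    exact ENNReal.toReal_le_of_le_ofReal hB (hgB j)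
  calc ∫ ω, |f ω| ∂P ≤ ∫ ω, K * ∑ j, |g j ω| ∂P :=
        integral_mono_of_nonneg (Eventually.of_forall fun ω => abs_nonneg _)
          ((integrable_finsetSum _ fun j _ => hint j).const_mul K) (Eventually.of_forall hf)
    _ = K * ∑ j, ∫ ω, |g j ω| ∂P := by
        rw [integral_const_mul, integral_finsetSum _ fun j _ => hint j]
    _ ≤ K * ∑ _j : Fin p, B := by gcongr with j; exact hle j
    _ = K * (p * B) := by simp

/-- A Lipschitz constant of the squared ratio in the squared past values. -/
def ratioLip (κ C D : ℝ) : ℝ := 2 * (D / κ) * ((D + D / κ * C) / κ)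

/-- The second moment `E w_1(u)²` of the relative perturbation of the conditional variance of the
stationary process with coefficients `c u`; it equals `(g(u), h)' E(u) (g(u), h)`. -/
def meanSq (P : Measure Ω) (c d : ℝ → Fin (p + 1) → ℝ) (S : ℝ → ℤ → Ω → ℝ) (u : ℝ) : ℝ :=
  ∫ ω, ratio (c u) (d u) (pastZ p (S u) 1 ω) ^ 2 ∂P

variable (h : RegularCoeffs c d κ C D L ρ)

include h

namespace RegularCoeffs

lemma ratioLip_nonneg : 0 ≤ ratioLip κ C D := by
  have := h.pos; have := h.upper_nonneg; have := h.dir_nonneg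
  unfold ratioLip; positivity

lemma moment_nonneg : 0 ≤ C / (1 - ρ ^ p) :=
  div_nonneg h.upper_nonneg (by linarith [h.rate_pow_lt_one])

lemma abs_ratio_le {u : ℝ} (hu : u ∈ Set.Icc (0 : ℝ) 1) {z : Fin p → ℝ} (hz : ∀ j, 0 ≤ z j) :
    |ratio (c u) (d u) z| ≤ D / κ := TvARCH.abs_ratio_le h.pos (h.lower u hu) (h.dir u hu) hz

lemma ratio_sq_le {u : ℝ} (hu : u ∈ Set.Icc (0 : ℝ) 1) {z : Fin p → ℝ} (hz : ∀ j, 0 ≤ z j) :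
    ratio (c u) (d u) z ^ 2 ≤ (D / κ) ^ 2 := by
  rw [← sq_abs]; exact pow_le_pow_left₀ (abs_nonneg _) (h.abs_ratio_le hu hz) 2

lemma abs_ratio_sq_le {u : ℝ} (hu : u ∈ Set.Icc (0 : ℝ) 1) {z : Fin p → ℝ} (hz : ∀ j, 0 ≤ z j) :
    |ratio (c u) (d u) z ^ 2| ≤ (D / κ) ^ 2 := by
  rw [abs_of_nonneg (sq_nonneg _)]; exact h.ratio_sq_le hu hz

lemma abs_ratio_sq_sub_le {u : ℝ} (hu : u ∈ Set.Icc (0 : ℝ) 1) {z z' : Fin p → ℝ}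
    (hz : ∀ j, 0 ≤ z j) (hz' : ∀ j, 0 ≤ z' j) :
    |ratio (c u) (d u) z ^ 2 - ratio (c u) (d u) z' ^ 2|
      ≤ ratioLip κ C D * ∑ j, |z j - z' j| := by
  refine (abs_sq_sub_sq_le (h.abs_ratio_le hu hz) (h.abs_ratio_le hu hz')).trans ?_
  rw [ratioLip, mul_assoc (2 * (D / κ))]
  refine mul_le_mul_of_nonneg_left (abs_ratio_sub_ratio_le h.pos (h.lower u hu) (h.upper u hu)
    (h.dir u hu) hz hz') ?_
  have := h.pos; have := h.dir_nonneg
  positivity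

omit [IsProbabilityMeasure P] in
lemma integral_abs_ratio_sq_sub_le {Z Z' : ℤ → Ω → ℝ} (hZ : ∀ t, Measurable (Z t))
    (hZ' : ∀ t, Measurable (Z' t)) (hn : ∀ t ω, 0 ≤ Z t ω) (hn' : ∀ t ω, 0 ≤ Z' t ω)
    {u : ℝ} (hu : u ∈ Set.Icc (0 : ℝ) 1) {t : ℤ} {B : ℝ} (hB : 0 ≤ B)
    (hb : ∀ j : Fin p, ∫⁻ ω, ENNReal.ofReal |Z (t - 1 - j) ω - Z' (t - 1 - j) ω| ∂P
      ≤ ENNReal.ofReal B) :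
    ∫ ω, |ratio (c u) (d u) (pastZ p Z t ω) ^ 2 - ratio (c u) (d u) (pastZ p Z' t ω) ^ 2| ∂P
      ≤ ratioLip κ C D * (p * B) :=
  integral_abs_le_of_lintegral_le h.ratioLip_nonneg hB
    (fun ω => h.abs_ratio_sq_sub_le hu (fun _ => hn _ ω) (fun _ => hn' _ ω))
    (fun j => (hZ (t - 1 - j)).sub (hZ' (t - 1 - j))) hb

end RegularCoeffs

variable (hξ : IsGaussianNoise P ξ)

include hξ

lemma lintegral_freshARCH_le {u : ℝ} (hu : u ∈ Set.Icc (0 : ℝ) 1) (s₀ t : ℤ) :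
    ∫⁻ ω, ENNReal.ofReal (freshARCH ξ (c u) s₀ t ω) ∂P ≤ ENNReal.ofReal (C / (1 - ρ ^ p)) := by
  by_cases ht : s₀ - p < t
  · have := (isSqARCH_freshARCH (P := P) (ξ := ξ) (s₀ := s₀) (h.coeff_nonneg hu) t).setLIntegral_le
      hξ h.rate_nonneg h.rate_lt_one.le h.rate_pow_lt_one le_rfl (fun _ _ _ => h.coeff_nonneg hu)
      (fun _ _ _ => h.sum_le u hu) h.upper_nonneg (fun _ _ _ => h.upper u hu 0)
      (B := Set.univ) MeasurableSet.univ (fun s _ hs => by simp [freshARCH_of_le hs]) t ht le_rfl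
    simpa using this
  · simp [freshARCH_of_le (show t ≤ s₀ by omega)]

section stationary

variable (hS : ∀ u ∈ Set.Icc (0 : ℝ) 1, ∀ s₀ s₁, IsSqARCH P ξ (fun _ => c u) s₀ s₁ (S u))
  (hstat : ∀ u ∈ Set.Icc (0 : ℝ) 1, ∀ k : ℤ,
    P.map (fun ω t => S u (t + k) ω) = P.map (fun ω t => S u t ω))

include hS hstat

lemma lintegral_stationary_le {u : ℝ} (hu : u ∈ Set.Icc (0 : ℝ) 1) (t : ℤ) :
    ∫⁻ ω, ENNReal.ofReal (S u t ω) ∂P ≤ ENNReal.ofReal (C / (1 - ρ ^ p)) := by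
  refine IsSqARCH.lintegral_le_of_stationary hξ (hS u hu 0) (fun s => ?_) h.rate_nonneg
    h.rate_lt_one h.rate_pow_lt_one (fun _ => h.coeff_nonneg hu) (fun _ => h.sum_le u hu)
    h.upper_nonneg (fun _ => h.upper u hu 0) t
  have hm : ∀ t, Measurable (S u t) := (hS u hu 0 0).measurable hξ
  have := congrArg (Measure.map fun y : ℤ → ℝ => y 0) (hstat u hu s)
  rw [Measure.map_map (measurable_pi_apply 0) (measurable_pi_lambda _ fun t => hm _),
    Measure.map_map (measurable_pi_apply 0) (measurable_pi_lambda _ fun t => hm _)] at this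
  simpa [Function.comp_def] using this

omit [IsProbabilityMeasure P] h in
lemma integral_ratio_sq_eq_meanSq {u : ℝ} (hu : u ∈ Set.Icc (0 : ℝ) 1) (t : ℤ) :
    ∫ ω, ratio (c u) (d u) (pastZ p (S u) t ω) ^ 2 ∂P = meanSq P c d S u := by
  have hm : ∀ t, Measurable (S u t) := (hS u hu 0 0).measurable hξ
  have hf : Measurable fun y : ℤ → ℝ => ratio (c u) (d u) (fun j : Fin p => y (1 - 1 - j)) ^ 2 :=
    ((measurable_ratio _ _).comp (measurable_pi_lambda _ fun j => measurable_pi_apply _)).pow_const 2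
  have hm1 : Measurable fun ω (s : ℤ) => S u (s + (t - 1)) ω := measurable_pi_lambda _ fun _ => hm _
  have hm2 : Measurable fun ω (s : ℤ) => S u s ω := measurable_pi_lambda _ fun _ => hm _
  have e1 := integral_map (μ := P) hm1.aemeasurable hf.aestronglyMeasurable
  have e2 := integral_map (μ := P) hm2.aemeasurable hf.aestronglyMeasurable
  rw [hstat u hu (t - 1), e2] at e1
  have key : ∀ ω, pastZ p (S u) t ω = fun j : Fin p => S u (1 - 1 - (j : ℤ) + (t - 1)) ω := fun ω => by
    funext j
    have : t - 1 - (j : ℤ) = 1 - 1 - (j : ℤ) + (t - 1) := by ring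
    rw [← this]
    rfl
  simp_rw [key]
  exact e1.symm

lemma lintegral_abs_fresh_sub_stationary_le {u : ℝ} (hu : u ∈ Set.Icc (0 : ℝ) 1) {s₀ t : ℤ}
    (ht : s₀ - p < t) :
    ∫⁻ ω, ENNReal.ofReal |freshARCH ξ (c u) s₀ t ω - S u t ω| ∂P
      ≤ ENNReal.ofReal (C / (1 - ρ ^ p) * ρ ^ (t - s₀).toNat) := by
  have := (isSqARCH_freshARCH (P := P) (ξ := ξ) (s₀ := s₀)
    (h.coeff_nonneg hu) t).lintegral_abs_sub_le hξ (hS u hu s₀ t) h.rate_nonneg h.rate_lt_one.le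
    h.rate_pow_lt_one h.moment_nonneg (η := 0) le_rfl h.moment_nonneg
    (fun _ _ _ => h.coeff_nonneg hu) (fun _ _ _ => h.sum_le u hu) (fun _ _ _ _ => by simp)
    (fun s _ _ => lintegral_stationary_le h hξ hS hstat hu s)
    (fun s _ hs => by
      simp only [freshARCH_of_le hs, zero_sub, abs_neg, abs_of_nonneg ((hS u hu 0 0).nonneg _ _)]
      exact lintegral_stationary_le h hξ hS hstat hu s) t ht le_rfl
  simpa using this

/-- The stationary processes at nearby rescaled times are close: both are started in the remote past,
so that in the coupling only the difference of the coefficients remains. -/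
lemma lintegral_abs_stationary_sub_le {u v : ℝ} (hu : u ∈ Set.Icc (0 : ℝ) 1)
    (hv : v ∈ Set.Icc (0 : ℝ) 1) (t : ℤ) :
    ∫⁻ ω, ENNReal.ofReal |S u t ω - S v t ω| ∂P
      ≤ ENNReal.ofReal (L * |u - v| * (1 + p * (C / (1 - ρ ^ p))) / (1 - ρ ^ p)) := by
  set b := C / (1 - ρ ^ p)
  have hb : 0 ≤ b := h.moment_nonneg
  have hlim : Tendsto (fun K : ℕ => ENNReal.ofReal ((b + b) * ρ ^ K
      + L * |u - v| * (1 + p * b) / (1 - ρ ^ p))) atTop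
      (𝓝 (ENNReal.ofReal ((b + b) * 0 + L * |u - v| * (1 + p * b) / (1 - ρ ^ p)))) :=
    ENNReal.tendsto_ofReal (((tendsto_pow_atTop_nhds_zero_of_lt_one h.rate_nonneg
      h.rate_lt_one).const_mul _).add_const _)
  rw [mul_zero, zero_add] at hlim
  refine ge_of_tendsto hlim ?_
  filter_upwards [eventually_ge_atTop 1] with K hK
  have hmu : ∀ t, Measurable (S u t) := (hS u hu 0 0).measurable hξ
  have := (hS u hu (t - K) t).lintegral_abs_sub_le hξ (hS v hv (t - K) t) h.rate_nonneg
    h.rate_lt_one.le h.rate_pow_lt_one (add_nonneg hb hb) (η := L * |u - v|)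
    (mul_nonneg h.lip_nonneg (abs_nonneg _)) hb
    (fun _ _ _ => h.coeff_nonneg hu) (fun _ _ _ => h.sum_le u hu)
    (fun _ _ _ k => h.lip u hu v hv k)
    (fun s _ _ => lintegral_stationary_le h hξ hS hstat hv s)
    (fun s _ hs => by
      calc _ ≤ ∫⁻ ω, (ENNReal.ofReal (S u s ω) + ENNReal.ofReal (S v s ω)) ∂P := by
            refine lintegral_mono fun ω => ?_
            have h1 := (hS u hu 0 0).nonneg s ω
            have h2 := (hS v hv 0 0).nonneg s ω
            rw [← ENNReal.ofReal_add h1 h2]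
            exact ENNReal.ofReal_le_ofReal (abs_le.2 ⟨by linarith, by linarith⟩)
        _ = ∫⁻ ω, ENNReal.ofReal (S u s ω) ∂P + ∫⁻ ω, ENNReal.ofReal (S v s ω) ∂P :=
            lintegral_add_left (hmu s).ennreal_ofReal _
        _ ≤ ENNReal.ofReal b + ENNReal.ofReal b :=
            add_le_add (lintegral_stationary_le h hξ hS hstat hu s)
              (lintegral_stationary_le h hξ hS hstat hv s)
        _ = _ := (ENNReal.ofReal_add hb hb).symm) t (by omega) le_rfl
  simpa using this

/-- The limiting information depends on the rescaled time in a Lipschitz way. -/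
lemma exists_abs_meanSq_sub_le : ∃ Λ : ℝ, ∀ u ∈ Set.Icc (0 : ℝ) 1, ∀ v ∈ Set.Icc (0 : ℝ) 1,
    |meanSq P c d S u - meanSq P c d S v| ≤ Λ * |u - v| := by
  set b := C / (1 - ρ ^ p) with hbdef
  have hb : 0 ≤ b := h.moment_nonneg
  have h1ρ : 0 < 1 - ρ ^ p := by linarith [h.rate_pow_lt_one]
  have hκ := h.pos
  have hD := h.dir_nonneg
  have hL := h.lip_nonneg
  refine ⟨ratioLip κ C D * (p * (L * (1 + p * b) / (1 - ρ ^ p)))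
    + 2 * (D / κ) * ((1 + D / κ) / κ * L), fun u hu v hv => ?_⟩
  have hmS : ∀ u ∈ Set.Icc (0 : ℝ) 1, ∀ t, Measurable (S u t) := fun u hu =>
    (hS u hu 0 0).measurable hξ
  have hnS : ∀ u ∈ Set.Icc (0 : ℝ) 1, ∀ ω (j : Fin p), 0 ≤ pastZ p (S u) 1 ω j := fun u hu ω j =>
    (hS u hu 0 0).nonneg _ ω
  have hmr : ∀ a ∈ Set.Icc (0 : ℝ) 1, ∀ a' ∈ Set.Icc (0 : ℝ) 1,
      Integrable (fun ω => ratio (c a) (d a) (pastZ p (S a') 1 ω) ^ 2) P := fun a ha a' ha' => by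
    refine integrable_of_abs_le ?_ fun ω => h.abs_ratio_sq_le ha (hnS a' ha' ω)
    exact ((measurable_ratio _ _).comp (measurable_lags fun j => hmS a' ha' _)).pow_const 2
  have e1 : |∫ ω, ratio (c u) (d u) (pastZ p (S u) 1 ω) ^ 2 ∂P
      - ∫ ω, ratio (c u) (d u) (pastZ p (S v) 1 ω) ^ 2 ∂P|
      ≤ ratioLip κ C D * (p * (L * |u - v| * (1 + p * b) / (1 - ρ ^ p))) := by
    rw [← integral_sub (hmr u hu u hu) (hmr u hu v hv)]
    refine abs_integral_le_integral_abs.trans ?_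
    exact h.integral_abs_ratio_sq_sub_le (hmS u hu) (hmS v hv) (hS u hu 0 0).nonneg
      (hS v hv 0 0).nonneg hu (by positivity)
      fun j => lintegral_abs_stationary_sub_le h hξ hS hstat hu hv _
  have e2 : |∫ ω, ratio (c u) (d u) (pastZ p (S v) 1 ω) ^ 2 ∂P
      - ∫ ω, ratio (c v) (d v) (pastZ p (S v) 1 ω) ^ 2 ∂P|
      ≤ 2 * (D / κ) * ((1 + D / κ) / κ * (L * |u - v|)) := by
    rw [← integral_sub (hmr u hu v hv) (hmr v hv v hv), ← Real.norm_eq_abs]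
    refine (norm_integral_le_of_norm_le_const (C := 2 * (D / κ) * ((1 + D / κ) / κ * (L * |u - v|)))
      (Eventually.of_forall fun ω => ?_)).trans (by simp)
    rw [Real.norm_eq_abs]
    refine (abs_sq_sub_sq_le (h.abs_ratio_le hu (hnS v hv ω))
      (h.abs_ratio_le hv (hnS v hv ω))).trans ?_
    refine mul_le_mul_of_nonneg_left ?_ (by positivity)
    exact abs_ratio_sub_ratio_coeff_le h.pos (h.lower v hv) (h.lower u hu) (h.dir v hv)
      (h.lip u hu v hv) (h.dir_lip u hu v hv) (hnS v hv ω)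
  calc _ ≤ _ := abs_sub_le _ (∫ ω, ratio (c u) (d u) (pastZ p (S v) 1 ω) ^ 2 ∂P) _
    _ ≤ _ := add_le_add e1 e2
    _ = _ := by ring

omit hξ hstat in
lemma meanSq_le {u : ℝ} (hu : u ∈ Set.Icc (0 : ℝ) 1) :
    |meanSq P c d S u| ≤ (D / κ) ^ 2 := by
  rw [meanSq, ← Real.norm_eq_abs]
  refine (norm_integral_le_of_norm_le_const (C := (D / κ) ^ 2)
    (Eventually.of_forall fun ω => ?_)).trans (by simp)
  exact h.abs_ratio_sq_le hu fun j => (hS u hu 0 0).nonneg _ ω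

end stationary

/-- The tv-ARCH process is close to the process with the coefficients frozen at `t / T` that is
restarted at time `s₀`. -/
lemma lintegral_abs_sub_fresh_le {T : ℕ} {Z : ℤ → Ω → ℝ} {A : ℝ} (hA : 0 ≤ A)
    (hZ : IsSqARCH P ξ (fun t => c ((t : ℝ) / T)) p T Z) (hZ0 : ∀ t ≤ (p : ℤ), ∀ ω, Z t ω ≤ A)
    {s₀ t : ℤ} (hs₀ : (p : ℤ) ≤ s₀) (hst : s₀ < t) (htT : t ≤ T) {s : ℤ} (hs : s₀ - p < s)
    (hs1 : s ≤ t) :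
    ∫⁻ ω, ENNReal.ofReal |Z s ω - freshARCH ξ (c ((t : ℝ) / T)) s₀ s ω| ∂P
      ≤ ENNReal.ofReal ((A + C / (1 - ρ ^ p)) * ρ ^ (s - s₀).toNat
        + L * ((t - s₀) / T) * (1 + p * (C / (1 - ρ ^ p))) / (1 - ρ ^ p)) := by
  set b := C / (1 - ρ ^ p) with hbdef
  have hb : 0 ≤ b := h.moment_nonneg
  have hT : (0 : ℝ) < T := by
    have : (0 : ℤ) < T := by omega
    exact_mod_cast this
  have hmem : ∀ r : ℤ, 0 ≤ r → r ≤ T → (r : ℝ) / T ∈ Set.Icc (0 : ℝ) 1 := fun r h0 h1 =>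
    ⟨div_nonneg (by exact_mod_cast h0) hT.le, (div_le_one hT).2 (by exact_mod_cast h1)⟩
  have hu := hmem t (by omega) htT
  have hZm : ∀ r ≤ (T : ℤ), ∫⁻ ω, ENNReal.ofReal (Z r ω) ∂P ≤ ENNReal.ofReal (A + b) := by
    have hinit : ∀ r ≤ (p : ℤ), ∫⁻ ω, ENNReal.ofReal (Z r ω) ∂P ≤ ENNReal.ofReal A := fun r hr =>
      (lintegral_mono fun ω => ENNReal.ofReal_le_ofReal (hZ0 r hr ω)).trans (by simp)
    intro r hr
    by_cases hrp : r ≤ p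
    · exact (hinit r hrp).trans (ENNReal.ofReal_le_ofReal (by linarith))
    · have := hZ.setLIntegral_le hξ h.rate_nonneg h.rate_lt_one.le h.rate_pow_lt_one hA
        (fun k hk hk' => h.coeff_nonneg (hmem k (by omega) hk'))
        (fun k hk hk' => h.sum_le _ (hmem k (by omega) hk')) h.upper_nonneg
        (fun k hk hk' => h.upper _ (hmem k (by omega) hk') 0)
        (B := Set.univ) MeasurableSet.univ
        (fun k _ hk => by simpa using hinit k hk) r (by omega) hr
      rw [Measure.restrict_univ] at this
      refine this.trans (ENNReal.ofReal_le_ofReal ?_)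
      have := mul_le_of_le_one_right hA
        (pow_le_one₀ h.rate_nonneg h.rate_lt_one.le (n := (r - p).toNat))
      linarith
  refine (hZ.mono hs₀ htT).lintegral_abs_sub_le hξ
    (isSqARCH_freshARCH (h.coeff_nonneg hu) t) h.rate_nonneg h.rate_lt_one.le h.rate_pow_lt_one
    (add_nonneg hA hb) (η := L * ((t - s₀) / T)) ?_ hb
    (fun k hk hk' => h.coeff_nonneg (hmem k (by omega) (by omega)))
    (fun k hk hk' => h.sum_le _ (hmem k (by omega) (by omega)))
    (fun k hk hk' i => ?_) (fun k _ _ => lintegral_freshARCH_le h hξ hu s₀ k)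
    (fun k hk hk' => ?_) s hs hs1
  · have : (0 : ℝ) ≤ (t : ℝ) - s₀ := by
      rw [sub_nonneg]; exact_mod_cast hst.le
    have := h.lip_nonneg
    positivity
  · refine (h.lip _ (hmem k (by omega) (by omega)) _ hu i).trans ?_
    refine mul_le_mul_of_nonneg_left ?_ h.lip_nonneg
    rw [← sub_div, abs_div, abs_of_pos hT]
    gcongr
    have h1 : (s₀ : ℝ) ≤ k := by exact_mod_cast hk.le
    have h2 : (k : ℝ) ≤ t := by exact_mod_cast hk'
    rw [abs_of_nonpos (by linarith)]
    linarith
  · simp only [freshARCH_of_le hk', sub_zero, abs_of_nonneg (hZ.nonneg _ _)]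
    exact hZm k (by omega)

end lln

section lln

variable {Ω : Type*} [MeasurableSpace Ω] {P : Measure Ω} [IsProbabilityMeasure P]
  {ξ : ℤ → Ω → ℝ} {p : ℕ} {c d : ℝ → Fin (p + 1) → ℝ} {κ C D L ρ : ℝ} {S : ℝ → ℤ → Ω → ℝ}
  (h : RegularCoeffs c d κ C D L ρ) (hξ : IsGaussianNoise P ξ)

include h hξ

/-- The approximations of the squared ratios by functions of the last `p + K` noise variables
satisfy a weak law of large numbers, being `(p + K)`-dependent and bounded. -/
lemma integral_abs_average_fresh_le (K : ℕ) {T : ℕ} (hT : 0 < T) :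
    ∫ ω, |1 / T * ∑ t ∈ Finset.Icc (p + 1) T,
      (ratio (c ((t : ℝ) / T)) (d ((t : ℝ) / T))
          (pastZ p (freshARCH ξ (c ((t : ℝ) / T)) (t - p - K)) t ω) ^ 2
        - ∫ ω', ratio (c ((t : ℝ) / T)) (d ((t : ℝ) / T))
          (pastZ p (freshARCH ξ (c ((t : ℝ) / T)) (t - p - K)) t ω') ^ 2 ∂P)| ∂P
      ≤ (1 + (2 * (p + K : ℕ) + 1) * (2 * (D / κ) ^ 2) ^ 2) * (1 / √T) := by
  have hT' : (0 : ℝ) < T := by exact_mod_cast hT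
  set W := (D / κ) ^ 2 with hW
  let H : ℕ → Ω → ℝ := fun t ω => ratio (c ((t : ℝ) / T)) (d ((t : ℝ) / T))
    (pastZ p (freshARCH ξ (c ((t : ℝ) / T)) (t - p - K)) t ω) ^ 2
  let G : ℕ → Ω → ℝ := fun t ω => H t ω - ∫ ω', H t ω' ∂P
  change ∫ ω, |1 / T * ∑ t ∈ Finset.Icc (p + 1) T, G t ω| ∂P ≤ _
  have hmem : ∀ t ∈ Finset.Icc (p + 1) T, (t : ℝ) / T ∈ Set.Icc (0 : ℝ) 1 := fun t ht =>
    ⟨by positivity, (div_le_one hT').2 (by exact_mod_cast (Finset.mem_Icc.1 ht).2)⟩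
  have hHm : ∀ t : ℕ, Measurable[noiseSigma ξ (Set.Ioc ((t : ℤ) - p - K) t)] (H t) := fun t => by
    refine ((measurable_ratio _ _).comp (measurable_lags fun j => ?_)).pow_const 2
    refine (measurable_freshARCH _).mono (noiseSigma_mono ξ ?_) le_rfl
    exact Set.Ioc_subset_Ioc_right (by omega)
  have hGm : ∀ t : ℕ, Measurable[noiseSigma ξ (Set.Ioc ((t : ℤ) - p - K) t)] (G t) := fun t =>
    (hHm t).sub measurable_const
  have hHm' : ∀ t, Measurable (H t) := fun t => (hHm t).mono (noiseSigma_le hξ _) le_rfl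
  have hGm' : ∀ t, Measurable (G t) := fun t => (hGm t).mono (noiseSigma_le hξ _) le_rfl
  have hHb : ∀ t ∈ Finset.Icc (p + 1) T, ∀ ω, |H t ω| ≤ W := fun t ht ω =>
    h.abs_ratio_sq_le (hmem t ht) fun j => freshARCH_nonneg (h.coeff_nonneg (hmem t ht)) _ _
  have hGb : ∀ t ∈ Finset.Icc (p + 1) T, ∀ ω, |G t ω| ≤ 2 * W := fun t ht ω => by
    have h1 : |∫ ω', H t ω' ∂P| ≤ W := by
      rw [← Real.norm_eq_abs]
      exact (norm_integral_le_of_norm_le_const (Eventually.of_forall (hHb t ht))).trans (by simp)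
    have := abs_sub (H t ω) (∫ ω', H t ω' ∂P)
    have := hHb t ht ω
    change |H t ω - _| ≤ _
    linarith
  have hG0 : ∀ t ∈ Finset.Icc (p + 1) T, ∫ ω, G t ω ∂P = 0 := fun t ht => by
    change ∫ ω, (H t ω - ∫ ω', H t ω' ∂P) ∂P = 0
    rw [integral_sub (integrable_of_abs_le (hHm' t) (hHb t ht)) (integrable_const _)]
    simp
  have hGG : ∀ s ∈ Finset.Icc (p + 1) T, ∀ t ∈ Finset.Icc (p + 1) T, ∀ ω,
      |G s ω * G t ω| ≤ (2 * W) ^ 2 := fun s hs t ht ω => by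
    rw [abs_mul, sq]
    exact mul_le_mul (hGb s hs ω) (hGb t ht ω) (abs_nonneg _) ((abs_nonneg _).trans (hGb s hs ω))
  have hsq := integral_sq_sum_le (P := P) (I := Finset.Icc (p + 1) T) (f := G) (N := p + K)
    (B := (2 * W) ^ 2) (by positivity)
    (fun s hs t ht => integrable_of_abs_le ((hGm' s).mul (hGm' t)) (hGG s hs t ht))
    (fun s hs t ht => by
      refine (le_abs_self _).trans ?_
      rw [← Real.norm_eq_abs]
      exact (norm_integral_le_of_norm_le_const (Eventually.of_forall (hGG s hs t ht))).trans
        (by simp))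
    (fun s hs t ht hst => by
      have hdisj : Disjoint (Set.Ioc ((s : ℤ) - p - K) s) (Set.Ioc ((t : ℤ) - p - K) t) := by
        rw [Set.disjoint_left]
        intro a ha ha'
        have := ha.2
        have := ha'.1
        omega
      have hind : IndepFun (G s) (G t) P := by
        rw [IndepFun_iff_Indep]
        exact indep_of_indep_of_le_left (indep_of_indep_of_le_right (indep_noiseSigma hξ hdisj)
          (hGm t).comap_le) (hGm s).comap_le
      rw [hind.integral_fun_mul_eq_mul_integral (hGm' s).aestronglyMeasurable
        (hGm' t).aestronglyMeasurable, hG0 s hs, zero_mul])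
  refine integral_abs_le_of_integral_sq_le (by positivity) ?_ ?_
  · refine integrable_of_abs_le (W := (1 / T * ((Finset.Icc (p + 1) T).card • (2 * W))) ^ 2)
      (((Finset.measurable_sum _ fun t _ => hGm' t).const_mul _).pow_const 2) fun ω => ?_
    rw [abs_of_nonneg (sq_nonneg _), ← sq_abs, abs_mul, abs_of_pos (a := 1 / (T : ℝ)) (by positivity)]
    gcongr
    exact (Finset.abs_sum_le_sum_abs _ _).trans (Finset.sum_le_card_nsmul _ _ _ fun t ht => hGb t ht ω)
  · simp_rw [mul_pow]
    rw [integral_const_mul]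
    have hcard : ((Finset.Icc (p + 1) T).card : ℝ) ≤ T := by
      exact_mod_cast (by rw [Nat.card_Icc]; omega : (Finset.Icc (p + 1) T).card ≤ T)
    calc _ ≤ (1 / (T : ℝ)) ^ 2 * (T * ((2 * (p + K : ℕ) + 1) * (2 * W) ^ 2)) := by
          gcongr
          exact hsq.trans (mul_le_mul_of_nonneg_right hcard (by positivity))
      _ = _ := by
          rw [div_pow, div_pow, Real.sq_sqrt hT'.le]
          field_simp

omit h hξ in
/-- The limit `T → ∞` is taken for a fixed memory `K` of the approximation, before `K → ∞`. -/
lemma tendsto_zero_of_le_geom {err b : ℕ → ℝ} {a ρ : ℝ} (h0 : ∀ T, 0 ≤ err T) (hρ : 0 ≤ ρ)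
    (hρ1 : ρ < 1) (hb : ∀ K, ∀ᶠ T : ℕ in atTop, err T ≤ a * ρ ^ K + b K * (1 / √T)) :
    Tendsto err atTop (𝓝 0) := by
  have hsqrt : Tendsto (fun T : ℕ => 1 / √(T : ℝ)) atTop (𝓝 0) := by
    simp_rw [one_div]
    exact tendsto_inv_atTop_zero.comp (Real.tendsto_sqrt_atTop.comp tendsto_natCast_atTop_atTop)
  refine tendsto_order.2 ⟨fun ε hε => Eventually.of_forall fun T => hε.trans_le (h0 T),
    fun ε hε => ?_⟩
  have h1 : Tendsto (fun K : ℕ => a * ρ ^ K) atTop (𝓝 (a * 0)) :=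
    (tendsto_pow_atTop_nhds_zero_of_lt_one hρ hρ1).const_mul a
  rw [mul_zero] at h1
  obtain ⟨K, hK⟩ := (h1.eventually (gt_mem_nhds (half_pos hε))).exists
  have h2 : Tendsto (fun T : ℕ => b K * (1 / √(T : ℝ))) atTop (𝓝 (b K * 0)) := hsqrt.const_mul _
  rw [mul_zero] at h2
  filter_upwards [hb K, h2.eventually (gt_mem_nhds (half_pos hε))] with T hT hT'
  linarith

/-- The average of the squared ratios along the tv-ARCH process converges in `L¹` to the integral
over rescaled time of its stationary mean. -/
lemma tendsto_integral_abs_average_sub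
    (hS : ∀ u ∈ Set.Icc (0 : ℝ) 1, ∀ s₀ s₁, IsSqARCH P ξ (fun _ => c u) s₀ s₁ (S u))
    (hstat : ∀ u ∈ Set.Icc (0 : ℝ) 1, ∀ k : ℤ,
      P.map (fun ω t => S u (t + k) ω) = P.map (fun ω t => S u t ω))
    {Z : ℕ → ℤ → Ω → ℝ} {A : ℝ} (hA : 0 ≤ A)
    (hZ : ∀ T : ℕ, IsSqARCH P ξ (fun t => c ((t : ℝ) / T)) p T (Z T))
    (hZ0 : ∀ T : ℕ, ∀ t ≤ (p : ℤ), ∀ ω, Z T t ω ≤ A) :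
    Tendsto (fun T : ℕ => ∫ ω, |1 / T * ∑ t ∈ Finset.Icc (p + 1) T,
        ratio (c ((t : ℝ) / T)) (d ((t : ℝ) / T)) (pastZ p (Z T) t ω) ^ 2
      - ∫ u in (0 : ℝ)..1, meanSq P c d S u| ∂P) atTop (𝓝 0) := by
  obtain ⟨Λ, hΛ⟩ := exists_abs_meanSq_sub_le h hξ hS hstat
  have hΛ0 : 0 ≤ Λ := by simpa using (abs_nonneg _).trans (hΛ 0 (by simp) 1 (by simp))
  set b := C / (1 - ρ ^ p) with hb_def
  have hb : 0 ≤ b := h.moment_nonneg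
  have h1ρ : 0 < 1 - ρ ^ p := by linarith [h.rate_pow_lt_one]
  set W := (D / κ) ^ 2 with hW
  have hW0 : 0 ≤ W := sq_nonneg _
  set R := ratioLip κ C D with hR
  have hR0 : 0 ≤ R := h.ratioLip_nonneg
  have hρ0 := h.rate_nonneg
  have hL := h.lip_nonneg
  set q₀ := (1 + p * b) / (1 - ρ ^ p) with hq₀
  have hq0 : 0 ≤ q₀ := by positivity
  refine tendsto_zero_of_le_geom (a := R * (p * (A + b)) + R * (p * b)) (ρ := ρ)
    (b := fun K => R * (p * (L * (p + K) * q₀)) + (2 * p + K : ℕ) * (2 * W)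
      + (1 + (2 * (p + K : ℕ) + 1) * (2 * W) ^ 2) + (Λ + p * W))
    (fun T => integral_nonneg fun ω => abs_nonneg _) hρ0 h.rate_lt_one fun K => ?_
  filter_upwards [eventually_ge_atTop 1] with T hT
  have hT' : (0 : ℝ) < T := by exact_mod_cast hT
  have hTs : 1 / (T : ℝ) ≤ 1 / √T := by
    have hT1 : (1 : ℝ) ≤ T := by exact_mod_cast hT
    exact one_div_le_one_div_of_le (Real.sqrt_pos.2 hT')
      (Real.sqrt_le_iff.2 ⟨hT'.le, by nlinarith⟩)
  have hmem : ∀ t ∈ Finset.Icc (p + 1) T, (t : ℝ) / T ∈ Set.Icc (0 : ℝ) 1 := fun t ht =>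
    ⟨by positivity, (div_le_one hT').2 (by exact_mod_cast (Finset.mem_Icc.1 ht).2)⟩
  have hcardT : ((Finset.Icc (p + 1) T).card : ℝ) ≤ T := by
    exact_mod_cast (by rw [Nat.card_Icc]; omega : (Finset.Icc (p + 1) T).card ≤ T)
  let Y : ℕ → ℤ → Ω → ℝ := fun t => freshARCH ξ (c ((t : ℝ) / T)) (t - p - K)
  let F : ℕ → Ω → ℝ := fun t ω =>
    ratio (c ((t : ℝ) / T)) (d ((t : ℝ) / T)) (pastZ p (Z T) t ω) ^ 2
  let H : ℕ → Ω → ℝ := fun t ω =>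
    ratio (c ((t : ℝ) / T)) (d ((t : ℝ) / T)) (pastZ p (Y t) t ω) ^ 2
  let m : ℝ → ℝ := meanSq P c d S
  have hZm : ∀ t, Measurable (Z T t) := (hZ T).measurable hξ
  have hYm : ∀ t s, Measurable (Y t s) := fun t s =>
    (measurable_freshARCH s).mono (noiseSigma_le hξ _) le_rfl
  have hSm : ∀ u ∈ Set.Icc (0 : ℝ) 1, ∀ t, Measurable (S u t) := fun u hu =>
    (hS u hu 0 0).measurable hξ
  have hYn : ∀ t ∈ Finset.Icc (p + 1) T, ∀ s ω, 0 ≤ Y t s ω := fun t ht s ω =>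
    freshARCH_nonneg (h.coeff_nonneg (hmem t ht)) _ _
  have hFm : ∀ t, Measurable (F t) := fun t =>
    ((measurable_ratio _ _).comp (measurable_lags fun j => hZm _)).pow_const 2
  have hHm : ∀ t, Measurable (H t) := fun t =>
    ((measurable_ratio _ _).comp (measurable_lags fun j => hYm _ _)).pow_const 2
  have hFb : ∀ t ∈ Finset.Icc (p + 1) T, ∀ ω, |F t ω| ≤ W := fun t ht ω =>
    h.abs_ratio_sq_le (hmem t ht) fun j => (hZ T).nonneg _ ω
  have hHb : ∀ t ∈ Finset.Icc (p + 1) T, ∀ ω, |H t ω| ≤ W := fun t ht ω =>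
    h.abs_ratio_sq_le (hmem t ht) fun j => hYn t ht _ ω
  have hFi : ∀ t ∈ Finset.Icc (p + 1) T, Integrable (F t) P := fun t ht =>
    integrable_of_abs_le (hFm t) (hFb t ht)
  have hHi : ∀ t ∈ Finset.Icc (p + 1) T, Integrable (H t) P := fun t ht =>
    integrable_of_abs_le (hHm t) (hHb t ht)
  have hpow : ∀ {s t : ℤ} {j : Fin p}, s = t - p - K → ρ ^ (t - 1 - j - s).toNat ≤ ρ ^ K :=
    fun {s t j} hs => pow_le_pow_of_le_one hρ0 h.rate_lt_one.le (by omega)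
  -- the error of freezing the coefficients at `t / T` and restarting at time `t - p - K`, which for
  -- `t < 2 * p + K` may precede the start of the recursion
  have e1 : ∀ t ∈ Finset.Icc (p + 1) T, ∫ ω, |F t ω - H t ω| ∂P
      ≤ R * (p * ((A + b) * ρ ^ K + L * ((p + K) / T) * q₀))
        + if t < 2 * p + K then 2 * W else 0 := fun t ht => by
    have ht' := Finset.mem_Icc.1 ht
    have hpos : 0 ≤ R * (p * ((A + b) * ρ ^ K + L * ((p + K) / T) * q₀)) := by positivity
    split_ifs with htK
    · have : ∫ ω, |F t ω - H t ω| ∂P ≤ 2 * W := by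
        refine (le_abs_self _).trans ?_
        rw [← Real.norm_eq_abs]
        refine (norm_integral_le_of_norm_le_const (C := 2 * W)
          (Eventually.of_forall fun ω => ?_)).trans (by simp)
        rw [Real.norm_eq_abs, abs_abs]
        have := abs_sub (F t ω) (H t ω)
        linarith [hFb t ht ω, hHb t ht ω]
      linarith
    · rw [add_zero]
      refine h.integral_abs_ratio_sq_sub_le hZm (hYm t) (hZ T).nonneg (hYn t ht) (hmem t ht)
        (by positivity) fun j => ?_
      have hj := j.2
      refine (lintegral_abs_sub_fresh_le h hξ hA (hZ T) (hZ0 T) (s₀ := t - p - K) (t := t)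
        (by omega) (by omega) (by omega) (by omega) (by omega)).trans
        (ENNReal.ofReal_le_ofReal ?_)
      have e : (((t : ℕ) : ℤ) : ℝ) - (((t : ℤ) - p - K : ℤ) : ℝ) = p + K := by push_cast; ring
      rw [e, mul_div_assoc (L * _)]
      exact add_le_add (mul_le_mul_of_nonneg_left (hpow (t := t) (j := j) rfl) (by positivity)) le_rfl
  -- the bias of the approximation
  have e3 : ∀ t ∈ Finset.Icc (p + 1) T, |∫ ω, H t ω ∂P - m ((t : ℝ) / T)|
      ≤ R * (p * (b * ρ ^ K)) := fun t ht => by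
    have hu := hmem t ht
    have hSi : Integrable (fun ω => ratio (c ((t : ℝ) / T)) (d ((t : ℝ) / T))
        (pastZ p (S ((t : ℝ) / T)) t ω) ^ 2) P := by
      refine integrable_of_abs_le (W := W) (((measurable_ratio _ _).comp
        (measurable_lags fun j => hSm _ hu _)).pow_const 2) fun ω => ?_
      exact h.abs_ratio_sq_le hu fun j => (hS _ hu 0 0).nonneg _ ω
    change |_ - meanSq P c d S ((t : ℝ) / T)| ≤ _
    rw [← integral_ratio_sq_eq_meanSq (d := d) hξ hS hstat hu t, ← integral_sub (hHi t ht) hSi]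
    refine abs_integral_le_integral_abs.trans ?_
    refine h.integral_abs_ratio_sq_sub_le (hYm t) (hSm _ hu) (hYn t ht) (hS _ hu 0 0).nonneg hu
      (by positivity) fun j => ?_
    refine (lintegral_abs_fresh_sub_stationary_le h hξ hS hstat hu (by omega)).trans
      (ENNReal.ofReal_le_ofReal ?_)
    exact mul_le_mul_of_nonneg_left (hpow (t := t) (j := j) rfl) hb
  -- the fluctuation of the approximation
  have e2 := integral_abs_average_fresh_le (P := P) h hξ K hT
  -- the error of the Riemann sum
  have e4 : |1 / T * ∑ t ∈ Finset.Icc (p + 1) T, m ((t : ℝ) / T) - ∫ u in (0 : ℝ)..1, m u|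
      ≤ (Λ + p * W) * (1 / T) := by
    have h1 := abs_integral_sub_riemannSum_le hΛ hT
    have h2 : |∑ t ∈ Finset.Icc (p + 1) T, m ((t : ℝ) / T) - ∑ t ∈ Finset.Icc 1 T, m ((t : ℝ) / T)|
        ≤ p * W := by
      rw [abs_sub_comm, ← Finset.sum_sdiff_eq_sub (Finset.Icc_subset_Icc (by omega) le_rfl)]
      refine (Finset.abs_sum_le_sum_abs _ _).trans ((Finset.sum_le_card_nsmul _ _ W ?_).trans ?_)
      · intro t ht
        refine meanSq_le h hS ⟨by positivity, (div_le_one hT').2 ?_⟩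
        exact_mod_cast (Finset.mem_Icc.1 (Finset.mem_sdiff.1 ht).1).2
      · rw [nsmul_eq_mul]
        refine mul_le_mul_of_nonneg_right ?_ hW0
        have : (Finset.Icc 1 T \ Finset.Icc (p + 1) T).card ≤ p := by
          refine (Finset.card_le_card (t := Finset.Icc 1 p) fun t ht => ?_).trans (by simp)
          simp only [Finset.mem_sdiff, Finset.mem_Icc] at ht ⊢
          omega
        exact_mod_cast this
    have h3 : |1 / T * ∑ t ∈ Finset.Icc (p + 1) T, m ((t : ℝ) / T)
        - 1 / T * ∑ t ∈ Finset.Icc 1 T, m ((t : ℝ) / T)| ≤ p * W * (1 / T) := by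
      rw [← mul_sub, abs_mul, abs_of_pos (a := 1 / (T : ℝ)) (by positivity), mul_comm]
      gcongr
    refine (abs_sub_le _ (1 / T * ∑ t ∈ Finset.Icc 1 T, m ((t : ℝ) / T)) _).trans ?_
    linarith
  set G : Ω → ℝ := fun ω => 1 / T * ∑ t ∈ Finset.Icc (p + 1) T, (H t ω - ∫ ω', H t ω' ∂P) with hG
  change ∫ ω, |G ω| ∂P ≤ _ at e2
  have hGi : Integrable (fun ω => |G ω|) P := by
    refine Integrable.abs (Integrable.const_mul (integrable_finsetSum _ fun t ht => ?_) _)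
    exact (hHi t ht).sub (integrable_const _)
  have hDi : ∀ t ∈ Finset.Icc (p + 1) T, Integrable (fun ω => |F t ω - H t ω|) P := fun t ht =>
    ((hFi t ht).sub (hHi t ht)).abs
  have hpt : ∀ ω, |1 / T * ∑ t ∈ Finset.Icc (p + 1) T, F t ω - ∫ u in (0 : ℝ)..1, m u|
      ≤ 1 / T * ∑ t ∈ Finset.Icc (p + 1) T, |F t ω - H t ω| + |G ω|
        + (R * (p * (b * ρ ^ K)) + (Λ + p * W) * (1 / T)) := fun ω => by
    have hdec : 1 / T * ∑ t ∈ Finset.Icc (p + 1) T, F t ω - ∫ u in (0 : ℝ)..1, m u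
        = 1 / T * ∑ t ∈ Finset.Icc (p + 1) T, (F t ω - H t ω) + G ω
          + (1 / T * ∑ t ∈ Finset.Icc (p + 1) T, (∫ ω', H t ω' ∂P - m ((t : ℝ) / T))
          + (1 / T * ∑ t ∈ Finset.Icc (p + 1) T, m ((t : ℝ) / T) - ∫ u in (0 : ℝ)..1, m u)) := by
      simp only [hG, Finset.sum_sub_distrib]
      ring
    have hbias : |1 / T * ∑ t ∈ Finset.Icc (p + 1) T, (∫ ω', H t ω' ∂P - m ((t : ℝ) / T))|
        ≤ R * (p * (b * ρ ^ K)) := by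
      rw [abs_mul, abs_of_pos (a := 1 / (T : ℝ)) (by positivity)]
      calc _ ≤ 1 / (T : ℝ) * (T * (R * (p * (b * ρ ^ K)))) := by
            gcongr
            refine (Finset.abs_sum_le_sum_abs _ _).trans
              ((Finset.sum_le_card_nsmul _ _ _ e3).trans ?_)
            rw [nsmul_eq_mul]
            exact mul_le_mul_of_nonneg_right hcardT (by positivity)
        _ = _ := by field_simp
    have hfirst : |1 / T * ∑ t ∈ Finset.Icc (p + 1) T, (F t ω - H t ω)|
        ≤ 1 / T * ∑ t ∈ Finset.Icc (p + 1) T, |F t ω - H t ω| := by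
      rw [abs_mul, abs_of_pos (a := 1 / (T : ℝ)) (by positivity)]
      gcongr
      exact Finset.abs_sum_le_sum_abs _ _
    rw [hdec]
    refine (abs_add_le _ _).trans (add_le_add ((abs_add_le _ _).trans (add_le_add hfirst le_rfl))
      ((abs_add_le _ _).trans (add_le_add hbias e4)))
  have hcount : ∑ t ∈ Finset.Icc (p + 1) T, (if t < 2 * p + K then 2 * W else 0)
      ≤ (2 * p + K : ℕ) * (2 * W) := by
    rw [← Finset.sum_filter, Finset.sum_const, nsmul_eq_mul]
    refine mul_le_mul_of_nonneg_right ?_ (by positivity)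
    have : ((Finset.Icc (p + 1) T).filter (· < 2 * p + K)).card ≤ 2 * p + K :=
      (Finset.card_le_card (t := Finset.range (2 * p + K)) fun t ht =>
        Finset.mem_range.2 (Finset.mem_filter.1 ht).2).trans (by simp)
    exact_mod_cast this
  have hint1 : Integrable (fun ω => 1 / T * ∑ t ∈ Finset.Icc (p + 1) T, |F t ω - H t ω|) P :=
    (integrable_finsetSum _ hDi).const_mul _
  calc ∫ ω, |1 / T * ∑ t ∈ Finset.Icc (p + 1) T, F t ω - ∫ u in (0 : ℝ)..1, m u| ∂P
      ≤ ∫ ω, (1 / T * ∑ t ∈ Finset.Icc (p + 1) T, |F t ω - H t ω| + |G ω|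
        + (R * (p * (b * ρ ^ K)) + (Λ + p * W) * (1 / T))) ∂P :=
        integral_mono_of_nonneg (Eventually.of_forall fun ω => abs_nonneg _)
          ((hint1.add hGi).add (integrable_const _)) (Eventually.of_forall hpt)
    _ = 1 / T * ∑ t ∈ Finset.Icc (p + 1) T, ∫ ω, |F t ω - H t ω| ∂P + ∫ ω, |G ω| ∂P
        + (R * (p * (b * ρ ^ K)) + (Λ + p * W) * (1 / T)) := by
        have h2 : Integrable (fun ω => 1 / T * ∑ t ∈ Finset.Icc (p + 1) T, |F t ω - H t ω|
          + |G ω|) P := hint1.add hGi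
        rw [integral_add h2 (integrable_const _), integral_add hint1 hGi, integral_const_mul,
          integral_finsetSum _ hDi]
        simp
    _ ≤ 1 / T * (T * (R * (p * ((A + b) * ρ ^ K + L * ((p + K) / T) * q₀)))
          + (2 * p + K : ℕ) * (2 * W))
        + (1 + (2 * (p + K : ℕ) + 1) * (2 * W) ^ 2) * (1 / √T)
        + (R * (p * (b * ρ ^ K)) + (Λ + p * W) * (1 / T)) := by
        gcongr
        refine (Finset.sum_le_sum e1).trans ?_
        rw [Finset.sum_add_distrib, Finset.sum_const, nsmul_eq_mul]
        refine add_le_add (mul_le_mul_of_nonneg_right hcardT (by positivity)) hcount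
    _ = (R * (p * (A + b)) + R * (p * b)) * ρ ^ K
        + (R * (p * (L * (p + K) * q₀)) + (2 * p + K : ℕ) * (2 * W) + (Λ + p * W)) * (1 / T)
        + (1 + (2 * (p + K : ℕ) + 1) * (2 * W) ^ 2) * (1 / √T) := by
        field_simp
        ring
    _ ≤ (R * (p * (A + b)) + R * (p * b)) * ρ ^ K
        + (R * (p * (L * (p + K) * q₀)) + (2 * p + K : ℕ) * (2 * W) + (Λ + p * W)) * (1 / √T)
        + (1 + (2 * (p + K : ℕ) + 1) * (2 * W) ^ 2) * (1 / √T) := by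
        gcongr
    _ = _ := by ring

end lln

/-! ### The centred squared noise -/

/-- The fourth moment of the standard Gaussian law, read off from the derivatives of `exp (t² / 2)`:
these are polynomials times `exp (t² / 2)`. -/
lemma integral_pow_four_gaussianReal : ∫ z, z ^ 4 ∂gaussianReal 0 1 = 3 := by
  have h1 := iteratedDeriv_mgf_zero (X := id) (μ := gaussianReal 0 1) (by simp) 4
  have hd : ∀ (a b e f : ℝ), deriv (fun t : ℝ => (a + b * t + e * t ^ 2 + f * t ^ 3)
      * Real.exp (t ^ 2 / 2)) = fun t => (b + (a + 2 * e) * t + (b + 3 * f) * t ^ 2 + e * t ^ 3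
        + f * t ^ 4) * Real.exp (t ^ 2 / 2) := fun a b e f => by
    funext t
    have h2 : HasDerivAt (fun t : ℝ => a + b * t + e * t ^ 2 + f * t ^ 3)
        (b + e * (2 * t) + f * (3 * t ^ 2)) t := by
      have := (((((hasDerivAt_id t).const_mul b).const_add a).add
        (((hasDerivAt_id t).pow 2).const_mul e)).add (((hasDerivAt_id t).pow 3).const_mul f))
      convert! this using 1
      simp
    have h3 : HasDerivAt (fun t : ℝ => Real.exp (t ^ 2 / 2)) (Real.exp (t ^ 2 / 2) * t) t := by
      have := (((hasDerivAt_id t).pow 2).div_const 2).exp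
      convert! this using 1
      simp
    rw [(h2.fun_mul h3).deriv]
    ring
  rw [mgf_id_gaussianReal, iteratedDeriv_succ, iteratedDeriv_succ, iteratedDeriv_succ,
    iteratedDeriv_one] at h1
  have e0 : (fun t : ℝ => Real.exp (0 * t + ((1 : ℝ≥0) : ℝ) * t ^ 2 / 2))
      = fun t => ((1 : ℝ) + 0 * t + 0 * t ^ 2 + 0 * t ^ 3) * Real.exp (t ^ 2 / 2) := by
    funext t; simp
  have e2 : ∀ (a b e f : ℝ), (fun t : ℝ => (a + b * t + e * t ^ 2 + f * t ^ 3 + 0 * t ^ 4)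
      * Real.exp (t ^ 2 / 2)) = fun t => (a + b * t + e * t ^ 2 + f * t ^ 3)
        * Real.exp (t ^ 2 / 2) := fun a b e f => by
    funext t; ring
  have e3 : (0 + 3 * 0 : ℝ) = 0 := by norm_num
  rw [e0, hd, e2, hd, e2, hd, e3, e2, hd] at h1
  norm_num at h1
  exact h1.symm

/-- The characteristic function of `ξ² - 1` for a standard Gaussian variable `ξ`. -/
def sqCharFun : ℝ → ℂ := charFun ((gaussianReal 0 1).map fun z => z ^ 2 - 1)

lemma integral_sq_sub_one_sq_gaussianReal : ∫ z, (z ^ 2 - 1) ^ 2 ∂gaussianReal 0 1 = 2 := by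
  have h4 := integrable_pow_gaussianReal 4
  have h2 := integrable_pow_gaussianReal 2
  have e : ∀ z : ℝ, (z ^ 2 - 1) ^ 2 = z ^ 4 - 2 * z ^ 2 + 1 := fun z => by ring
  simp_rw [e]
  have h42 : Integrable (fun z : ℝ => z ^ 4 - 2 * z ^ 2) (gaussianReal 0 1) :=
    h4.sub (h2.const_mul 2)
  rw [integral_add h42 (integrable_const _),
    integral_sub h4 (h2.const_mul 2), integral_const_mul, integral_pow_four_gaussianReal,
    integral_sq_gaussianReal]
  simp
  norm_num

/-- Second order expansion of the characteristic function of `ξ² - 1`, whose variance is `2`. -/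
lemma sqCharFun_isLittleO :
    (fun s : ℝ => sqCharFun s - (1 - (s : ℂ) ^ 2)) =o[𝓝 0] fun s : ℝ => s ^ 2 := by
  have h2 := integrable_pow_gaussianReal 2
  -- normalized to unit variance
  let X : ℝ → ℝ := fun z => (√2)⁻¹ * (z ^ 2 - 1)
  have hs : (√2 : ℝ) ≠ 0 := by positivity
  have h0 : ∫ z, X z ∂gaussianReal 0 1 = 0 := by
    simp only [X]
    rw [integral_const_mul, integral_sub h2 (integrable_const _), integral_sq_gaussianReal]
    simp
  have h1 : ∫ z, (X ^ 2) z ∂gaussianReal 0 1 = 1 := by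
    simp only [X, Pi.pow_apply, mul_pow]
    rw [integral_const_mul, integral_sq_sub_one_sq_gaussianReal, inv_pow, Real.sq_sqrt zero_le_two]
    norm_num
  have h := taylor_charFun_two (X := X) (P := gaussianReal 0 1) (by fun_prop) h0 h1
  have ht : Tendsto (fun s : ℝ => √2 * s) (𝓝 0) (𝓝 0) := by
    simpa using (continuous_const_mul (√2 : ℝ)).tendsto 0
  have h' := h.comp_tendsto ht
  have hmap : (gaussianReal 0 1).map X = ((gaussianReal 0 1).map fun z => z ^ 2 - 1).map
      ((√2)⁻¹ * ·) := by
    rw [Measure.map_map (by fun_prop) (by fun_prop)]; rfl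
  have e1 : ∀ s : ℝ, charFun ((gaussianReal 0 1).map X) (√2 * s) = sqCharFun s := fun s => by
    rw [hmap, charFun_map_mul, inv_mul_cancel_left₀ hs]; rfl
  have e2 : ∀ s : ℝ, (((√2 * s : ℝ) : ℂ)) ^ 2 / 2 = (s : ℂ) ^ 2 := fun s => by
    rw [← Complex.ofReal_pow, mul_pow, Real.sq_sqrt zero_le_two]
    push_cast; ring
  simp only [Function.comp_def, e1, e2] at h'
  refine h'.trans_isBigO (Asymptotics.IsBigO.of_bound 2 (Eventually.of_forall fun s => ?_))
  rw [mul_pow, Real.sq_sqrt zero_le_two, norm_mul]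
  simp

lemma abs_exp_mul_one_sub_sub_one_le {x : ℝ} (hx : 0 ≤ x) (hx1 : x ≤ 1) :
    |Real.exp x * (1 - x) - 1| ≤ x ^ 2 := by
  have h1 := Real.add_one_le_exp x
  have h2 := Real.one_sub_le_exp_neg x
  have h3 : Real.exp x * Real.exp (-x) = 1 := by rw [← Real.exp_add]; simp
  rw [abs_le]
  constructor
  · nlinarith
  · nlinarith [Real.exp_pos x, sq_nonneg x]

lemma exists_norm_sqCharFun_mul_exp_sub_one_le {ε : ℝ} (hε : 0 < ε) :
    ∃ δ > 0, ∀ s : ℝ, |s| ≤ δ →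
      ‖sqCharFun s * Real.exp (s ^ 2) - 1‖ ≤ ε * s ^ 2 * Real.exp 1 + s ^ 4 := by
  have h := sqCharFun_isLittleO.def hε
  obtain ⟨δ, hδ, hδ'⟩ := Metric.eventually_nhds_iff.1 h
  refine ⟨min (δ / 2) 1, by positivity, fun s hs => ?_⟩
  have hs1 : |s| ≤ 1 := hs.trans (min_le_right _ _)
  have hs2 : dist s 0 < δ := by
    rw [Real.dist_eq, sub_zero]
    exact (hs.trans (min_le_left _ _)).trans_lt (by linarith)
  have h1 := hδ' hs2
  rw [Real.norm_of_nonneg (sq_nonneg s)] at h1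
  have hsq : s ^ 2 ≤ 1 := by rw [← sq_abs]; exact pow_le_one₀ (abs_nonneg _) hs1
  have e : sqCharFun s * Real.exp (s ^ 2) - 1 = (sqCharFun s - (1 - (s : ℂ) ^ 2)) * Real.exp (s ^ 2)
      + ((Real.exp (s ^ 2) * (1 - s ^ 2) - 1 : ℝ) : ℂ) := by
    push_cast; ring
  rw [e]
  refine (norm_add_le _ _).trans (add_le_add ?_ ?_)
  · rw [norm_mul, Complex.norm_real, Real.norm_of_nonneg (Real.exp_pos _).le]
    gcongr
  · rw [Complex.norm_real, Real.norm_eq_abs]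
    refine (abs_exp_mul_one_sub_sub_one_le (sq_nonneg s) hsq).trans (le_of_eq (by ring))

section martingale

variable {Ω : Type*} [MeasurableSpace Ω] {P : Measure Ω} [IsProbabilityMeasure P]
  {ξ : ℤ → Ω → ℝ} (hξ : IsGaussianNoise P ξ)

include hξ

omit [IsProbabilityMeasure P] in
lemma integrable_noise_sq_sub_one_sq (t : ℤ) :
    Integrable (fun ω => (ξ t ω ^ 2 - 1) ^ 2) P ∧ ∫ ω, (ξ t ω ^ 2 - 1) ^ 2 ∂P = 2 := by
  have h : Integrable (fun z : ℝ => (z ^ 2 - 1) ^ 2) (P.map (ξ t)) := by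
    rw [hξ.law t]
    have e : ∀ z : ℝ, (z ^ 2 - 1) ^ 2 = z ^ 4 - 2 * z ^ 2 + 1 := fun z => by ring
    simp_rw [e]
    exact ((integrable_pow_gaussianReal 4).sub
      ((integrable_pow_gaussianReal 2).const_mul 2)).add (integrable_const _)
  refine ⟨h.comp_measurable (hξ.measurable t), ?_⟩
  have := integral_sq_sub_one_sq_gaussianReal
  rwa [← hξ.law t, integral_map (hξ.measurable t).aemeasurable (by fun_prop)] at this

omit [IsProbabilityMeasure P] in
lemma indepFun_noise {β : Type*} [MeasurableSpace β] {t : ℤ} {F : Ω → β}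
    (hF : Measurable[noiseSigma ξ (Set.Iio t)] F) : IndepFun F (ξ t) P := by
  rw [IndepFun_iff_Indep]
  refine indep_of_indep_of_le_left (indep_of_indep_of_le_right
    (indep_noiseSigma hξ (S := Set.Iio t) (S' := {t}) (by simp)) ?_) hF.comap_le
  exact (measurable_noise ξ (Set.mem_singleton t)).comap_le

/-- The conditional characteristic function of `D (ξ_t² - 1)` given the past, for predictable `D`. -/
lemma integral_mul_cexp_noise {t : ℤ} {A : Ω → ℂ} {D : Ω → ℝ} {B : ℝ}
    (hA : Measurable[noiseSigma ξ (Set.Iio t)] A) (hD : Measurable[noiseSigma ξ (Set.Iio t)] D)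
    (hB : ∀ ω, ‖A ω‖ ≤ B) :
    ∫ ω, A ω * Complex.exp (((D ω * (ξ t ω ^ 2 - 1) : ℝ) : ℂ) * Complex.I) ∂P
      = ∫ ω, A ω * sqCharFun (D ω) ∂P := by
  have hA' : Measurable A := hA.mono (noiseSigma_le hξ _) le_rfl
  have hD' : Measurable D := hD.mono (noiseSigma_le hξ _) le_rfl
  have hAD : Measurable fun ω => (A ω, D ω) := hA'.prodMk hD'
  have hind : IndepFun (fun ω => (A ω, D ω)) (ξ t) P := indepFun_noise hξ (hA.prodMk hD)
  have hprod := (indepFun_iff_map_prod_eq_prod_map_map hAD.aemeasurable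
    (hξ.measurable t).aemeasurable).1 hind
  let f : (ℂ × ℝ) × ℝ → ℂ := fun y =>
    y.1.1 * Complex.exp (((y.1.2 * (y.2 ^ 2 - 1) : ℝ) : ℂ) * Complex.I)
  have hf : Measurable f := by fun_prop
  have hmeas := hAD.prodMk (hξ.measurable t)
  have hint : Integrable f ((P.map fun ω => (A ω, D ω)).prod (P.map (ξ t))) := by
    rw [← hprod, integrable_map_measure hf.aestronglyMeasurable hmeas.aemeasurable]
    refine Integrable.of_bound (hf.comp hmeas).aestronglyMeasurable B
      (Eventually.of_forall fun ω => ?_)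
    simp only [f, Function.comp_apply]
    rw [norm_mul, Complex.norm_exp_ofReal_mul_I, mul_one]
    exact hB ω
  have : IsProbabilityMeasure (P.map fun ω => (A ω, D ω)) :=
    Measure.isProbabilityMeasure_map hAD.aemeasurable
  have : IsProbabilityMeasure (P.map (ξ t)) :=
    Measure.isProbabilityMeasure_map (hξ.measurable t).aemeasurable
  calc _ = ∫ y, f y ∂(P.map fun ω => ((A ω, D ω), ξ t ω)) := by
        rw [integral_map hmeas.aemeasurable hf.aestronglyMeasurable]
    _ = ∫ y, y.1 * sqCharFun y.2 ∂(P.map fun ω => (A ω, D ω)) := by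
        rw [hprod, integral_prod _ hint]
        refine integral_congr_ae (Eventually.of_forall fun y => ?_)
        simp only [f]
        rw [hξ.law t, integral_const_mul, sqCharFun, charFun_apply_real,
          integral_map (φ := fun z : ℝ => z ^ 2 - 1) (by fun_prop) (by fun_prop)]
        congr 1
        refine integral_congr_ae (Eventually.of_forall fun z => ?_)
        simp only []
        push_cast
        rfl
    _ = _ := by
        have hg : Measurable fun y : ℂ × ℝ => y.1 * sqCharFun y.2 :=
          measurable_fst.mul (measurable_charFun.comp measurable_snd)
        rw [integral_map hAD.aemeasurable hg.aestronglyMeasurable]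

/-- For predictable bounded `s_t`, the exponential of `i ∑ s_t (ξ_t² - 1) + ∑ s_t²` has expectation
close to `1`: it is an approximate martingale. -/
lemma norm_integral_cexp_sub_one_le {a : ℕ} {s : ℕ → Ω → ℝ} {σ r : ℝ}
    (hs : ∀ t : ℕ, Measurable[noiseSigma ξ (Set.Iio (t : ℤ))] (s t)) {n : ℕ} (hn : a ≤ n)
    (hσ : ∀ t ∈ Finset.Ico a n, ∀ ω, |s t ω| ≤ σ)
    (hr : ∀ x : ℝ, |x| ≤ σ → ‖sqCharFun x * Real.exp (x ^ 2) - 1‖ ≤ r) (hr0 : 0 ≤ r) :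
    ‖∫ ω, Complex.exp (((∑ t ∈ Finset.Ico a n, s t ω * (ξ t ω ^ 2 - 1) : ℝ) : ℂ) * Complex.I)
        * Real.exp (∑ t ∈ Finset.Ico a n, s t ω ^ 2) ∂P - 1‖
      ≤ (n - a : ℕ) * (Real.exp ((n - a : ℕ) * σ ^ 2) * r) := by
  induction n, hn using Nat.le_induction with
  | base => simp
  | succ n hn ih =>
    have hsub : Finset.Ico a n ⊆ Finset.Ico a (n + 1) := Finset.Ico_subset_Ico_right (by omega)
    have ih' := ih fun t ht => hσ t (hsub ht)
    let G : Ω → ℂ := fun ω =>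
      Complex.exp (((∑ t ∈ Finset.Ico a n, s t ω * (ξ t ω ^ 2 - 1) : ℝ) : ℂ) * Complex.I)
        * Real.exp (∑ t ∈ Finset.Ico a n, s t ω ^ 2)
    have hsn : ∀ ω, |s n ω| ≤ σ := hσ n (by simp [hn])
    have hmono : ∀ t ∈ Finset.Ico a n, Measurable[noiseSigma ξ (Set.Iio (n : ℤ))] (s t) :=
      fun t ht => (hs t).mono (noiseSigma_mono ξ (Set.Iio_subset_Iio
        (Int.ofNat_le.2 (Finset.mem_Ico.1 ht).2.le))) le_rfl
    have hG : Measurable[noiseSigma ξ (Set.Iio (n : ℤ))] G := by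
      have h1 : Measurable[noiseSigma ξ (Set.Iio (n : ℤ))] fun ω =>
          ∑ t ∈ Finset.Ico a n, s t ω * (ξ t ω ^ 2 - 1) :=
        Finset.measurable_sum _ fun t ht => (hmono t ht).mul
          (((measurable_noise ξ (by simpa using (Finset.mem_Ico.1 ht).2)).pow_const 2).sub_const 1)
      have h2 : Measurable[noiseSigma ξ (Set.Iio (n : ℤ))] fun ω =>
          ∑ t ∈ Finset.Ico a n, s t ω ^ 2 :=
        Finset.measurable_sum _ fun t ht => (hmono t ht).pow_const 2
      exact ((Complex.measurable_ofReal.comp h1).mul_const _).cexp.mul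
        (Complex.measurable_ofReal.comp h2.exp)
    have hGb : ∀ ω, ‖G ω‖ ≤ Real.exp ((n - a : ℕ) * σ ^ 2) := fun ω => by
      simp only [G]
      rw [norm_mul, Complex.norm_exp_ofReal_mul_I, one_mul, Complex.norm_real,
        Real.norm_of_nonneg (Real.exp_pos _).le, Real.exp_le_exp]
      refine (Finset.sum_le_card_nsmul _ _ (σ ^ 2) fun t ht => ?_).trans (by simp)
      rw [← sq_abs]
      exact pow_le_pow_left₀ (abs_nonneg _) (hσ t (hsub ht) ω) 2
    have hE : Measurable[noiseSigma ξ (Set.Iio (n : ℤ))] fun ω => (Real.exp (s n ω ^ 2) : ℂ) :=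
      Complex.measurable_ofReal.comp ((hs n).pow_const 2).exp
    have hEb : ∀ ω, ‖(Real.exp (s n ω ^ 2) : ℂ)‖ ≤ Real.exp (σ ^ 2) := fun ω => by
      rw [Complex.norm_real, Real.norm_of_nonneg (Real.exp_pos _).le, Real.exp_le_exp, ← sq_abs]
      exact pow_le_pow_left₀ (abs_nonneg _) (hsn ω) 2
    have hGE : Measurable[noiseSigma ξ (Set.Iio (n : ℤ))] fun ω =>
        G ω * (Real.exp (s n ω ^ 2) : ℂ) := hG.mul hE
    have hle := noiseSigma_le hξ (Set.Iio (n : ℤ))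
    have hGi : Integrable G P := Integrable.of_bound
      (hG.mono hle le_rfl).aestronglyMeasurable _ (Eventually.of_forall hGb)
    have hstep : ∫ ω, Complex.exp
        (((∑ t ∈ Finset.Ico a (n + 1), s t ω * (ξ t ω ^ 2 - 1) : ℝ) : ℂ) * Complex.I)
        * Real.exp (∑ t ∈ Finset.Ico a (n + 1), s t ω ^ 2) ∂P
        = ∫ ω, (G ω * Real.exp (s n ω ^ 2)) * sqCharFun (s n ω) ∂P := by
      rw [← integral_mul_cexp_noise hξ hGE (hs n)
        (B := Real.exp ((n - a : ℕ) * σ ^ 2) * Real.exp (σ ^ 2))]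
      · refine integral_congr_ae (Eventually.of_forall fun ω => ?_)
        simp only [G, Finset.sum_Ico_succ_top hn]
        rw [Real.exp_add]
        push_cast
        rw [add_mul, Complex.exp_add]
        ring
      · intro ω
        rw [norm_mul]
        exact mul_le_mul (hGb ω) (hEb ω) (norm_nonneg _) (Real.exp_pos _).le
    have hdiff : ‖∫ ω, (G ω * Real.exp (s n ω ^ 2)) * sqCharFun (s n ω) ∂P - ∫ ω, G ω ∂P‖
        ≤ Real.exp ((n - a : ℕ) * σ ^ 2) * r := by
      rw [← integral_sub _ hGi]
      · refine (norm_integral_le_of_norm_le_const (C := Real.exp ((n - a : ℕ) * σ ^ 2) * r)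
          (Eventually.of_forall fun ω => ?_)).trans (by simp)
        rw [show G ω * Real.exp (s n ω ^ 2) * sqCharFun (s n ω) - G ω
          = G ω * (sqCharFun (s n ω) * Real.exp (s n ω ^ 2) - 1) by ring, norm_mul]
        exact mul_le_mul (hGb ω) (hr _ (hsn ω)) (norm_nonneg _) (Real.exp_pos _).le
      · refine Integrable.of_bound ((hGE.mul
          (measurable_charFun.comp (hs n))).mono hle le_rfl).aestronglyMeasurable
          (Real.exp ((n - a : ℕ) * σ ^ 2) * Real.exp (σ ^ 2) * 1) (Eventually.of_forall fun ω => ?_)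
        rw [norm_mul, norm_mul]
        have : IsProbabilityMeasure ((gaussianReal 0 1).map fun z : ℝ => z ^ 2 - 1) :=
          Measure.isProbabilityMeasure_map (by fun_prop)
        exact mul_le_mul (mul_le_mul (hGb ω) (hEb ω) (norm_nonneg _) (Real.exp_pos _).le)
          (norm_charFun_le_one _) (norm_nonneg _) (by positivity)
    rw [hstep]
    have hsplit := norm_sub_le_norm_sub_add_norm_sub
      (∫ ω, (G ω * Real.exp (s n ω ^ 2)) * sqCharFun (s n ω) ∂P) (∫ ω, G ω ∂P) 1
    have e : ((n + 1 - a : ℕ) : ℝ) = (n - a : ℕ) + 1 := by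
      rw [Nat.succ_sub hn]; push_cast; ring
    have hexp : Real.exp ((n - a : ℕ) * σ ^ 2) ≤ Real.exp (((n - a : ℕ) + 1) * σ ^ 2) := by
      rw [Real.exp_le_exp]
      nlinarith [sq_nonneg σ]
    rw [e]
    calc _ ≤ Real.exp ((n - a : ℕ) * σ ^ 2) * r
          + (n - a : ℕ) * (Real.exp ((n - a : ℕ) * σ ^ 2) * r) :=
          hsplit.trans (add_le_add hdiff ih')
      _ = ((n - a : ℕ) + 1) * (Real.exp ((n - a : ℕ) * σ ^ 2) * r) := by ring
      _ ≤ _ := by gcongr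

end martingale

/-! ### Asymptotics of the score and of the log-likelihood ratio -/

/-- The contribution of one observation to the log-likelihood ratio, for squared noise `x` and
relative perturbation `y` of the conditional variance. -/
def llrTerm (x y : ℝ) : ℝ := -(1 / 2) * Real.log (1 + y) + x / 2 * (y / (1 + y))

/-- The second order expansion of `llrTerm`, with the quadratic term split into its conditional mean
`-y² / 4` and a centred part. -/
lemma abs_llrTerm_sub_le {x y : ℝ} (hx : 0 ≤ x) (hy : |y| ≤ 1 / 2) :
    |llrTerm x y - (1 / 2 * ((x - 1) * y) - 1 / 4 * y ^ 2 - 1 / 2 * ((x - 1) * y ^ 2))|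
      ≤ |y| ^ 3 * (1 + x) := by
  have hy' := abs_le.1 hy
  have hlog : |Real.log (1 + y) - (y - y ^ 2 / 2)| ≤ 2 * |y| ^ 3 := by
    have h1 := Real.abs_log_sub_add_sum_range_le (x := -y) (by rw [abs_neg]; linarith) 2
    simp only [Finset.sum_range_succ, Finset.sum_range_zero, abs_neg, sub_neg_eq_add] at h1
    norm_num at h1
    have e : -y + y ^ 2 / 2 + Real.log (1 + y) = Real.log (1 + y) - (y - y ^ 2 / 2) := by ring
    rw [e] at h1
    refine h1.trans ?_
    rw [div_le_iff₀ (by linarith)]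
    have : 0 ≤ |y| ^ 3 := by positivity
    nlinarith
  have hfrac : |y / (1 + y) - (y - y ^ 2)| ≤ 2 * |y| ^ 3 := by
    have hpos : 0 < 1 + y := by linarith
    have e : y / (1 + y) - (y - y ^ 2) = y ^ 3 / (1 + y) := by field_simp; ring
    rw [e, abs_div, abs_pow, abs_of_pos hpos, div_le_iff₀ hpos]
    have : 0 ≤ |y| ^ 3 := by positivity
    nlinarith
  have e : llrTerm x y - (1 / 2 * ((x - 1) * y) - 1 / 4 * y ^ 2 - 1 / 2 * ((x - 1) * y ^ 2))
      = -(1 / 2) * (Real.log (1 + y) - (y - y ^ 2 / 2))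
        + x / 2 * (y / (1 + y) - (y - y ^ 2)) := by
    unfold llrTerm; ring
  rw [e]
  refine (abs_add_le _ _).trans ?_
  rw [abs_mul, abs_mul, abs_of_nonneg (a := x / 2) (by positivity)]
  have h2 := mul_le_mul_of_nonneg_left hfrac (a := x / 2) (by positivity)
  norm_num
  linarith

section asymptotics

variable {Ω : Type*} [MeasurableSpace Ω] {P : Measure Ω} [IsProbabilityMeasure P]
  {ξ : ℤ → Ω → ℝ} (hξ : IsGaussianNoise P ξ) {p : ℕ} {w : ℕ → ℕ → Ω → ℝ} {W Q : ℝ}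
  (hw : ∀ T t : ℕ, Measurable[noiseSigma ξ (Set.Iio (t : ℤ))] (w T t))
  (hW : ∀ T : ℕ, ∀ t ∈ Finset.Icc (p + 1) T, ∀ ω, |w T t ω| ≤ W)

include hξ hw hW

/-- The exponential of `i v` times the score, compensated by its conditional variance, has expectation
tending to `1`. -/
lemma tendsto_norm_integral_cexp_sub_one (v : ℝ) :
    Tendsto (fun T : ℕ => ‖∫ ω, Complex.exp
        (((∑ t ∈ Finset.Ico (p + 1) (T + 1), v / (2 * √T) * w T t ω * (ξ t ω ^ 2 - 1) : ℝ) : ℂ)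
          * Complex.I)
        * Real.exp (∑ t ∈ Finset.Ico (p + 1) (T + 1), (v / (2 * √T) * w T t ω) ^ 2) ∂P - 1‖)
      atTop (𝓝 0) := by
  set B := v ^ 2 * W ^ 2 / 4 with hB
  have hB0 : 0 ≤ B := by positivity
  have hsqrt : Tendsto (fun T : ℕ => |v| * W / 2 * (√(T : ℝ))⁻¹) atTop (𝓝 (|v| * W / 2 * 0)) :=
    (tendsto_inv_atTop_zero.comp
      (Real.tendsto_sqrt_atTop.comp tendsto_natCast_atTop_atTop)).const_mul _
  have hinv : Tendsto (fun T : ℕ => Real.exp B * B ^ 2 * (T : ℝ)⁻¹) atTop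
      (𝓝 (Real.exp B * B ^ 2 * 0)) :=
    (tendsto_inv_atTop_zero.comp tendsto_natCast_atTop_atTop).const_mul _
  rw [mul_zero] at hsqrt hinv
  refine tendsto_order.2 ⟨fun ε hε => Eventually.of_forall fun T => hε.trans_le (norm_nonneg _),
    fun ε hε => ?_⟩
  set ε' := ε / (2 * (Real.exp B * Real.exp 1 * B + 1)) with hε'
  have hden : 0 < Real.exp B * Real.exp 1 * B + 1 := by positivity
  have hε'0 : 0 < ε' := by positivity
  obtain ⟨δ, hδ, hδ'⟩ := exists_norm_sqCharFun_mul_exp_sub_one_le hε'0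
  filter_upwards [eventually_ge_atTop (p + 1), hsqrt.eventually (gt_mem_nhds hδ),
    hinv.eventually (gt_mem_nhds (half_pos hε))] with T hT hT1 hT2
  have hT' : (0 : ℝ) < T := by
    have : 0 < T := by omega
    exact_mod_cast this
  have hs0 : 0 < √(T : ℝ) := Real.sqrt_pos.2 hT'
  set σ := |v| * W / 2 * (√(T : ℝ))⁻¹ with hσ
  have hσ2 : T * σ ^ 2 = B := by
    rw [hσ, mul_pow, div_pow, mul_pow, sq_abs, inv_pow, Real.sq_sqrt hT'.le, hB]
    field_simp
    norm_num
  have hmemI : ∀ t ∈ Finset.Ico (p + 1) (T + 1), t ∈ Finset.Icc (p + 1) T := fun t ht => by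
    rw [Finset.mem_Ico] at ht; rw [Finset.mem_Icc]; omega
  have hsb : ∀ t ∈ Finset.Ico (p + 1) (T + 1), ∀ ω, |v / (2 * √T) * w T t ω| ≤ σ := fun t ht ω => by
    rw [abs_mul, abs_div, abs_of_pos (a := 2 * √(T : ℝ)) (by positivity)]
    calc _ ≤ |v| / (2 * √(T : ℝ)) * W := by gcongr; exact hW T t (hmemI t ht) ω
      _ = σ := by rw [hσ]; field_simp
  set r := ε' * σ ^ 2 * Real.exp 1 + σ ^ 4 with hr
  have hr0 : 0 ≤ r := by positivity
  have hmain := norm_integral_cexp_sub_one_le hξ (a := p + 1) (n := T + 1)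
    (s := fun t ω => v / (2 * √T) * w T t ω) (σ := σ) (r := r)
    (fun t => (hw T t).const_mul _) (by omega) hsb
    (fun x hx => (hδ' x (hx.trans hT1.le)).trans (by
      have hx2 : x ^ 2 ≤ σ ^ 2 := by
        rw [← sq_abs]; exact pow_le_pow_left₀ (abs_nonneg _) hx 2
      have hx4 : x ^ 4 ≤ σ ^ 4 := by
        have := pow_le_pow_left₀ (sq_nonneg x) hx2 2
        nlinarith
      rw [hr]
      gcongr)) hr0
  refine hmain.trans_lt ?_
  have hcard : ((T + 1 - (p + 1) : ℕ) : ℝ) ≤ T := by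
    exact_mod_cast (by omega : T + 1 - (p + 1) ≤ T)
  have hTr : T * r = ε' * Real.exp 1 * B + B ^ 2 * (T : ℝ)⁻¹ := by
    have : σ ^ 2 = B / T := by rw [← hσ2]; field_simp
    rw [hr, show σ ^ 4 = (σ ^ 2) ^ 2 by ring, this]
    field_simp
  calc _ ≤ T * (Real.exp (T * σ ^ 2) * r) := by gcongr
    _ = Real.exp B * (T * r) := by rw [hσ2]; ring
    _ = ε' * (Real.exp B * Real.exp 1 * B) + Real.exp B * B ^ 2 * (T : ℝ)⁻¹ := by rw [hTr]; ring
    _ < ε / 2 + ε / 2 := by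
        refine add_lt_add_of_le_of_lt ?_ hT2
        calc _ ≤ ε' * (Real.exp B * Real.exp 1 * B + 1) := by gcongr; linarith
          _ = ε / 2 := by rw [hε']; field_simp
    _ = ε := by ring

omit [MeasurableSpace Ω] [IsProbabilityMeasure P] hξ hw in
lemma average_sq_le (T : ℕ) (ω : Ω) :
    1 / (T : ℝ) * ∑ t ∈ Finset.Icc (p + 1) T, w T t ω ^ 2 ≤ W ^ 2 := by
  rcases T.eq_zero_or_pos with rfl | hT
  · simpa using sq_nonneg W
  have hT' : (0 : ℝ) < T := by exact_mod_cast hT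
  have hcard : ((Finset.Icc (p + 1) T).card : ℝ) ≤ T := by
    exact_mod_cast (by rw [Nat.card_Icc]; omega : (Finset.Icc (p + 1) T).card ≤ T)
  calc _ ≤ 1 / (T : ℝ) * (T * W ^ 2) := by
        gcongr
        refine (Finset.sum_le_card_nsmul _ _ (W ^ 2) fun t ht => ?_).trans ?_
        · rw [← sq_abs]; exact pow_le_pow_left₀ (abs_nonneg _) (hW T t ht ω) 2
        · rw [nsmul_eq_mul]; exact mul_le_mul_of_nonneg_right hcard (sq_nonneg _)
    _ = W ^ 2 := by field_simp

/-- A central limit theorem for the score, through its characteristic function: the compensated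
exponential has expectation tending to `1`, and the compensator converges to a constant. -/
lemma tendsto_integral_cexp_score (hQ0 : 0 ≤ Q)
    (hQ : Tendsto (fun T : ℕ => ∫ ω, |1 / T * ∑ t ∈ Finset.Icc (p + 1) T, w T t ω ^ 2 - Q| ∂P)
      atTop (𝓝 0)) (v : ℝ) :
    Tendsto (fun T : ℕ => ∫ ω, Complex.exp (((v * (1 / (2 * √T) *
        ∑ t ∈ Finset.Icc (p + 1) T, (ξ t ω ^ 2 - 1) * w T t ω) : ℝ) : ℂ) * Complex.I) ∂P)
      atTop (𝓝 (Complex.exp ((-(v ^ 2 * Q / 4) : ℝ) : ℂ))) := by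
  set B := v ^ 2 * W ^ 2 / 4 with hB
  have hB0 : 0 ≤ B := by positivity
  rw [tendsto_iff_norm_sub_tendsto_zero]
  have hlim : Tendsto (fun T : ℕ => Real.exp B * (v ^ 2 / 4
      * ∫ ω, |1 / T * ∑ t ∈ Finset.Icc (p + 1) T, w T t ω ^ 2 - Q| ∂P)
      + ‖∫ ω, Complex.exp
        (((∑ t ∈ Finset.Ico (p + 1) (T + 1), v / (2 * √T) * w T t ω * (ξ t ω ^ 2 - 1) : ℝ) : ℂ)
          * Complex.I)
        * Real.exp (∑ t ∈ Finset.Ico (p + 1) (T + 1), (v / (2 * √T) * w T t ω) ^ 2) ∂P - 1‖)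
      atTop (𝓝 (Real.exp B * (v ^ 2 / 4 * 0) + 0)) :=
    ((hQ.const_mul _).const_mul _).add (tendsto_norm_integral_cexp_sub_one hξ hw hW v)
  rw [mul_zero, mul_zero, zero_add] at hlim
  refine squeeze_zero' (Eventually.of_forall fun T => norm_nonneg _) ?_ hlim
  filter_upwards [eventually_ge_atTop 1] with T hT
  have hT' : (0 : ℝ) < T := by exact_mod_cast hT
  have hs0 : 0 < √(T : ℝ) := Real.sqrt_pos.2 hT'
  have hI : Finset.Ico (p + 1) (T + 1) = Finset.Icc (p + 1) T := by
    ext t; simp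
  rw [hI]
  have hwm : ∀ t, Measurable (w T t) := fun t => (hw T t).mono (noiseSigma_le hξ _) le_rfl
  let A : Ω → ℝ := fun ω => 1 / T * ∑ t ∈ Finset.Icc (p + 1) T, w T t ω ^ 2
  let U : Ω → ℝ := fun ω => v * (1 / (2 * √T) *
    ∑ t ∈ Finset.Icc (p + 1) T, (ξ t ω ^ 2 - 1) * w T t ω)
  have hUe : ∀ ω, ∑ t ∈ Finset.Icc (p + 1) T, v / (2 * √T) * w T t ω * (ξ t ω ^ 2 - 1) = U ω :=
    fun ω => by
      simp only [U, Finset.mul_sum]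
      refine Finset.sum_congr rfl fun t _ => ?_
      field_simp
  have hVe : ∀ ω, ∑ t ∈ Finset.Icc (p + 1) T, (v / (2 * √T) * w T t ω) ^ 2 = v ^ 2 / 4 * A ω :=
    fun ω => by
      simp only [A, Finset.mul_sum]
      refine Finset.sum_congr rfl fun t _ => ?_
      rw [mul_pow, div_pow, mul_pow, Real.sq_sqrt hT'.le]
      field_simp
      ring
  simp only [hUe, hVe]
  have hAm : Measurable A := (Finset.measurable_sum _ fun t _ => (hwm t).pow_const 2).const_mul _
  have hUm : Measurable U := ((Finset.measurable_sum _ fun (t : ℕ) _ =>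
    (((hξ.measurable t).pow_const 2).sub_const 1).mul (hwm t)).const_mul _).const_mul _
  have hA0 : ∀ ω, 0 ≤ A ω := fun ω => by positivity
  have hAW : ∀ ω, A ω ≤ W ^ 2 := average_sq_le hW T
  have hVB : ∀ ω, v ^ 2 / 4 * A ω ≤ B := fun ω => by
    rw [hB, mul_div_right_comm]; exact mul_le_mul_of_nonneg_left (hAW ω) (by positivity)
  have hAi : Integrable (fun ω => |A ω - Q|) P :=
    ((integrable_of_abs_le hAm fun ω => by rw [abs_of_nonneg (hA0 ω)]; exact hAW ω).sub
      (integrable_const Q)).abs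
  let E : Ω → ℂ := fun ω => Complex.exp ((U ω : ℂ) * Complex.I)
  let G : Ω → ℂ := fun ω => E ω * Real.exp (v ^ 2 / 4 * A ω)
  have hEm : Measurable E := ((Complex.measurable_ofReal.comp hUm).mul_const _).cexp
  have hEn : ∀ ω, ‖E ω‖ = 1 := fun ω => Complex.norm_exp_ofReal_mul_I _
  have hEi : Integrable E P := Integrable.of_bound hEm.aestronglyMeasurable 1
    (Eventually.of_forall fun ω => (hEn ω).le)
  have hGi : Integrable G P := by
    refine Integrable.of_bound (hEm.mul
      (Complex.measurable_ofReal.comp (hAm.const_mul _).exp)).aestronglyMeasurable (Real.exp B)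
      (Eventually.of_forall fun ω => ?_)
    rw [norm_mul, hEn, one_mul, Complex.norm_real, Real.norm_of_nonneg (Real.exp_pos _).le,
      Real.exp_le_exp]
    exact hVB ω
  set q : ℝ := -(v ^ 2 * Q / 4) with hq
  have hq0 : q ≤ 0 := by rw [hq]; have : 0 ≤ v ^ 2 * Q := by positivity
                         linarith
  change ‖∫ ω, E ω ∂P - _‖ ≤ _ + ‖∫ ω, G ω ∂P - 1‖
  have e1 : ∫ ω, E ω ∂P - Complex.exp (q : ℂ) = ∫ ω, (E ω - Real.exp q * G ω) ∂P
      + Real.exp q * (∫ ω, G ω ∂P - 1) := by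
    rw [integral_sub hEi (hGi.const_mul _), integral_const_mul, Complex.ofReal_exp]
    ring
  have e2 : ∀ ω, ‖E ω - Real.exp q * G ω‖ ≤ Real.exp B * (v ^ 2 / 4 * |A ω - Q|) := fun ω => by
    have h1 : E ω - Real.exp q * G ω = E ω * ((1 - Real.exp (q + v ^ 2 / 4 * A ω) : ℝ) : ℂ) := by
      simp only [G]
      rw [Real.exp_add]
      push_cast
      ring
    have hx : q + v ^ 2 / 4 * A ω = v ^ 2 / 4 * (A ω - Q) := by rw [hq]; ring
    have hxB : q + v ^ 2 / 4 * A ω ≤ B := by linarith [hVB ω]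
    rw [h1, norm_mul, hEn, one_mul, Complex.norm_real, Real.norm_eq_abs]
    have hxa : v ^ 2 / 4 * |A ω - Q| = |q + v ^ 2 / 4 * A ω| := by
      rw [hx, abs_mul, abs_of_nonneg (a := v ^ 2 / 4) (by positivity)]
    rw [hxa]
    generalize q + v ^ 2 / 4 * A ω = x at hxB
    -- `|1 - eˣ| ≤ |x| e^{max x 0}`
    have hx1 := Real.add_one_le_exp x
    have hx2 := Real.add_one_le_exp (-x)
    have hx3 : Real.exp x * Real.exp (-x) = 1 := by rw [← Real.exp_add]; simp
    have hB1 : 1 ≤ Real.exp B := Real.one_le_exp hB0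
    have hxB' : Real.exp x ≤ Real.exp B := Real.exp_le_exp.2 hxB
    rcases le_total 0 x with h0 | h0
    · rw [abs_of_nonneg h0, abs_of_nonpos (by linarith)]
      nlinarith [Real.exp_pos x]
    · rw [abs_of_nonpos h0, abs_of_nonneg (by
        have := Real.exp_le_one_iff.2 h0; linarith)]
      nlinarith
  rw [e1]
  refine (norm_add_le _ _).trans (add_le_add ?_ ?_)
  · refine (norm_integral_le_integral_norm _).trans ?_
    rw [← integral_const_mul, ← integral_const_mul]
    exact integral_mono_of_nonneg (Eventually.of_forall fun ω => norm_nonneg _)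
      ((hAi.const_mul _).const_mul _) (Eventually.of_forall e2)
  · rw [norm_mul, Complex.norm_real, Real.norm_of_nonneg (Real.exp_pos _).le]
    exact mul_le_of_le_one_left (norm_nonneg _) (Real.exp_le_one_iff.2 hq0)

omit hw hW in
/-- Averages of the martingale differences `(ξ_t² - 1) b_t`, with `b_t` predictable and bounded, are of
order `T^(-1/2)` in `L¹`. -/
lemma integral_average_noise_mul_le {T : ℕ} (hT : 0 < T) {b : ℕ → Ω → ℝ} {V : ℝ}
    (hb : ∀ t : ℕ, Measurable[noiseSigma ξ (Set.Iio (t : ℤ))] (b t))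
    (hV : ∀ t ∈ Finset.Icc (p + 1) T, ∀ ω, |b t ω| ≤ V) :
    ∫ ω, |1 / (T : ℝ) * ∑ t ∈ Finset.Icc (p + 1) T, (ξ t ω ^ 2 - 1) * b t ω| ∂P
      ≤ (1 + V ^ 2 * 2) * (1 / √T) := by
  have hT' : (0 : ℝ) < T := by exact_mod_cast hT
  let f : ℕ → Ω → ℝ := fun t ω => (ξ t ω ^ 2 - 1) * b t ω
  have hηm : ∀ t : ℤ, Measurable fun ω => ξ t ω ^ 2 - 1 := fun t =>
    ((hξ.measurable t).pow_const 2).sub_const 1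
  have hbm : ∀ t, Measurable (b t) := fun t => (hb t).mono (noiseSigma_le hξ _) le_rfl
  have hfm : ∀ t, Measurable (f t) := fun t => (hηm t).mul (hbm t)
  have hηi : ∀ t : ℤ, Integrable (fun ω => ξ t ω ^ 2 - 1) P := fun t =>
    (integrable_noise_pow hξ t 2).sub (integrable_const 1)
  have hη0 : ∀ t : ℤ, ∫ ω, (ξ t ω ^ 2 - 1) ∂P = 0 := fun t => by
    rw [integral_sub (integrable_noise_pow hξ t 2) (integrable_const 1), integral_noise_sq hξ]
    simp
  have hfb : ∀ t ∈ Finset.Icc (p + 1) T, ∀ ω, f t ω ^ 2 ≤ V ^ 2 * (ξ t ω ^ 2 - 1) ^ 2 :=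
    fun t ht ω => by
      simp only [f]
      rw [mul_pow, mul_comm]
      refine mul_le_mul_of_nonneg_right ?_ (sq_nonneg _)
      rw [← sq_abs]; exact pow_le_pow_left₀ (abs_nonneg _) (hV t ht ω) 2
  have hf2 : ∀ t ∈ Finset.Icc (p + 1) T, MemLp (f t) 2 P := fun t ht => by
    rw [memLp_two_iff_integrable_sq (hfm t).aestronglyMeasurable]
    refine ((integrable_noise_sq_sub_one_sq hξ t).1.const_mul (V ^ 2)).mono'
      ((hfm t).pow_const 2).aestronglyMeasurable (Eventually.of_forall fun ω => ?_)
    rw [Real.norm_of_nonneg (sq_nonneg _)]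
    exact hfb t ht ω
  have hff : ∀ s ∈ Finset.Icc (p + 1) T, ∀ t ∈ Finset.Icc (p + 1) T,
      Integrable (fun ω => f s ω * f t ω) P := fun s hs t ht => (hf2 s hs).integrable_mul (hf2 t ht)
  have horth : ∀ s ∈ Finset.Icc (p + 1) T, ∀ t ∈ Finset.Icc (p + 1) T, s < t →
      ∫ ω, f s ω * f t ω ∂P = 0 := fun s hs t ht hst => by
    have hsm : Measurable[noiseSigma ξ (Set.Iio (t : ℤ))] fun ω => f s ω * b t ω := by
      refine Measurable.mul (Measurable.mul ?_ ?_) (hb t)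
      · exact ((measurable_noise ξ (by simpa using hst)).pow_const 2).sub_const 1
      · exact (hb s).mono (noiseSigma_mono ξ (Set.Iio_subset_Iio (Int.ofNat_le.2 hst.le))) le_rfl
    have hind : IndepFun (fun ω => f s ω * b t ω) (fun ω => ξ t ω ^ 2 - 1) P :=
      (indepFun_noise hξ hsm).comp measurable_id (φ := id)
        (ψ := fun z : ℝ => z ^ 2 - 1) (by fun_prop)
    have := hind.integral_fun_mul_eq_mul_integral
      (hsm.mono (noiseSigma_le hξ _) le_rfl).aestronglyMeasurable (hηm t).aestronglyMeasurable
    rw [hη0, mul_zero] at this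
    rw [← this]
    refine integral_congr_ae (Eventually.of_forall fun ω => ?_)
    simp only [f]
    ring
  have hdiag : ∀ t ∈ Finset.Icc (p + 1) T, ∫ ω, f t ω * f t ω ∂P ≤ V ^ 2 * 2 := fun t ht => by
    rw [← (integrable_noise_sq_sub_one_sq hξ t).2, ← integral_const_mul]
    refine integral_mono (hff t ht t ht) ((integrable_noise_sq_sub_one_sq hξ t).1.const_mul _)
      fun ω => ?_
    have := hfb t ht ω
    rwa [sq] at this
  have hsum := integral_sq_sum_le (P := P) (I := Finset.Icc (p + 1) T) (f := f) (N := 0)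
    (B := V ^ 2 * 2) (by positivity) hff
    (fun s hs t ht => by
      rcases lt_trichotomy s t with hst | rfl | hst
      · rw [horth s hs t ht hst]; positivity
      · exact hdiag s hs
      · simp_rw [mul_comm (f s _)]
        rw [horth t ht s hs hst]; positivity)
    (fun s hs t ht hst => horth s hs t ht (by omega))
  have hcard : ((Finset.Icc (p + 1) T).card : ℝ) ≤ T := by
    exact_mod_cast (by rw [Nat.card_Icc]; omega : (Finset.Icc (p + 1) T).card ≤ T)
  have hsumi : Integrable (fun ω => (∑ t ∈ Finset.Icc (p + 1) T, f t ω) ^ 2) P :=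
    (memLp_finsetSum _ hf2).integrable_sq
  refine integral_abs_le_of_integral_sq_le (by positivity) ?_ ?_
  · simp_rw [mul_pow]
    exact hsumi.const_mul _
  · simp_rw [mul_pow]
    rw [integral_const_mul]
    calc _ ≤ (1 / (T : ℝ)) ^ 2 * (T * (V ^ 2 * 2)) := by
          gcongr
          refine hsum.trans ?_
          simp only [Nat.cast_zero, mul_zero, zero_add, one_mul]
          exact mul_le_mul_of_nonneg_right hcard (by positivity)
      _ = _ := by
          rw [div_pow, div_pow, Real.sq_sqrt hT'.le]
          field_simp

/-- The quadratic expansion of the log-likelihood ratio in `L¹`. It is stated with the Lebesgue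
integral, which does not presuppose integrability. -/
lemma tendsto_lintegral_abs_llr_sub
    (hQ : Tendsto (fun T : ℕ => ∫ ω, |1 / T * ∑ t ∈ Finset.Icc (p + 1) T, w T t ω ^ 2 - Q| ∂P)
      atTop (𝓝 0)) :
    Tendsto (fun T : ℕ => ∫⁻ ω, ENNReal.ofReal
      |∑ t ∈ Finset.Icc (p + 1) T, llrTerm (ξ t ω ^ 2) (w T t ω / √T)
        - (1 / (2 * √T) * ∑ t ∈ Finset.Icc (p + 1) T, (ξ t ω ^ 2 - 1) * w T t ω - Q / 4)| ∂P)
      atTop (𝓝 0) := by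
  have hsqrt : Tendsto (fun T : ℕ => (√(T : ℝ))⁻¹) atTop (𝓝 0) :=
    tendsto_inv_atTop_zero.comp (Real.tendsto_sqrt_atTop.comp tendsto_natCast_atTop_atTop)
  have hlim : Tendsto (fun T : ℕ => 1 / 4 * ∫ ω, |1 / T * ∑ t ∈ Finset.Icc (p + 1) T,
      w T t ω ^ 2 - Q| ∂P + 1 / 2 * ((1 + (W ^ 2) ^ 2 * 2) * (√(T : ℝ))⁻¹)
      + 2 * |W| ^ 3 * (√(T : ℝ))⁻¹) atTop
      (𝓝 (1 / 4 * 0 + 1 / 2 * ((1 + (W ^ 2) ^ 2 * 2) * 0) + 2 * |W| ^ 3 * 0)) :=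
    ((hQ.const_mul _).add ((hsqrt.const_mul _).const_mul _)).add (hsqrt.const_mul _)
  simp only [mul_zero, add_zero] at hlim
  replace hlim := ENNReal.tendsto_ofReal hlim
  rw [ENNReal.ofReal_zero] at hlim
  refine tendsto_of_tendsto_of_tendsto_of_le_of_le' tendsto_const_nhds hlim
    (Eventually.of_forall fun T => zero_le) ?_
  have hsmall : Tendsto (fun T : ℕ => |W| * (√(T : ℝ))⁻¹) atTop (𝓝 (|W| * 0)) := hsqrt.const_mul _
  rw [mul_zero] at hsmall
  filter_upwards [eventually_ge_atTop 1, hsmall.eventually (gt_mem_nhds (half_pos one_pos))]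
    with T hT hTW
  have hT' : (0 : ℝ) < T := by exact_mod_cast hT
  have hs0 : 0 < √(T : ℝ) := Real.sqrt_pos.2 hT'
  have hwm : ∀ t, Measurable (w T t) := fun t => (hw T t).mono (noiseSigma_le hξ _) le_rfl
  have hcard : ((Finset.Icc (p + 1) T).card : ℝ) ≤ T := by
    exact_mod_cast (by rw [Nat.card_Icc]; omega : (Finset.Icc (p + 1) T).card ≤ T)
  have hy : ∀ t ∈ Finset.Icc (p + 1) T, ∀ ω, |w T t ω / √T| ≤ |W| * (√(T : ℝ))⁻¹ := fun t ht ω => by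
    rw [abs_div, abs_of_pos hs0, div_eq_mul_inv]
    exact mul_le_mul_of_nonneg_right ((hW T t ht ω).trans (le_abs_self W)) (by positivity)
  let A : Ω → ℝ := fun ω => 1 / T * ∑ t ∈ Finset.Icc (p + 1) T, w T t ω ^ 2
  let M : Ω → ℝ := fun ω => 1 / T * ∑ t ∈ Finset.Icc (p + 1) T, (ξ t ω ^ 2 - 1) * w T t ω ^ 2
  let R : Ω → ℝ := fun ω => (|W| * (√(T : ℝ))⁻¹) ^ 3 * ∑ t ∈ Finset.Icc (p + 1) T, (1 + ξ t ω ^ 2)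
  have hAm : Measurable A := (Finset.measurable_sum _ fun t _ => (hwm t).pow_const 2).const_mul _
  have hAi : Integrable (fun ω => |A ω - Q|) P := by
    refine ((integrable_of_abs_le (W := W ^ 2) hAm fun ω => ?_).sub (integrable_const Q)).abs
    rw [abs_of_nonneg (by positivity)]
    exact average_sq_le hW T ω
  have hMi : Integrable (fun ω => |M ω|) P := by
    refine (Integrable.const_mul (integrable_finsetSum _ fun t ht => ?_) _).abs
    refine ((integrable_noise_pow hξ t 2).sub (integrable_const 1)).mul_bdd (c := W ^ 2)
      ((hwm t).pow_const 2).aestronglyMeasurable (Eventually.of_forall fun ω => ?_)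
    rw [Real.norm_of_nonneg (sq_nonneg _), ← sq_abs]
    exact pow_le_pow_left₀ (abs_nonneg _) (hW T t ht ω) 2
  have hξi : ∀ t : ℕ, Integrable (fun ω => 1 + ξ t ω ^ 2) P := fun t =>
    (integrable_const 1).add (integrable_noise_pow hξ t 2)
  have hRi : Integrable R P := (integrable_finsetSum _ fun t _ => hξi t).const_mul _
  have hM := integral_average_noise_mul_le (p := p) hξ hT (b := fun t ω => w T t ω ^ 2)
    (V := W ^ 2) (fun t => (hw T t).pow_const 2) fun t ht ω => by
      rw [abs_of_nonneg (sq_nonneg _), ← sq_abs]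
      exact pow_le_pow_left₀ (abs_nonneg _) (hW T t ht ω) 2
  rw [one_div (√(T : ℝ))] at hM
  have hR : ∫ ω, R ω ∂P ≤ 2 * |W| ^ 3 * (√(T : ℝ))⁻¹ := by
    simp only [R]
    rw [integral_const_mul, integral_finsetSum _ fun t _ => hξi t]
    have h1 : ∀ t : ℕ, ∫ ω, (1 + ξ t ω ^ 2) ∂P = 2 := fun t => by
      rw [integral_add (integrable_const 1) (integrable_noise_pow hξ t 2), integral_noise_sq hξ]
      simp
      norm_num
    simp only [h1, Finset.sum_const, nsmul_eq_mul]
    calc _ ≤ (|W| * (√(T : ℝ))⁻¹) ^ 3 * (T * 2) := by gcongr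
      _ = _ := by
        have e : ((√(T : ℝ))⁻¹) ^ 3 = (√(T : ℝ))⁻¹ * (T : ℝ)⁻¹ := by
          rw [pow_succ', inv_pow, Real.sq_sqrt hT'.le]
        rw [mul_pow, e]
        field_simp
  have hpt : ∀ ω, |∑ t ∈ Finset.Icc (p + 1) T, llrTerm (ξ t ω ^ 2) (w T t ω / √T)
      - (1 / (2 * √T) * ∑ t ∈ Finset.Icc (p + 1) T, (ξ t ω ^ 2 - 1) * w T t ω - Q / 4)|
      ≤ 1 / 4 * |A ω - Q| + 1 / 2 * |M ω| + R ω := fun ω => by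
    have hdec : ∑ t ∈ Finset.Icc (p + 1) T, llrTerm (ξ t ω ^ 2) (w T t ω / √T)
        - (1 / (2 * √T) * ∑ t ∈ Finset.Icc (p + 1) T, (ξ t ω ^ 2 - 1) * w T t ω - Q / 4)
        = -(1 / 4) * (A ω - Q) + -(1 / 2) * M ω + ∑ t ∈ Finset.Icc (p + 1) T,
          (llrTerm (ξ t ω ^ 2) (w T t ω / √T) - (1 / 2 * ((ξ t ω ^ 2 - 1) * (w T t ω / √T))
            - 1 / 4 * (w T t ω / √T) ^ 2 - 1 / 2 * ((ξ t ω ^ 2 - 1) * (w T t ω / √T) ^ 2))) := by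
      have e1 : A ω = ∑ t ∈ Finset.Icc (p + 1) T, (w T t ω / √T) ^ 2 := by
        simp only [A, Finset.mul_sum]
        refine Finset.sum_congr rfl fun t _ => ?_
        rw [div_pow, Real.sq_sqrt hT'.le]; field_simp
      have e2 : M ω = ∑ t ∈ Finset.Icc (p + 1) T, (ξ t ω ^ 2 - 1) * (w T t ω / √T) ^ 2 := by
        simp only [M, Finset.mul_sum]
        refine Finset.sum_congr rfl fun t _ => ?_
        rw [div_pow, Real.sq_sqrt hT'.le]; field_simp
      have e3 : 1 / (2 * √T) * ∑ t ∈ Finset.Icc (p + 1) T, (ξ t ω ^ 2 - 1) * w T t ω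
          = 1 / 2 * ∑ t ∈ Finset.Icc (p + 1) T, (ξ t ω ^ 2 - 1) * (w T t ω / √T) := by
        simp only [Finset.mul_sum]
        refine Finset.sum_congr rfl fun t _ => ?_
        field_simp
      rw [e1, e2, e3]
      simp only [Finset.sum_sub_distrib, ← Finset.mul_sum]
      ring
    rw [hdec]
    refine (abs_add_le _ _).trans (add_le_add ((abs_add_le _ _).trans (add_le_add ?_ ?_)) ?_)
    · rw [abs_mul]; norm_num
    · rw [abs_mul]; norm_num
    · refine (Finset.abs_sum_le_sum_abs _ _).trans ?_
      simp only [R, Finset.mul_sum]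
      refine Finset.sum_le_sum fun t ht => ?_
      refine (abs_llrTerm_sub_le (sq_nonneg _) ((hy t ht ω).trans hTW.le)).trans ?_
      have := hy t ht ω
      gcongr
  have hsum1 : Integrable (fun ω => 1 / 4 * |A ω - Q| + 1 / 2 * |M ω|) P :=
    (hAi.const_mul _).add (hMi.const_mul _)
  refine (lintegral_mono fun ω => ENNReal.ofReal_le_ofReal (hpt ω)).trans ?_
  rw [← ofReal_integral_eq_lintegral_ofReal (f := fun ω => 1 / 4 * |A ω - Q| + 1 / 2 * |M ω| + R ω)
    (hsum1.add hRi) (Eventually.of_forall fun ω => (abs_nonneg _).trans (hpt ω))]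
  refine ENNReal.ofReal_le_ofReal ?_
  calc ∫ ω, (1 / 4 * |A ω - Q| + 1 / 2 * |M ω| + R ω) ∂P
      = 1 / 4 * ∫ ω, |A ω - Q| ∂P + 1 / 2 * ∫ ω, |M ω| ∂P + ∫ ω, R ω ∂P := by
        rw [integral_add hsum1 hRi, integral_add (hAi.const_mul _) (hMi.const_mul _),
          integral_const_mul, integral_const_mul]
    _ ≤ _ := by gcongr

end asymptotics

/-! ### Regularity of the coefficients -/

lemma IsLipschitzVec.exists_bound {m : ℕ} {f : ℝ → Fin m → ℝ} (hf : IsLipschitzVec f) :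
    ∃ L B : ℝ, 0 ≤ L ∧
      (∀ u ∈ Set.Icc (0 : ℝ) 1, ∀ v ∈ Set.Icc (0 : ℝ) 1, ∀ k, |f u k - f v k| ≤ L * |u - v|) ∧
      ∀ u ∈ Set.Icc (0 : ℝ) 1, ∀ k, |f u k| ≤ B := by
  choose K hK using hf
  have hL : ∀ u ∈ Set.Icc (0 : ℝ) 1, ∀ v ∈ Set.Icc (0 : ℝ) 1, ∀ k,
      |f u k - f v k| ≤ (∑ k, (K k : ℝ)) * |u - v| := fun u hu v hv k => by
    have h1 := (hK k).dist_le_mul u hu v hv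
    rw [Real.dist_eq, Real.dist_eq] at h1
    refine h1.trans (mul_le_mul_of_nonneg_right ?_ (abs_nonneg _))
    exact Finset.single_le_sum (f := fun k => (K k : ℝ)) (fun k _ => (K k).2) (Finset.mem_univ k)
  have hL0 : (0 : ℝ) ≤ ∑ k, (K k : ℝ) := Finset.sum_nonneg fun k _ => (K k).2
  refine ⟨∑ k, (K k : ℝ), ∑ k, |f 0 k| + ∑ k, (K k : ℝ), hL0, hL, fun u hu k => ?_⟩
  have h1 := hL u hu 0 (by simp) k
  rw [sub_zero, abs_of_nonneg hu.1] at h1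
  have h2 : |f 0 k| ≤ ∑ k, |f 0 k| :=
    Finset.single_le_sum (f := fun k => |f 0 k|) (fun k _ => abs_nonneg _) (Finset.mem_univ k)
  have h3 := abs_sub_abs_le_abs_sub (f u k) (f 0 k)
  nlinarith [hu.2]

lemma IsLipschitzVec.mergeCoeff {p m n : ℕ} (e : Fin m ⊕ Fin n ≃ Fin (p + 1))
    {f : ℝ → Fin m → ℝ} (hf : IsLipschitzVec f) (b : Fin n → ℝ) :
    IsLipschitzVec fun u => mergeCoeff e (f u) b := by
  intro k
  simp only [TvARCH.mergeCoeff]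
  rcases e.symm k with i | j
  · exact hf i
  · exact ⟨0, (LipschitzWith.const (b j)).lipschitzOnWith⟩

/-- Lipschitz coefficients are regular: positive minima exist by compactness, and the contraction rate
is a `p`-th root of the bound for the lag coefficients (of `1 / 2`, if that bound is smaller). -/
lemma exists_regularCoeffs {p : ℕ} (hp : p ≠ 0) {c d : ℝ → Fin (p + 1) → ℝ}
    (hcl : IsLipschitzVec c) (hdl : IsLipschitzVec d)
    (hpos : ∀ u ∈ Set.Icc (0 : ℝ) 1, ∀ k, 0 < c u k) {c₀ : ℝ} (hc₀ : c₀ < 1)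
    (hsum : ∀ u ∈ Set.Icc (0 : ℝ) 1, ∑ j : Fin p, c u j.succ ≤ c₀) :
    ∃ κ C D L ρ, RegularCoeffs c d κ C D L ρ := by
  obtain ⟨L, C, hL0, hL, hC⟩ := hcl.exists_bound
  obtain ⟨L', D, hL0', hL', hD⟩ := hdl.exists_bound
  have hmin : ∀ k, ∃ a ∈ Set.Icc (0 : ℝ) 1, ∀ u ∈ Set.Icc (0 : ℝ) 1, c a k ≤ c u k := fun k => by
    obtain ⟨K, hK⟩ := hcl k
    obtain ⟨a, ha, hmin⟩ := isCompact_Icc.exists_isMinOn ⟨0, by simp⟩ hK.continuousOn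
    exact ⟨a, ha, fun u hu => hmin hu⟩
  choose a ha hmin using hmin
  obtain ⟨k₀, hk₀⟩ := Finite.exists_min fun k => c (a k) k
  have h0 : (0 : ℝ) ≤ max c₀ (1 / 2) := le_max_of_le_right (by norm_num)
  have h1 : max c₀ (1 / 2) < 1 := max_lt hc₀ (by norm_num)
  have hpow : (max c₀ (1 / 2) ^ ((p : ℝ)⁻¹)) ^ p = max c₀ (1 / 2) := Real.rpow_inv_natCast_pow h0 hp
  refine ⟨c (a k₀) k₀, C, D, L + L', max c₀ (1 / 2) ^ ((p : ℝ)⁻¹), ?_⟩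
  exact
    { pos := hpos _ (ha k₀) k₀
      lower := fun u hu k => (hk₀ k).trans (hmin k u hu)
      upper := fun u hu k => (le_abs_self _).trans (hC u hu k)
      dir := hD
      lip := fun u hu v hv k => (hL u hu v hv k).trans
        (mul_le_mul_of_nonneg_right (by linarith) (abs_nonneg _))
      dir_lip := fun u hu v hv k => (hL' u hu v hv k).trans
        (mul_le_mul_of_nonneg_right (by linarith) (abs_nonneg _))
      rate_nonneg := Real.rpow_nonneg h0 _
      rate_lt_one := Real.rpow_lt_one h0 h1 (by positivity)
      rate_pow_lt_one := by rw [hpow]; exact h1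
      sum_le := fun u hu => by rw [hpow]; exact (hsum u hu).trans (le_max_left _ _) }

lemma lin_mergeCoeff_add_smul {p m n : ℕ} (e : Fin m ⊕ Fin n ≃ Fin (p + 1)) (a a' : Fin m → ℝ)
    (b b' : Fin n → ℝ) (s : ℝ) (z : Fin p → ℝ) :
    lin (mergeCoeff e (a + s • a') (b + s • b')) z
      = lin (mergeCoeff e a b) z + s * lin (mergeCoeff e a' b') z := by
  have h : ∀ k, mergeCoeff e (a + s • a') (b + s • b') k
      = mergeCoeff e a b k + s * mergeCoeff e a' b' k := fun k => by
    unfold mergeCoeff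
    rcases e.symm k with i | j <;> simp
  simp only [lin, h, add_mul, Finset.sum_add_distrib, mul_add, Finset.mul_sum, mul_assoc]
  ring

/-! ### The sample on the probability space of the noise -/

section sample

variable {Ω : Type*} {p m n : ℕ} (q : Fin m → Fin (p + 1)) (r : Fin n → Fin (p + 1)) (T : ℕ)
  (α : ℝ → Fin m → ℝ) (β : Fin n → ℝ) (x : Finset.Icc 1 p → ℝ) (ξ : ℤ → Ω → ℝ)

/-- The solution of the tv-ARCH recursion driven by the noise `ξ`. -/
def drivenPath (ω : Ω) (t : ℕ) : ℝ := solution q r T α β x (fun s => ξ (s : ℕ) ω) t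

/-- The sample `(X_{p+1}, …, X_T)` driven by the noise `ξ`. -/
def drivenSample (ω : Ω) : Finset.Icc (p + 1) T → ℝ := fun t => drivenPath q r T α β x ξ ω t

/-- The squares of the tv-ARCH process, indexed by `ℤ` (it is `0` at the times outside `[1, T]`). -/
def drivenSq (t : ℤ) (ω : Ω) : ℝ := drivenPath q r T α β x ξ ω t.toNat ^ 2

variable {q r T α β x ξ}

lemma drivenPath_zero (ω : Ω) : drivenPath q r T α β x ξ ω 0 = 0 := by
  rw [drivenPath, solution, dif_neg (by simp), dif_neg (by simp)]

lemma drivenPath_of_mem {t : ℕ} (ht : t ∈ Finset.Icc (p + 1) T) (ω : Ω) :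
    drivenPath q r T α β x ξ ω t = ξ t ω
      * √(sigmaSq q r (α (t / T)) β (past p (drivenPath q r T α β x ξ ω) t)) := by
  have ht' := Finset.mem_Icc.1 ht
  rw [drivenPath, solution, dif_neg (by rw [Finset.mem_Icc]; omega), dif_pos ht]
  rfl

lemma path_drivenSample (ω : Ω) (t : ℕ) :
    path x (drivenSample q r T α β x ξ ω) t = drivenPath q r T α β x ξ ω t := by
  simp only [path, drivenSample]
  split_ifs with h1 h2
  · rw [drivenPath, solution, dif_pos h1]
  · rfl
  · rw [drivenPath, solution, dif_neg h1, dif_neg h2]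

lemma pastZ_drivenSq (t : ℕ) (ω : Ω) :
    pastZ p (drivenSq q r T α β x ξ) t ω
      = fun j => past p (path x (drivenSample q r T α β x ξ ω)) t j ^ 2 := by
  funext j
  have h : ((t : ℤ) - 1 - ((j : ℕ) : ℤ)).toNat = t - 1 - j := by omega
  change drivenPath q r T α β x ξ ω ((t : ℤ) - 1 - ((j : ℕ) : ℤ)).toNat ^ 2
    = path x (drivenSample q r T α β x ξ ω) (t - 1 - j) ^ 2
  rw [h, path_drivenSample]

lemma measurable_drivenPath (t : ℕ) :
    Measurable[noiseSigma ξ (Set.Iic (t : ℤ))] fun ω => drivenPath q r T α β x ξ ω t := by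
  induction t using Nat.strong_induction_on with
  | _ t ih =>
    let : MeasurableSpace Ω := noiseSigma ξ (Set.Iic (t : ℤ))
    by_cases h2 : t ∈ Finset.Icc (p + 1) T
    · simp only [drivenPath_of_mem h2]
      refine (measurable_noise ξ (S := Set.Iic (t : ℤ)) (by simp)).mul (Measurable.sqrt ?_)
      refine (measurable_sigmaSq q r _ β).comp (measurable_pi_lambda _ fun j => ?_)
      have := (Finset.mem_Icc.1 h2).1
      refine (ih (t - 1 - j) (by omega)).mono (noiseSigma_mono ξ ?_) le_rfl
      exact Set.Iic_subset_Iic.2 (by omega)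
    · have : ∀ ω ω', drivenPath q r T α β x ξ ω t = drivenPath q r T α β x ξ ω' t := fun ω ω' => by
        simp only [drivenPath]
        rw [solution, solution]
        simp only [dif_neg h2]
      exact measurable_const' this

lemma drivenSq_le {t : ℤ} (ht : t ≤ p) (ω : Ω) :
    drivenSq q r T α β x ξ t ω ≤ ∑ i, x i ^ 2 := by
  have h0 : 0 ≤ ∑ i, x i ^ 2 := Finset.sum_nonneg fun i _ => sq_nonneg _
  rw [drivenSq, drivenPath, solution]
  split_ifs with h1 h2
  · exact Finset.single_le_sum (f := fun i => x i ^ 2) (fun i _ => sq_nonneg _) (Finset.mem_univ _)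
  · have := (Finset.mem_Icc.1 h2).1
    omega
  · simpa using h0

variable {e : Fin m ⊕ Fin n ≃ Fin (p + 1)} (he : ⇑e = Sum.elim q r)

include he

lemma condVar_eq_lin (t : ℕ) (y : Finset.Icc (p + 1) T → ℝ) :
    condVar q r T α β x t y
      = lin (mergeCoeff e (α (t / T)) β) (fun j => past p (path x y) t j ^ 2) :=
  subvec_dotProduct_add he _ _ _

variable [mΩ : MeasurableSpace Ω] {P : Measure Ω}

lemma isSqARCH_drivenSq (hc : ∀ u ∈ Set.Icc (0 : ℝ) 1, ∀ k, 0 ≤ mergeCoeff e (α u) β k) :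
    IsSqARCH P ξ (fun t => mergeCoeff e (α ((t : ℝ) / T)) β) p T (drivenSq q r T α β x ξ) := by
  refine ⟨fun t ω => sq_nonneg _, fun t => ?_, fun t h0 h1 => Eventually.of_forall fun ω => ?_⟩
  · rcases le_or_gt 0 t with ht | ht
    · have := (measurable_drivenPath (q := q) (r := r) (T := T) (α := α) (β := β) (x := x)
        (ξ := ξ) t.toNat).pow_const 2
      rwa [Int.toNat_of_nonneg ht] at this
    · have : drivenSq q r T α β x ξ t = fun _ => 0 := by
        funext ω
        rw [drivenSq, Int.toNat_of_nonpos ht.le, drivenPath_zero]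
        simp
      rw [this]
      exact measurable_const
  · lift t to ℕ using by omega
    have ht : t ∈ Finset.Icc (p + 1) T := Finset.mem_Icc.2 ⟨by omega, by omega⟩
    have hT : (0 : ℝ) < T := by
      have := Finset.mem_Icc.1 ht
      exact_mod_cast (by omega : 0 < T)
    have hu : ((t : ℝ) / T) ∈ Set.Icc (0 : ℝ) 1 :=
      ⟨by positivity, (div_le_one hT).2 (by exact_mod_cast (Finset.mem_Icc.1 ht).2)⟩
    have h2 : sigmaSq q r (α (t / T)) β (past p (drivenPath q r T α β x ξ ω) t)
        = lin (mergeCoeff e (α ((t : ℝ) / T)) β) (pastZ p (drivenSq q r T α β x ξ) t ω) := by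
      rw [pastZ_drivenSq, sigmaSq, subvec_dotProduct_add he]
      congr 1
      funext j
      simp only [past, path_drivenSample]
    rw [drivenSq, Int.toNat_natCast, drivenPath_of_mem ht, mul_pow, h2, Real.sq_sqrt]
    · simp
    · exact lin_nonneg (hc _ hu) fun j => sq_nonneg _

omit he

/-- The conditional law of the sample is the law of the sample driven by the given noise. -/
lemma condLaw_eq_map [IsProbabilityMeasure P] (hξ : IsGaussianNoise P ξ) :
    condLaw q r T α β x = P.map (drivenSample q r T α β x ξ) := by
  have hinj : Function.Injective fun t : Finset.Icc (p + 1) T => ((t : ℕ) : ℤ) :=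
    fun a b hab => Subtype.ext (Nat.cast_injective hab)
  have hmap : P.map (fun ω (t : Finset.Icc (p + 1) T) => ξ (t : ℕ) ω)
      = Measure.pi fun _ => gaussianReal 0 1 := by
    rw [(iIndepFun_iff_map_fun_eq_pi_map
      fun t : Finset.Icc (p + 1) T => (hξ.measurable (t : ℕ)).aemeasurable).1
      (hξ.indep.precomp hinj)]
    simp only [hξ.law]
  rw [condLaw, ← hmap, Measure.map_map
    (measurable_pi_lambda (fun (ζ : Finset.Icc (p + 1) T → ℝ) (t : Finset.Icc (p + 1) T) =>
      solution q r T α β x ζ t) fun t => measurable_solution q r T α β x t)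
    (measurable_pi_lambda _ fun t => hξ.measurable _)]
  rfl

lemma measurable_drivenSample (hξ : IsGaussianNoise P ξ) :
    Measurable (drivenSample q r T α β x ξ) :=
  measurable_pi_lambda _ fun t =>
    (measurable_drivenPath (t : ℕ)).mono (noiseSigma_le hξ _) le_rfl

lemma measurable_score (g : ℝ → Fin m → ℝ) (h : Fin n → ℝ) :
    Measurable (score q r T α β g h x) := by
  have hs : ∀ (s : ℕ) {k : ℕ} (l : Fin k → Fin (p + 1)) (b : Fin k → ℝ),
      Measurable fun y : Finset.Icc (p + 1) T → ℝ => subvec l (past p (path x y) s) ⬝ᵥ b := by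
    intro s k l b
    have := (measurable_sigmaSq l l b (0 : Fin k → ℝ)).comp
      (measurable_past_path (T := T) (x := x) s)
    simpa [sigmaSq, Function.comp_def] using this
  refine (Finset.measurable_sum _ fun t _ => ?_).const_mul _
  exact ((((measurable_path t).pow_const 2).sub (measurable_condVar t)).div
    ((measurable_condVar t).pow_const 2)).mul ((hs t q _).add (hs t r _))

end sample

/-! ### The information of the stationary processes -/

section information

variable {Ω : Type*} [MeasurableSpace Ω] {P : Measure Ω} [IsProbabilityMeasure P] {ξ : ℤ → Ω → ℝ}
  {p m n : ℕ} {q : Fin m → Fin (p + 1)} {r : Fin n → Fin (p + 1)}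
  {e : Fin m ⊕ Fin n ≃ Fin (p + 1)} (he : ⇑e = Sum.elim q r) {a : Fin m → ℝ} {b : Fin n → ℝ}

omit [IsProbabilityMeasure P] in
lemma IsStationaryARCH.measurable (hξ : IsGaussianNoise P ξ) {X : ℤ → Ω → ℝ}
    (hX : IsStationaryARCH P ξ q r a b X) (t : ℤ) : Measurable (X t) :=
  (hX.causal t).mono (iSup_le fun s => (hξ.measurable s).comap_le) le_rfl

omit [IsProbabilityMeasure P] in
lemma IsStationaryARCH.map_sq (hξ : IsGaussianNoise P ξ) {X : ℤ → Ω → ℝ}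
    (hX : IsStationaryARCH P ξ q r a b X) (k : ℤ) :
    P.map (fun ω t => X (t + k) ω ^ 2) = P.map (fun ω t => X t ω ^ 2) := by
  have hm : Measurable fun y : ℤ → ℝ => fun t => y t ^ 2 :=
    measurable_pi_lambda _ fun t => (measurable_pi_apply t).pow_const 2
  have h := congrArg (Measure.map fun y : ℤ → ℝ => fun t => y t ^ 2) (hX.stationary k)
  rw [Measure.map_map hm (measurable_pi_lambda _ fun t => hX.measurable hξ _),
    Measure.map_map hm (measurable_pi_lambda _ fun t => hX.measurable hξ _)] at h
  exact h

include he

omit [IsProbabilityMeasure P] in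
lemma IsStationaryARCH.isSqARCH {X : ℤ → Ω → ℝ} (hX : IsStationaryARCH P ξ q r a b X)
    (hc : ∀ k, 0 ≤ mergeCoeff e a b k) (s₀ s₁ : ℤ) :
    IsSqARCH P ξ (fun _ => mergeCoeff e a b) s₀ s₁ (fun t ω => X t ω ^ 2) := by
  refine ⟨fun t ω => sq_nonneg _, fun t => ?_, fun t _ _ => ?_⟩
  · have := (hX.causal t).pow_const 2
    rwa [iSup_subtype] at this
  · filter_upwards [hX.recursion t] with ω hω
    rw [hω, mul_pow, Real.sq_sqrt]
    · rw [sigmaSq, subvec_dotProduct_add he]; rfl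
    · rw [sigmaSq, subvec_dotProduct_add he]
      exact lin_nonneg hc fun j => sq_nonneg _

/-- The quadratic form of the information matrix is the mean square of the relative perturbation of
the conditional variance. -/
lemma dotProduct_infoMatrix_mulVec (hξ : IsGaussianNoise P ξ) {X : ℤ → Ω → ℝ}
    (hX : IsStationaryARCH P ξ q r a b X) {κ : ℝ} (hκ : 0 < κ)
    (hc : ∀ k, κ ≤ mergeCoeff e a b k) (a' : Fin m → ℝ) (b' : Fin n → ℝ) :
    Sum.elim a' b' ⬝ᵥ (infoMatrix P q r a b X *ᵥ Sum.elim a' b')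
      = ∫ ω, ratio (mergeCoeff e a b) (mergeCoeff e a' b')
          (pastZ p (fun t ω => X t ω ^ 2) 1 ω) ^ 2 ∂P := by
  let z : Ω → Fin p → ℝ := fun ω => pastZ p (fun t ω => X t ω ^ 2) 1 ω
  have hz : ∀ ω j, 0 ≤ z ω j := fun ω j => sq_nonneg _
  have hzm : Measurable z := 
    measurable_pi_lambda _ fun j => (hX.measurable hξ _).pow_const 2
  -- the regressors divided by the conditional variance
  let f : Fin m ⊕ Fin n → Ω → ℝ := fun i ω => ratio (mergeCoeff e a b) (Pi.single (e i) 1) (z ω)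
  have hfm : ∀ i, Measurable (f i) := fun i => (measurable_ratio _ _).comp hzm
  have hfb : ∀ i ω, |f i ω| ≤ 1 / κ := fun i ω => by
    refine abs_ratio_le hκ hc (fun k => ?_) (hz ω)
    rw [Pi.single_apply]
    split_ifs <;> simp
  have hff : ∀ i j, Integrable (fun ω => f i ω * f j ω) P := fun i j => by
    refine integrable_of_abs_le (W := 1 / κ * (1 / κ)) ((hfm i).mul (hfm j)) fun ω => ?_
    rw [abs_mul]
    exact mul_le_mul (hfb i ω) (hfb j ω) (abs_nonneg _) (by positivity)
  have hlin : ∀ (k : Fin (p + 1)) (v : Fin p → ℝ),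
      lin (Pi.single k 1) (fun j => v j ^ 2) = regressor v k := fun k v => by
    refine Fin.cases ?_ (fun j => ?_) k
    · simp [lin, regressor, Fin.succ_ne_zero]
    · simp [lin, regressor, Pi.single_apply, (Fin.succ_ne_zero _).symm]
  have hfe : ∀ i ω, f i ω = regressor (pastZ p X 1 ω) (e i) / sigmaSq q r a b (pastZ p X 1 ω) :=
    fun i ω => by
      rw [sigmaSq, subvec_dotProduct_add he, ← hlin]
      rfl
  have hE : ∀ i j, infoMatrix P q r a b X i j = ∫ ω, f i ω * f j ω ∂P := fun i j => by
    simp only [hfe, div_mul_div_comm, ← sq, he]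
    rcases i with i | i <;> rcases j with j | j <;> rfl
  have hratio : ∀ ω, ratio (mergeCoeff e a b) (mergeCoeff e a' b') (z ω)
      = ∑ i, Sum.elim a' b' i * f i ω := fun ω => by
    have h1 : lin (mergeCoeff e a' b') (z ω)
        = ∑ k, mergeCoeff e a' b' k * regressor (pastZ p X 1 ω) k := by
      rw [Fin.sum_univ_succ]
      simp only [regressor, Fin.cons_zero, Fin.cons_succ, mul_one]
      rfl
    rw [ratio, h1, ← e.sum_comp, Finset.sum_div]
    refine Finset.sum_congr rfl fun i _ => ?_
    rw [hfe, sigmaSq, subvec_dotProduct_add he, mul_div_assoc]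
    congr 1
    simp [mergeCoeff]
  have hsq : ∀ ω, ratio (mergeCoeff e a b) (mergeCoeff e a' b') (z ω) ^ 2
      = ∑ i, ∑ j, Sum.elim a' b' i * (Sum.elim a' b' j * (f i ω * f j ω)) := fun ω => by
    rw [hratio, sq, Finset.sum_mul_sum]
    refine Finset.sum_congr rfl fun i _ => Finset.sum_congr rfl fun j _ => ?_
    ring
  have hii : ∀ i j, Integrable
      (fun ω => Sum.elim a' b' i * (Sum.elim a' b' j * (f i ω * f j ω))) P :=
    fun i j => ((hff i j).const_mul _).const_mul _
  calc _ = ∑ i, ∑ j, Sum.elim a' b' i * (Sum.elim a' b' j * ∫ ω, f i ω * f j ω ∂P) := by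
        simp only [dotProduct, Matrix.mulVec, hE, Finset.mul_sum]
        refine Finset.sum_congr rfl fun i _ => Finset.sum_congr rfl fun j _ => ?_
        ring
    _ = ∫ ω, ∑ i, ∑ j, Sum.elim a' b' i * (Sum.elim a' b' j * (f i ω * f j ω)) ∂P := by
        rw [integral_finsetSum _ fun i _ => integrable_finsetSum _ fun j _ => hii i j]
        refine Finset.sum_congr rfl fun i _ => ?_
        rw [integral_finsetSum _ fun j _ => hii i j]
        simp only [integral_const_mul]
    _ = _ := integral_congr_ae (Eventually.of_forall fun ω => (hsq ω).symm)

end information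

/-! ### The likelihood ratio and the score in terms of the noise -/

/-- The perturbation `(M_t'g(t/T) + N_t'h) / σ_t²` of the conditional variance at time `t`, relative
to the conditional variance, as a function of the sample. -/
def relPert {p m n : ℕ} (e : Fin m ⊕ Fin n ≃ Fin (p + 1)) (T : ℕ) (α : ℝ → Fin m → ℝ)
    (β : Fin n → ℝ) (g : ℝ → Fin m → ℝ) (h : Fin n → ℝ) (x : Finset.Icc 1 p → ℝ) (t : ℕ)
    (y : Finset.Icc (p + 1) T → ℝ) : ℝ :=
  ratio (mergeCoeff e (α (t / T)) β) (mergeCoeff e (g (t / T)) h)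
    (fun j => past p (path x y) t j ^ 2)

section expansion

variable {p m n : ℕ} {q : Fin m → Fin (p + 1)} {r : Fin n → Fin (p + 1)} {T : ℕ}
  {α : ℝ → Fin m → ℝ} {β : Fin n → ℝ} {g : ℝ → Fin m → ℝ} {h : Fin n → ℝ}
  {x : Finset.Icc 1 p → ℝ}

lemma rescaled_mem_Icc {t : ℕ} (ht : t ∈ Finset.Icc (p + 1) T) :
    ((t : ℝ) / T) ∈ Set.Icc (0 : ℝ) 1 := by
  have ht' := Finset.mem_Icc.1 ht
  have hT : (0 : ℝ) < T := by exact_mod_cast (by omega : 0 < T)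
  exact ⟨by positivity, (div_le_one hT).2 (by exact_mod_cast ht'.2)⟩

variable {e : Fin m ⊕ Fin n ≃ Fin (p + 1)} (he : ⇑e = Sum.elim q r) {κ C D L ρ : ℝ}
  (hreg : RegularCoeffs (fun u => mergeCoeff e (α u) β) (fun u => mergeCoeff e (g u) h) κ C D L ρ)

include hreg in
lemma abs_relPert_le {t : ℕ} (ht : t ∈ Finset.Icc (p + 1) T) (y : Finset.Icc (p + 1) T → ℝ) :
    |relPert e T α β g h x t y| ≤ D / κ :=
  abs_ratio_le hreg.pos (hreg.lower _ (rescaled_mem_Icc ht)) (hreg.dir _ (rescaled_mem_Icc ht))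
    fun _ => sq_nonneg _

include he hreg

lemma condVar_pos {t : ℕ} (ht : t ∈ Finset.Icc (p + 1) T) (y : Finset.Icc (p + 1) T → ℝ) :
    0 < condVar q r T α β x t y := by
  rw [condVar_eq_lin he]
  exact hreg.pos.trans_le (le_lin_of_nonneg hreg.pos.le (hreg.lower _ (rescaled_mem_Icc ht))
    fun _ => sq_nonneg _)

lemma condVar_add_smul (s : ℝ) {t : ℕ} (ht : t ∈ Finset.Icc (p + 1) T)
    (y : Finset.Icc (p + 1) T → ℝ) :
    condVar q r T (fun u => α u + s • g u) (β + s • h) x t y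
      = condVar q r T α β x t y * (1 + s * relPert e T α β g h x t y) := by
  have hpos := condVar_pos (x := x) he hreg ht y
  rw [condVar_eq_lin he] at hpos
  rw [condVar_eq_lin he, condVar_eq_lin he, lin_mergeCoeff_add_smul, relPert, ratio]
  field_simp

lemma condVar_add_smul_pos {s : ℝ} (hs : |s| * (D / κ) < 1) {t : ℕ}
    (ht : t ∈ Finset.Icc (p + 1) T) (y : Finset.Icc (p + 1) T → ℝ) :
    0 < condVar q r T (fun u => α u + s • g u) (β + s • h) x t y := by
  rw [condVar_add_smul he hreg s ht]
  refine mul_pos (condVar_pos he hreg ht y) ?_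
  have h1 : |s * relPert e T α β g h x t y| < 1 := by
    rw [abs_mul]
    exact (mul_le_mul_of_nonneg_left (abs_relPert_le hreg ht y) (abs_nonneg s)).trans_lt hs
  linarith [(abs_lt.1 h1).1]

lemma score_eq_sum (y : Finset.Icc (p + 1) T → ℝ) :
    score q r T α β g h x y = 1 / (2 * √T) * ∑ t ∈ Finset.Icc (p + 1) T,
      (path x y t ^ 2 / condVar q r T α β x t y - 1) * relPert e T α β g h x t y := by
  rw [score]
  congr 1
  refine Finset.sum_congr rfl fun t ht => ?_
  have hpos := condVar_pos (x := x) he hreg ht y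
  rw [subvec_dotProduct_add he, relPert, ratio, ← condVar_eq_lin (α := α) (β := β) he]
  change (path x y t ^ 2 - condVar q r T α β x t y) / condVar q r T α β x t y ^ 2 * _ = _
  field_simp

lemma llr_condLaw_eq_sum (hpT : p ≤ T) {s : ℝ} (hs : |s| * (D / κ) < 1) :
    llr (condLaw q r T (fun u => α u + s • g u) (β + s • h) x) (condLaw q r T α β x)
      =ᵐ[condLaw q r T α β x] fun y => ∑ t ∈ Finset.Icc (p + 1) T,
        llrTerm (path x y t ^ 2 / condVar q r T α β x t y) (s * relPert e T α β g h x t y) := by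
  refine (llr_condLaw (fun t ht y => condVar_pos he hreg ht y)
    (fun t ht y => condVar_add_smul_pos he hreg hs ht y) hpT).trans (Eventually.of_forall fun y => ?_)
  refine Finset.sum_congr rfl fun t ht => ?_
  have h0 := condVar_pos (x := x) he hreg ht y
  have h1 := condVar_add_smul_pos (x := x) he hreg hs ht y
  rw [condVar_add_smul he hreg s ht] at h1 ⊢
  have h2 := pos_of_mul_pos_right h1 h0.le
  rw [llrTerm, mul_div_cancel_left₀ _ h0.ne']
  congr 1
  field_simp
  ring

variable {Ω : Type*} {ξ : ℤ → Ω → ℝ}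

/-- Along the sample driven by `ξ`, the standardized squares are the squares of the noise. -/
lemma sq_path_div_condVar_drivenSample {t : ℕ} (ht : t ∈ Finset.Icc (p + 1) T) (ω : Ω) :
    path x (drivenSample q r T α β x ξ ω) t ^ 2
      / condVar q r T α β x t (drivenSample q r T α β x ξ ω) = ξ t ω ^ 2 := by
  have hpos := condVar_pos (x := x) he hreg ht (drivenSample q r T α β x ξ ω)
  have h1 : sigmaSq q r (α (t / T)) β (past p (drivenPath q r T α β x ξ ω) t)
      = condVar q r T α β x t (drivenSample q r T α β x ξ ω) := by
    rw [condVar]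
    congr 1
    funext j
    simp only [past, path_drivenSample]
  rw [path_drivenSample, drivenPath_of_mem ht, h1, mul_pow, Real.sq_sqrt hpos.le,
    mul_div_cancel_right₀ _ hpos.ne']

end expansion

end TvARCH

end

theorem proposition2 {p m n : ℕ} (hm : 1 ≤ m) (hn : 1 ≤ n)
    -- the bipartition of the indices `{0, …, p}`
    (q : Fin m → Fin (p + 1)) (r : Fin n → Fin (p + 1)) (hq : StrictMono q) (hr : StrictMono r)
    (hqr : IsCompl (Set.range q) (Set.range r))
    -- the parameter `(α, β)` and the direction `(g, h)`
    (α : ℝ → Fin m → ℝ) (β : Fin n → ℝ) (g : ℝ → Fin m → ℝ) (h : Fin n → ℝ)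
    (hα : TvARCH.IsLipschitzVec α) (hg : TvARCH.IsLipschitzVec g)
    (hα_pos : ∀ u ∈ Set.Icc (0 : ℝ) 1, ∀ i, 0 < α u i) (hβ_pos : ∀ j, 0 < β j)
    (hc : ∃ c : ℝ, c < 1 ∧ ∀ u ∈ Set.Icc (0 : ℝ) 1, TvARCH.lagCoeffSum q r (α u) β ≤ c)
    -- the stationary ARCH processes `X u`, `u ∈ [0,1]`, with coefficients `(α(u), β)`
    {Ω : Type*} [MeasurableSpace Ω] (P : Measure Ω) [IsProbabilityMeasure P]
    (ξ : ℤ → Ω → ℝ) (hξ : TvARCH.IsGaussianNoise P ξ) (X : ℝ → ℤ → Ω → ℝ)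
    (hX : ∀ u ∈ Set.Icc (0 : ℝ) 1, TvARCH.IsStationaryARCH P ξ q r (α u) β (X u))
    -- the initial values `X_1 = x_1, …, X_p = x_p`
    (x : Finset.Icc 1 p → ℝ) :
    (∀ᶠ T : ℕ in atTop,
      TvARCH.condLaw q r T (fun u => α u + (√T)⁻¹ • g u) (β + (√T)⁻¹ • h) x
        ≪ TvARCH.condLaw q r T α β x) ∧
    (∀ ε : ℝ, 0 < ε → Tendsto (fun T : ℕ => TvARCH.condLaw q r T α β x
      {y | ε ≤ |llr (TvARCH.condLaw q r T (fun u => α u + (√T)⁻¹ • g u) (β + (√T)⁻¹ • h) x)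
            (TvARCH.condLaw q r T α β x) y
          - (TvARCH.score q r T α β g h x y - 1 / 2 * TvARCH.normSq P q r α β X g h)|})
      atTop (𝓝 0)) ∧
    TendstoInDistribution (fun (T : ℕ) y => TvARCH.score q r T α β g h x y) atTop
      (id : ℝ → ℝ) (fun T : ℕ => TvARCH.condLaw q r T α β x)
      (gaussianReal 0 (TvARCH.normSq P q r α β X g h).toNNReal) := by
  obtain ⟨c₀, hc₀, hsum⟩ := hc
  let e := TvARCH.indexEquiv q r hq hr hqr
  have he : ⇑e = Sum.elim q r := rfl
  have hp : p ≠ 0 := by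
    have := Fintype.card_congr e
    simp only [Fintype.card_sum, Fintype.card_fin] at this
    omega
  have hpos : ∀ u ∈ Set.Icc (0 : ℝ) 1, ∀ k, 0 < TvARCH.mergeCoeff e (α u) β k := fun u hu k => by
    unfold TvARCH.mergeCoeff
    rcases e.symm k with i | j
    · exact hα_pos u hu i
    · exact hβ_pos j
  obtain ⟨κ, C, D, L, ρ, hreg⟩ := TvARCH.exists_regularCoeffs hp (hα.mergeCoeff e β)
    (hg.mergeCoeff e h) hpos hc₀ fun u hu => by
      rw [← TvARCH.lagCoeffSum_eq he]; exact hsum u hu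
  have hκ := hreg.pos
  -- the sample, and the relative perturbation, on the probability space of the noise
  let Y : (T : ℕ) → Ω → Finset.Icc (p + 1) T → ℝ := fun T => TvARCH.drivenSample q r T α β x ξ
  have hY : ∀ T, Measurable (Y T) := fun T => TvARCH.measurable_drivenSample hξ
  have hlaw : ∀ T, TvARCH.condLaw q r T α β x = P.map (Y T) := fun T => TvARCH.condLaw_eq_map hξ
  let w : ℕ → ℕ → Ω → ℝ := fun T t ω => TvARCH.relPert e T α β g h x t (Y T ω)
  have hwr : ∀ T t ω, w T t ω = TvARCH.ratio (TvARCH.mergeCoeff e (α ((t : ℝ) / T)) β)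
      (TvARCH.mergeCoeff e (g ((t : ℝ) / T)) h)
      (TvARCH.pastZ p (TvARCH.drivenSq q r T α β x ξ) t ω) := fun T t ω => by
    rw [TvARCH.pastZ_drivenSq]; rfl
  have hZ : ∀ T : ℕ, TvARCH.IsSqARCH P ξ
      (fun t => TvARCH.mergeCoeff e (α ((t : ℝ) / T)) β) p T (TvARCH.drivenSq q r T α β x ξ) :=
    fun T => TvARCH.isSqARCH_drivenSq he fun u hu k => (hpos u hu k).le
  have hw : ∀ T t : ℕ, Measurable[TvARCH.noiseSigma ξ (Set.Iio (t : ℤ))] (w T t) := fun T t => by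
    rw [show w T t = _ from funext (hwr T t)]
    exact (TvARCH.measurable_ratio _ _).comp ((hZ T).measurable_pastZ t)
  have hW : ∀ T, ∀ t ∈ Finset.Icc (p + 1) T, ∀ ω, |w T t ω| ≤ D / κ :=
    fun T t ht ω => TvARCH.abs_relPert_le hreg ht _
  have hscore : ∀ T ω, TvARCH.score q r T α β g h x (Y T ω)
      = 1 / (2 * √T) * ∑ t ∈ Finset.Icc (p + 1) T, (ξ t ω ^ 2 - 1) * w T t ω := fun T ω => by
    rw [TvARCH.score_eq_sum he hreg]
    congr 1
    refine Finset.sum_congr rfl fun t ht => ?_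
    rw [TvARCH.sq_path_div_condVar_drivenSample he hreg ht]
  -- the limit of the averages of the squared relative perturbations
  let Q := ∫ u in (0 : ℝ)..1, TvARCH.meanSq P (fun u => TvARCH.mergeCoeff e (α u) β)
    (fun u => TvARCH.mergeCoeff e (g u) h) (fun u t ω => X u t ω ^ 2) u
  have hQ : Tendsto (fun T : ℕ => ∫ ω, |1 / T * ∑ t ∈ Finset.Icc (p + 1) T, w T t ω ^ 2 - Q| ∂P)
      atTop (𝓝 0) := by
    simp only [hwr]
    exact TvARCH.tendsto_integral_abs_average_sub hreg hξ
      (fun u hu => (hX u hu).isSqARCH he fun k => (hpos u hu k).le)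
      (fun u hu => (hX u hu).map_sq hξ) (Finset.sum_nonneg fun i _ => sq_nonneg _) hZ
      (fun T t ht => TvARCH.drivenSq_le ht)
  have hQ0 : 0 ≤ Q := intervalIntegral.integral_nonneg zero_le_one fun u _ =>
    integral_nonneg fun ω => sq_nonneg _
  have hnorm : TvARCH.normSq P q r α β X g h = 1 / 2 * Q := by
    rw [TvARCH.normSq]
    congr 1
    refine intervalIntegral.integral_congr fun u hu => ?_
    rw [Set.uIcc_of_le zero_le_one] at hu
    exact TvARCH.dotProduct_infoMatrix_mulVec he hξ (hX u hu) hκ (hreg.lower u hu) _ _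
  have hev : ∀ᶠ T : ℕ in atTop, p ≤ T ∧ |(√(T : ℝ))⁻¹| * (D / κ) < 1 := by
    have h1 : Tendsto (fun T : ℕ => |(√(T : ℝ))⁻¹| * (D / κ)) atTop (𝓝 (|0| * (D / κ))) :=
      ((tendsto_inv_atTop_zero.comp
        (Real.tendsto_sqrt_atTop.comp tendsto_natCast_atTop_atTop)).abs).mul_const _
    rw [abs_zero, zero_mul] at h1
    exact (eventually_ge_atTop p).and (h1.eventually (gt_mem_nhds one_pos))
  refine ⟨?_, fun ε hε => ?_, ?_⟩
  · filter_upwards [hev] with T ⟨hpT, hT⟩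
    exact TvARCH.condLaw_absolutelyContinuous (fun t ht y => TvARCH.condVar_pos he hreg ht y)
      (fun t ht y => TvARCH.condVar_add_smul_pos he hreg hT ht y) hpT
  · have hlim := TvARCH.tendsto_lintegral_abs_llr_sub hξ hw hW hQ
    have hε' : ENNReal.ofReal ε ≠ 0 := (ENNReal.ofReal_pos.2 hε).ne'
    have hlim' := ENNReal.Tendsto.div_const hlim (Or.inr hε')
    rw [ENNReal.zero_div] at hlim'
    refine tendsto_of_tendsto_of_tendsto_of_le_of_le' tendsto_const_nhds hlim'
      (Eventually.of_forall fun T => zero_le) ?_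
    filter_upwards [hev] with T ⟨hpT, hT⟩
    have hm : Measurable fun y => |llr (TvARCH.condLaw q r T (fun u => α u + (√T)⁻¹ • g u)
        (β + (√T)⁻¹ • h) x) (TvARCH.condLaw q r T α β x) y
          - (TvARCH.score q r T α β g h x y - 1 / 2 * TvARCH.normSq P q r α β X g h)| :=
      _root_.continuous_abs.measurable.comp
        ((measurable_llr _ _).sub ((TvARCH.measurable_score g h).sub_const _))
    have hllr := TvARCH.llr_condLaw_eq_sum (x := x) he hreg hpT hT
    have hae : ∀ {s : (Finset.Icc (p + 1) T → ℝ) → Prop},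
        (∀ᵐ y ∂TvARCH.condLaw q r T α β x, s y) → ∀ᵐ ω ∂P, s (Y T ω) := fun hs =>
      ae_of_ae_map (hY T).aemeasurable (by rwa [← hlaw T])
    have hint : ∀ f : (Finset.Icc (p + 1) T → ℝ) → ℝ≥0∞, Measurable f →
        ∫⁻ y, f y ∂TvARCH.condLaw q r T α β x = ∫⁻ ω, f (Y T ω) ∂P := fun f hf => by
      rw [hlaw T, lintegral_map hf (hY T)]
    refine ((measure_mono fun y hy => ENNReal.ofReal_le_ofReal hy).trans (meas_ge_le_lintegral_div
      hm.ennreal_ofReal.aemeasurable hε' ENNReal.ofReal_ne_top)).trans_eq ?_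
    congr 1
    rw [hint _ hm.ennreal_ofReal]
    refine lintegral_congr_ae ((hae hllr).mono fun ω hω => ?_)
    simp only
    rw [hω, hscore, hnorm]
    congr 3
    · refine Finset.sum_congr rfl fun t ht => ?_
      rw [TvARCH.sq_path_div_condVar_drivenSample he hreg ht, inv_mul_eq_div]
    · ring
  · refine ⟨fun T => (TvARCH.measurable_score g h).aemeasurable, aemeasurable_id, ?_⟩
    refine ProbabilityMeasure.tendsto_iff_tendsto_charFun.2 fun v => ?_
    have hlim := TvARCH.tendsto_integral_cexp_score hξ hw hW hQ0 hQ v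
    convert hlim using 2 with T
    · simp only [ProbabilityMeasure.coe_mk]
      rw [hlaw T, Measure.map_map (TvARCH.measurable_score g h) (hY T), charFun_apply_real,
        integral_map ((TvARCH.measurable_score g h).comp (hY T)).aemeasurable (by fun_prop)]
      simp only [Function.comp_apply, hscore]
      push_cast
      rfl
    · simp only [ProbabilityMeasure.coe_mk, Measure.map_id]
      rw [charFun_gaussianReal, hnorm, Real.coe_toNNReal _ (by positivity)]
      congr 2
      push_cast
      ring
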